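/- Let $\mathcal T$ be the infinite rooted binary tree with vertex set $\{0,1\}^*$ and edges $w\to w0$, $w\to w1$, and let the first Grigorchuk group $\Gamma\le \mathrm{Aut}(\mathcal T)$ be generated by the automorphisms $a,b,c,d$ which fix the root and satisfy, for all $w\in\{0,1\}^*$, $$a(0w)=1w,\quad a(1w)=0w,\quad b(0w)=0\,a(w),\quad b(1w)=1\,c(w),$$ $$c(0w)=0\,a(w),\quad c(1w)=1\,d(w),\quad d(0w)=0w,\quad d(1w)=1\,b(w).$$ **Theorem.** The conjugate pair problem in $\Gamma$ is solvable in linear time on a random access machine. That is, there are a single random access machine $M$ and a constant $C\in\mathbb N$ such that for every $k\ge 0$ and all (not necessarily reduced) words $w_1,\dots,w_k\in\{a,b,c,d\}^*$, with $n=|w_1|+\dots+|w_k|$, the machine $M$ on input $w_1,\dots,w_k$ halts after at most $C(n+1)$ steps and answers correctly whether there are indices $i\neq j$ such that $w_i$ and $w_j$ represent elements conjugate in $\Gamma$. Here a random access machine has a finite program, finitely many registers and a memory of cells indexed by $\mathbb N$, all holding natural numbers, initially $0$. Each of the following counts as one step: loading a constant into a register, copying a register, adding or subtracting (with truncation at $0$)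 two registers, loading from or storing to the memory cell whose address is in a register, reading the next input symbol into a register, and branching on whether a register is $0$. The input is read once from left to right and consists of the letters of $w_1$, an end marker, the letters of $w_2$, an end marker, and so on, each symbol coded by a fixed positive number; reading past the end gives $0$. Moreover, on such an input all numbers occurring in registers and memory cells of $M$ are at most $(n+2)^C$, i.e. they have $O(\log (n+2))$ bits. -/

import Mathlib

/-! ## The first Grigorchuk group -/

namespace Grigorchuk

/-- Edges `w → w0`, `w → w1` of the infinite rooted binary tree with vertex set `{0,1}*`.
Vertices are lists of booleans (`false` is `0`, `true` is `1`), first letter at the head. -/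
def Edge (u v : List Bool) : Prop := ∃ x : Bool, v = u ++ [x]

/-- The group of automorphisms of the infinite rooted binary tree, under composition. -/
abbrev TreeAut : Type := Edge ≃r Edge

/-- The group alphabet `X = {a, b, c, d}`. -/
inductive Letter : Type
  | a | b | c | d

/-- The action of the letters on the vertices of the tree. -/
def act : Letter → List Bool → List Bool
  | _, [] => []
  | .a, false :: w => true :: w
  | .a, true :: w => false :: w
  | .b, false :: w => false :: act .a w
  | .b, true :: w => true :: act .c w
  | .c, false :: w => false :: act .a w
  | .c, true :: w => true :: act .d w
  | .d, false :: w => false :: w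
  | .d, true :: w => true :: act .b w

theorem act_act (l : Letter) (w : List Bool) : act l (act l w) = w := by
  induction w generalizing l with
  | nil => cases l <;> rfl
  | cons x w ih => cases l <;> cases x <;> simp [act, ih]

theorem act_append (l : Letter) (w : List Bool) (x : Bool) :
    ∃ y : Bool, act l (w ++ [x]) = act l w ++ [y] := by
  induction w generalizing l with
  | nil => cases l <;> cases x <;> simp [act]
  | cons z w ih => cases l <;> cases z <;> simp [act, ih]

theorem edge_act {l : Letter} {u v : List Bool} (h : Edge u v) : Edge (act l u) (act l v) := by
  obtain ⟨x, rfl⟩ := h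
  exact act_append l u x

/-- The tree automorphisms `a`, `b`, `c`, `d`. -/
def gen (l : Letter) : TreeAut where
  toFun := act l
  invFun := act l
  left_inv := act_act l
  right_inv := act_act l
  map_rel_iff' := by
    intro u v
    refine ⟨fun h => ?_, fun h => edge_act h⟩
    have h' := edge_act (l := l) h
    simpa [act_act] using h'

/-- The first Grigorchuk group `Γ`: the group of tree automorphisms generated by
`a`, `b`, `c`, `d`. -/
def Gamma : Subgroup TreeAut := Subgroup.closure (Set.range gen)

/-- A letter, as an element of `Γ`. -/
def letterVal (l : Letter) : Gamma :=
  ⟨gen l, Subgroup.subset_closure (Set.mem_range_self l)⟩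

/-- The element of `Γ` represented by a word over `{a, b, c, d}`. -/
def wordVal (w : List Letter) : Gamma := (w.map letterVal).prod

/-- The list `w₁, …, w_k` has two entries, at different positions, which represent elements that
are conjugate in `Γ`. -/
def HasConjugatePair (ws : List (List Letter)) : Prop :=
  ∃ i j : Fin ws.length, i ≠ j ∧ IsConj (wordVal (ws.get i)) (wordVal (ws.get j))

/-- The total length `|w₁| + ⋯ + |w_k|`. -/
def totalLength (ws : List (List Letter)) : ℕ := (ws.map List.length).sum

/-- Numerical codes of the letters. -/
def Letter.code : Letter → ℕ
  | .a => 1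
  | .b => 2
  | .c => 3
  | .d => 4

/-- The input string of a list of words: the codes of the letters of each word, each word being
followed by the end marker `5` (so a list of `k` words has exactly `k` end markers). -/
def encode (ws : List (List Letter)) : List ℕ :=
  ws.flatMap fun w => w.map Letter.code ++ [5]

end Grigorchuk

/-! ## Random access machines

A random access machine with registers and a memory of cells indexed by the natural numbers, a
one-way read-only input, and instructions for constants, copying, addition, (truncated)
subtraction, indirect loading and storing, reading the next input symbol, and a zero test. There is
no multiplication. Every instruction takes one step. -/

namespace RAM

/-- The instructions, over a set `Λ` of program labels. The last argument (the last two in the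
case of `branch`) says which instruction is executed next. -/
inductive Instr (Λ : Type) : Type
  /-- `r ← n` -/
  | const (r n : ℕ) (next : Λ)
  /-- `r ← s` -/
  | move (r s : ℕ) (next : Λ)
  /-- `r ← s + t` -/
  | add (r s t : ℕ) (next : Λ)
  /-- `r ← max (s - t) 0` -/
  | sub (r s t : ℕ) (next : Λ)
  /-- `r ← mem[s]` -/
  | load (r s : ℕ) (next : Λ)
  /-- `mem[r] ← s` -/
  | store (r s : ℕ) (next : Λ)
  /-- `r ←` the next input symbol, or `0` if the input is exhausted -/
  | read (r : ℕ) (next : Λ)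
  /-- go to `ifZero` if `r` contains `0`, and to `ifPos` otherwise -/
  | branch (r : ℕ) (ifZero ifPos : Λ)
  /-- stop with the given answer -/
  | halt (answer : Bool)

/-- A program: a first label, and an instruction for each label. It is used with finite `Λ`
only, so that a program is a finite object and mentions finitely many registers. -/
structure Program (Λ : Type) : Type where
  start : Λ
  code : Λ → Instr Λ

/-- A configuration: the current label, the contents of the registers and of the memory cells,
and the part of the input that has not been read yet. -/
structure Config (Λ : Type) : Type where
  label : Λ
  reg : ℕ → ℕ
  mem : ℕ → ℕ
  input : List ℕ

variable {Λ : Type}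

/-- The initial configuration: all registers and memory cells contain `0`. -/
def Program.init (P : Program Λ) (input : List ℕ) : Config Λ where
  label := P.start
  reg := fun _ => 0
  mem := fun _ => 0
  input := input

/-- Execute one instruction (nothing changes once `halt` is reached). -/
def Program.step (P : Program Λ) (s : Config Λ) : Config Λ :=
  match P.code s.label with
  | .const r n q => { s with label := q, reg := Function.update s.reg r n }
  | .move r i q => { s with label := q, reg := Function.update s.reg r (s.reg i) }
  | .add r i j q => { s with label := q, reg := Function.update s.reg r (s.reg i + s.reg j) }
  | .sub r i j q => { s with label := q, reg := Function.update s.reg r (s.reg i - s.reg j) }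
  | .load r i q => { s with label := q, reg := Function.update s.reg r (s.mem (s.reg i)) }
  | .store r i q => { s with label := q, mem := Function.update s.mem (s.reg r) (s.reg i) }
  | .read r q =>
    { s with label := q, reg := Function.update s.reg r (s.input.headD 0), input := s.input.tail }
  | .branch r q₀ q₁ => { s with label := if s.reg r = 0 then q₀ else q₁ }
  | .halt _ => s

/-- The configuration after `t` steps on the given input. -/
def Program.run (P : Program Λ) (input : List ℕ) (t : ℕ) : Config Λ :=
  P.step^[t] (P.init input)

/-- On the given input, `P` stops with the given answer after at most `T` steps. -/
def Program.AnswersWithin (P : Program Λ) (input : List ℕ) (T : ℕ) (answer : Bool) : Prop :=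
  ∃ t ≤ T, P.code (P.run input t).label = .halt answer

/-- On the given input, all numbers that ever occur in a register or a memory cell of `P` are at
most `B`. -/
def Program.NumbersBoundedBy (P : Program Λ) (input : List ℕ) (B : ℕ) : Prop :=
  ∀ t i : ℕ, (P.run input t).reg i ≤ B ∧ (P.run input t).mem i ≤ B

end RAM

/-!
# The conjugate pair problem in the first Grigorchuk group

Every element `g` of the group either fixes the first level of the tree and has two sections `g₀`,
`g₁`, or it is `(g₀, g₁) a`. Let `K` be the normal closure of `(ab)²`. It has finite index, and it
is branching: every pair of elements of `K` is the pair of sections of an element of `K`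
(`exists_mem_K`). For this reason the `K`-conjugacy class of an element is determined by the
classes of `g₀` and `g₁` in the first case (`cls_eq_of_even`), and by the class of `g₀ g₁` and the
coset of `g₀` in the second (`cls_eq_of_odd`). These data are called the key of the element. Two
elements `g` and `h` are conjugate if and only if the `K`-class of `h` is among the finitely many
classes `conjCls g p` of the conjugates `x g x⁻¹`, where `p` runs over the cosets `x K`
(`isConj_iff_conjCls`); and the keys of the elements of `conjCls g p` are known from the classes
`conjCls` of the sections of `g` (or of `g₀ g₁`) and a finite table (`keyOf_conj_even`,
`keyOf_conj_odd`).

So classes can be numbered, and the numbers of all `conjCls g p` can be found from the numbers for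
the shorter words which represent the sections, by means of a dictionary from keys to numbers. All
elements of a numbered class have their keys in the dictionary, hence an element of an old class
is recognized and one of a new class gets a new number (`Consistent`, `eval_classify`). The
recursion ends at words without the letter `a`, whose values are generators or trivial. The
conjugates of these elements have constant numbers, which are in the dictionary from the
beginning; this is possible since the classes in their keys are again of this kind
(`assigned_seedIds`).

The time is linear because the sections get shorter with respect to suitable weights of the
letters: if `w` is conjugated by its first run of letters `b`, `c`, `d`, and adjacent letters of
this kind are multiplied, then the words for the two sections together have weight at most `5/6`
of that of `w` (`weight_split`). The lengths of all words which occur have therefore a linear sum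
(`potential_split`). This fails to count empty words; but two empty words in the input are a
conjugate pair already, and with at most one of them the number of words is linear, too.

A pair of numbers is a key of the dictionary, which needs an address for every pair. The pair
`(u, v)` gets the address `u M + v`, where `M` exceeds all numbers of classes. In the absence of
multiplication, a table of the multiples of `M` is extended with every new number. The memory is
used sparsely, and its initial content `0` marks the keys without a number.

The machine is obtained from a structured program with named registers and arrays, whose variables
can only grow by `1` in a step, except for an accumulator, in which sums of them are formed, and
the table of multiples of `M`; this bounds all numbers by a polynomial in the time (`RAM.Exec.answers`).
-/

namespace Grigorchuk

/-! ### Sections of elements of the group -/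

/-- `g` acts on the first letter of a vertex by `x ↦ x + ε`, and on the subtree which it maps to
the subtree below the letter `e` by `s e`. -/
def Dec (g : TreeAut) (ε : Bool) (s : Bool → Gamma) : Prop :=
  g [] = [] ∧ ∀ x v, g (x :: v) = (x ^^ ε) :: (s (x ^^ ε)).1 v

theorem Dec.one : Dec 1 false (fun _ => 1) := ⟨rfl, fun x v => by simp⟩

theorem Dec.mul {g h : TreeAut} {ε η : Bool} {s t : Bool → Gamma} (hg : Dec g ε s)
    (hh : Dec h η t) : Dec (g * h) (ε ^^ η) (fun e => s e * t (e ^^ ε)) := by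
  refine ⟨by rw [RelIso.mul_apply, hh.1, hg.1], fun x v => ?_⟩
  rw [RelIso.mul_apply, hh.2, hg.2]
  have e1 : ((x ^^ η) ^^ ε) = (x ^^ (ε ^^ η)) := by cases x <;> cases η <;> cases ε <;> rfl
  have e2 : ((x ^^ (ε ^^ η)) ^^ ε) = (x ^^ η) := by cases x <;> cases η <;> cases ε <;> rfl
  beta_reduce
  rw [e1, e2]
  rfl

theorem Dec.inv {g : TreeAut} {ε : Bool} {s : Bool → Gamma} (hg : Dec g ε s) :
    Dec g⁻¹ ε (fun e => (s (e ^^ ε))⁻¹) := by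
  refine ⟨?_, fun x v => ?_⟩
  · apply g.injective
    rw [RelIso.apply_inv_self, hg.1]
  · apply g.injective
    rw [RelIso.apply_inv_self, hg.2]
    have e1 : ((x ^^ ε) ^^ ε) = x := by cases x <;> cases ε <;> rfl
    beta_reduce
    rw [e1, Subgroup.coe_inv, RelIso.apply_inv_self]

theorem Dec.gen (l : Letter) : ∃ ε s, Dec (gen l) ε s := by
  cases l
  · exact ⟨true, fun _ => 1, rfl, fun x v => by cases x <;> rfl⟩
  · exact ⟨false, fun e => if e then letterVal .c else letterVal .a, rfl,
      fun x v => by cases x <;> rfl⟩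
  · exact ⟨false, fun e => if e then letterVal .d else letterVal .a, rfl,
      fun x v => by cases x <;> rfl⟩
  · exact ⟨false, fun e => if e then letterVal .b else 1, rfl,
      fun x v => by cases x <;> rfl⟩

theorem exists_dec (g : Gamma) : ∃ ε s, Dec g.1 ε s := by
  obtain ⟨g, hg⟩ := g
  induction hg using Subgroup.closure_induction with
  | mem x hx => obtain ⟨l, rfl⟩ := hx; exact Dec.gen l
  | one => exact ⟨_, _, Dec.one⟩
  | mul x y _ _ hx hy =>
    obtain ⟨_, _, hx⟩ := hx
    obtain ⟨_, _, hy⟩ := hy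
    exact ⟨_, _, hx.mul hy⟩
  | inv x _ hx =>
    obtain ⟨_, _, hx⟩ := hx
    exact ⟨_, _, hx.inv⟩

/-- Whether `g` interchanges the two subtrees below the root. -/
noncomputable def par (g : Gamma) : Bool := (exists_dec g).choose

/-- The section of `g` which lands in the subtree below the letter `e`. -/
noncomputable def sect (g : Gamma) : Bool → Gamma := (exists_dec g).choose_spec.choose

theorem dec_par_sect (g : Gamma) : Dec g.1 (par g) (sect g) :=
  (exists_dec g).choose_spec.choose_spec

theorem Dec.unique {g : TreeAut} {ε η : Bool} {s t : Bool → Gamma} (h : Dec g ε s)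
    (h' : Dec g η t) : ε = η ∧ s = t := by
  have e : ε = η := by
    have := (h.2 false []).symm.trans (h'.2 false [])
    simpa using (List.cons.inj this).1
  subst e
  refine ⟨rfl, funext fun e => Subtype.ext (RelIso.ext fun v => ?_)⟩
  have := (h.2 (e ^^ ε) v).symm.trans (h'.2 (e ^^ ε) v)
  have e1 : ((e ^^ ε) ^^ ε) = e := by cases e <;> cases ε <;> rfl
  rw [e1] at this
  exact (List.cons.inj this).2

theorem Dec.par_eq {g : Gamma} {ε : Bool} {s : Bool → Gamma} (h : Dec g.1 ε s) : par g = ε :=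
  ((dec_par_sect g).unique h).1

theorem Dec.sect_eq {g : Gamma} {ε : Bool} {s : Bool → Gamma} (h : Dec g.1 ε s) : sect g = s :=
  ((dec_par_sect g).unique h).2

theorem ext_sect {g h : Gamma} (h0 : par g = par h) (h1 : ∀ e, sect g e = sect h e) : g = h := by
  apply Subtype.ext
  apply RelIso.ext
  rintro (_ | ⟨x, v⟩)
  · rw [(dec_par_sect g).1, (dec_par_sect h).1]
  · rw [(dec_par_sect g).2, (dec_par_sect h).2, h0, h1]

@[simp] theorem par_one : par 1 = false := Dec.par_eq (g := 1) Dec.one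
@[simp] theorem sect_one (e : Bool) : sect 1 e = 1 := by rw [Dec.sect_eq (g := 1) Dec.one]

@[simp] theorem par_mul (g h : Gamma) : par (g * h) = (par g ^^ par h) :=
  Dec.par_eq (g := g * h) ((dec_par_sect g).mul (dec_par_sect h))

@[simp] theorem sect_mul (g h : Gamma) (e : Bool) :
    sect (g * h) e = sect g e * sect h (e ^^ par g) := by
  rw [Dec.sect_eq (g := g * h) ((dec_par_sect g).mul (dec_par_sect h))]

@[simp] theorem par_inv (g : Gamma) : par g⁻¹ = par g :=
  Dec.par_eq (g := g⁻¹) (dec_par_sect g).inv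

@[simp] theorem sect_inv (g : Gamma) (e : Bool) : sect g⁻¹ e = (sect g (e ^^ par g))⁻¹ := by
  rw [Dec.sect_eq (g := g⁻¹) (dec_par_sect g).inv]

/-- The generator `a`, as an element of the group. -/
noncomputable abbrev ga : Gamma := letterVal .a
/-- The generator `b`, as an element of the group. -/
noncomputable abbrev gb : Gamma := letterVal .b
/-- The generator `c`, as an element of the group. -/
noncomputable abbrev gc : Gamma := letterVal .c
/-- The generator `d`, as an element of the group. -/
noncomputable abbrev gd : Gamma := letterVal .d

theorem dec_a : Dec ga.1 true (fun _ => 1) := ⟨rfl, fun x v => by cases x <;> rfl⟩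
theorem dec_b : Dec gb.1 false (fun e => if e then gc else ga) :=
  ⟨rfl, fun x v => by cases x <;> rfl⟩
theorem dec_c : Dec gc.1 false (fun e => if e then gd else ga) :=
  ⟨rfl, fun x v => by cases x <;> rfl⟩
theorem dec_d : Dec gd.1 false (fun e => if e then gb else 1) :=
  ⟨rfl, fun x v => by cases x <;> rfl⟩

@[simp] theorem par_a : par ga = true := dec_a.par_eq
@[simp] theorem par_b : par gb = false := dec_b.par_eq
@[simp] theorem par_c : par gc = false := dec_c.par_eq
@[simp] theorem par_d : par gd = false := dec_d.par_eq
@[simp] theorem sect_a (e : Bool) : sect ga e = 1 := by rw [dec_a.sect_eq]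
@[simp] theorem sect_b_false : sect gb false = ga := by rw [dec_b.sect_eq]; rfl
@[simp] theorem sect_b_true : sect gb true = gc := by rw [dec_b.sect_eq]; rfl
@[simp] theorem sect_c_false : sect gc false = ga := by rw [dec_c.sect_eq]; rfl
@[simp] theorem sect_c_true : sect gc true = gd := by rw [dec_c.sect_eq]; rfl
@[simp] theorem sect_d_false : sect gd false = 1 := by rw [dec_d.sect_eq]; rfl
@[simp] theorem sect_d_true : sect gd true = gb := by rw [dec_d.sect_eq]; rfl

@[simp] theorem letterVal_mul_self (l : Letter) : letterVal l * letterVal l = 1 :=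
  Subtype.ext (RelIso.ext fun w => act_act l w)

@[simp] theorem letterVal_inv (l : Letter) : (letterVal l)⁻¹ = letterVal l :=
  inv_eq_of_mul_eq_one_left (letterVal_mul_self l)

theorem act_bcd (w : List Bool) :
    act .b (act .c w) = act .d w ∧ act .c (act .d w) = act .b w ∧ act .d (act .b w) = act .c w := by
  induction w with
  | nil => simp [act]
  | cons x w ih =>
    obtain ⟨h1, h2, h3⟩ := ih
    cases x <;> simp [act, act_act, h1, h2, h3]

theorem gb_mul_gc : gb * gc = gd := Subtype.ext (RelIso.ext fun w => (act_bcd w).1)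
theorem gc_mul_gd : gc * gd = gb := Subtype.ext (RelIso.ext fun w => (act_bcd w).2.1)
theorem gd_mul_gb : gd * gb = gc := Subtype.ext (RelIso.ext fun w => (act_bcd w).2.2)
theorem gc_mul_gb : gc * gb = gd := by
  have := congrArg (·⁻¹) gb_mul_gc
  simpa using this
theorem gd_mul_gc : gd * gc = gb := by
  have := congrArg (·⁻¹) gc_mul_gd
  simpa using this
theorem gb_mul_gd : gb * gd = gc := by
  have := congrArg (·⁻¹) gd_mul_gb
  simpa using this

@[simp] theorem wordVal_nil : wordVal [] = 1 := rfl
@[simp] theorem wordVal_cons (l : Letter) (w : List Letter) :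
    wordVal (l :: w) = letterVal l * wordVal w := by simp [wordVal]
@[simp] theorem wordVal_append (v w : List Letter) :
    wordVal (v ++ w) = wordVal v * wordVal w := by simp [wordVal]

theorem exists_wordVal (g : Gamma) : ∃ w, wordVal w = g := by
  obtain ⟨g, hg⟩ := g
  induction hg using Subgroup.closure_induction with
  | mem x hx => obtain ⟨l, rfl⟩ := hx; exact ⟨[l], by simp [letterVal]⟩
  | one => exact ⟨[], rfl⟩
  | mul x y hx' hy' hx hy =>
    obtain ⟨v, hx⟩ := hx
    obtain ⟨w, hy⟩ := hy
    exact ⟨v ++ w, by rw [wordVal_append, hx, hy]; rfl⟩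
  | inv x hx' hx =>
    obtain ⟨v, hx⟩ := hx
    refine ⟨v.reverse, ?_⟩
    have : wordVal v.reverse = (wordVal v)⁻¹ := by
      clear hx
      induction v with
      | nil => simp
      | cons l v ih => simp [ih]
    rw [this, hx]; rfl

/-! ### A branching normal subgroup of finite index -/

/-- The normal closure of `(ab)²`. It has finite index, and contains with `k₀` and `k₁` also the
element which fixes the first level and acts as `k₀` and `k₁` on the two subtrees. -/
noncomputable def K : Subgroup Gamma := Subgroup.normalClosure {(ga * gb) * (ga * gb)}

instance : K.Normal := Subgroup.normalClosure_normal

/-- The quotient by the branching subgroup. -/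
abbrev G : Type := Gamma ⧸ K

/-- The quotient map. -/
noncomputable abbrev toG : Gamma →* G := QuotientGroup.mk' K

theorem toG_eq_one {g : Gamma} : toG g = 1 ↔ g ∈ K := QuotientGroup.eq_one_iff g

theorem toG_surj (p : G) : ∃ x, toG x = p := QuotientGroup.mk'_surjective K p

theorem toG_letter_sq (l : Letter) : toG (letterVal l) * toG (letterVal l) = 1 := by
  rw [← map_mul, letterVal_mul_self, map_one]

theorem toG_a_mul_b : toG ga * toG gb = toG gb * toG ga := by
  have h : toG ((ga * gb) * (ga * gb)) = 1 :=
    toG_eq_one.2 (Subgroup.subset_normalClosure (Set.mem_singleton _))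
  have ha := toG_letter_sq .a
  have hb := toG_letter_sq .b
  rw [map_mul, map_mul] at h
  have h' := eq_inv_of_mul_eq_one_left h
  rwa [mul_inv_rev, inv_eq_of_mul_eq_one_left ha, inv_eq_of_mul_eq_one_left hb] at h'

theorem toG_b_mul_d : toG gb * toG gd = toG gd * toG gb := by
  rw [← map_mul, ← map_mul, gb_mul_gd, gd_mul_gb]

/-- `(bada)² = ((ab)², 1)` lies in `K`. -/
theorem bada_mem : (gb * (ga * gd * ga)) * (gb * (ga * gd * ga)) ∈ K := by
  rw [← toG_eq_one]
  simp only [map_mul]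
  have hc : Commute (toG gb) (toG ga * toG gd * toG ga) :=
    (Commute.mul_right (Commute.mul_right toG_a_mul_b.symm toG_b_mul_d) toG_a_mul_b.symm)
  have ha := toG_letter_sq .a
  have hb := toG_letter_sq .b
  have hd := toG_letter_sq .d
  calc _ = (toG gb * toG gb) * ((toG ga * toG gd * toG ga) * (toG ga * toG gd * toG ga)) := by
          rw [mul_assoc, ← mul_assoc (toG ga * toG gd * toG ga), ← hc.eq]; simp only [mul_assoc]
    _ = toG ga * toG gd * (toG ga * toG ga) * toG gd * toG ga := by
      rw [hb]; simp only [mul_assoc, one_mul]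
    _ = 1 := by
      rw [ha, mul_one, mul_assoc (toG ga), hd, mul_one, ha]

/-- Every element is a section of an element fixing the first level; it suffices to see this for the
sections `a` of `b`, `b` of `ada`, `c` of `aba` and `d` of `aca`. -/
theorem exists_sect_false (g : Gamma) : ∃ y, par y = false ∧ sect y false = g := by
  obtain ⟨w, rfl⟩ := exists_wordVal g
  induction w with
  | nil => exact ⟨1, by simp⟩
  | cons l w ih =>
    obtain ⟨y, h0, h1⟩ := ih
    cases l
    · exact ⟨gb * y, by simp [h0, h1]⟩
    · exact ⟨(ga * gd * ga) * y, by simp [h0, h1]⟩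
    · exact ⟨(ga * gb * ga) * y, by simp [h0, h1]⟩
    · exact ⟨(ga * gc * ga) * y, by simp [h0, h1]⟩

/-- For `k` in `K`, the pair `(k, 1)` is a product of conjugates of `((ab)², 1)` and its inverse. -/
theorem exists_mem_K_left {k : Gamma} (hk : k ∈ K) :
    ∃ x ∈ K, par x = false ∧ sect x false = k ∧ sect x true = 1 := by
  induction hk using Subgroup.closure_induction with
  | mem x hx =>
    obtain ⟨t, ht, hx⟩ := Group.mem_conjugatesOfSet_iff.1 hx
    obtain rfl := Set.mem_singleton_iff.1 ht
    obtain ⟨g, rfl⟩ := isConj_iff.1 hx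
    obtain ⟨y, hy0, rfl⟩ := exists_sect_false g
    refine ⟨y * ((gb * (ga * gd * ga)) * (gb * (ga * gd * ga))) * y⁻¹,
      Subgroup.Normal.conj_mem inferInstance _ bada_mem _, ?_, ?_, ?_⟩ <;> simp [hy0]
  | one => exact ⟨1, K.one_mem, by simp⟩
  | mul x y _ _ hx hy =>
    obtain ⟨x', hx, h0, h1, h2⟩ := hx
    obtain ⟨y', hy, h3, h4, h5⟩ := hy
    exact ⟨x' * y', K.mul_mem hx hy, by simp [*]⟩
  | inv x _ hx =>
    obtain ⟨x', hx, h0, h1, h2⟩ := hx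
    exact ⟨x'⁻¹, K.inv_mem hx, by simp [*]⟩

/-- `K` is branching: it contains every pair of elements of `K`. -/
theorem exists_mem_K {k : Bool → Gamma} (hk : ∀ e, k e ∈ K) :
    ∃ x ∈ K, par x = false ∧ ∀ e, sect x e = k e := by
  obtain ⟨x, hx, h0, h1, h2⟩ := exists_mem_K_left (hk false)
  obtain ⟨y, hy, h3, h4, h5⟩ := exists_mem_K_left (hk true)
  have hy' : ga * y * ga ∈ K := by
    have := (inferInstance : K.Normal).conj_mem y hy ga
    rwa [letterVal_inv] at this
  refine ⟨x * (ga * y * ga), K.mul_mem hx hy', by simp [*], fun e => ?_⟩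
  cases e <;> simp [*]

theorem adad_sq : (ga * gd * (ga * gd)) * (ga * gd * (ga * gd)) = 1 := by
  apply ext_sect
  · simp
  · intro e
    cases e <;> simp

/-- The quotient consists of the elements `βⁱ (αδ)ʲ αᵏ`, where `α`, `β`, `δ` are the images of `a`,
`b`, `d`: the image `β` is central, and `αδ` has finite order and is inverted by `α`. -/
instance : Finite G := by
  set α := toG ga with hα
  set β := toG gb with hβ
  set δ := toG gd with hδ
  set ρ := α * δ with hρ
  have ha : α * α = 1 := toG_letter_sq .a
  have hb : β * β = 1 := toG_letter_sq .b
  have hd : δ * δ = 1 := toG_letter_sq .d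
  have hr : ρ ^ 4 = 1 := by
    have := congrArg toG adad_sq
    simp only [map_mul, map_one] at this
    rw [← this, pow_succ, pow_succ, pow_two]; simp only [hρ, hα, hδ, mul_assoc]
  have hab : Commute α β := toG_a_mul_b
  have hbd : Commute β δ := toG_b_mul_d
  have hbr : Commute β ρ := hab.symm.mul_right hbd
  have ha' : α⁻¹ = α := inv_eq_of_mul_eq_one_left ha
  have hd' : δ⁻¹ = δ := inv_eq_of_mul_eq_one_left hd
  have har : ∀ j : ℤ, α * ρ ^ j = ρ ^ (-j) * α := by
    intro j
    have : α * ρ * α⁻¹ = ρ⁻¹ := by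
      rw [hρ, mul_inv_rev, ha', hd', ← mul_assoc, ha, one_mul]
    have h2 := conj_zpow (i := j) (a := α) (b := ρ)
    rw [this, inv_zpow, ← zpow_neg] at h2
    rw [h2, mul_assoc, inv_mul_cancel, mul_one]
  have fin : ∀ g : G, ∀ n, n ≠ 0 → g ^ n = 1 → (Set.range fun j : ℤ => g ^ j).Finite := by
    intro g n hn h
    have : IsOfFinOrder g := isOfFinOrder_iff_pow_eq_one.2 ⟨n, Nat.pos_of_ne_zero hn, h⟩
    have h2 := this.finite_zpowers
    exact h2
  have key : ∀ w, ∃ i j k : ℤ, toG (wordVal w) = β ^ i * ρ ^ j * α ^ k := by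
    intro w
    induction w with
    | nil => exact ⟨0, 0, 0, by simp⟩
    | cons l w ih =>
      obtain ⟨i, j, k, ih⟩ := ih
      have hA : ∀ i j k : ℤ, α * (β ^ i * ρ ^ j * α ^ k) = β ^ i * ρ ^ (-j) * α ^ (1 + k) := by
        intro i j k
        rw [← mul_assoc, ← mul_assoc, (hab.zpow_right i).eq, mul_assoc (β ^ i), har, zpow_one_add]
        simp only [mul_assoc]
      have hR : ∀ i j k : ℤ, ρ * (β ^ i * ρ ^ j * α ^ k) = β ^ i * ρ ^ (1 + j) * α ^ k := by
        intro i j k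
        rw [← mul_assoc, ← mul_assoc, (hbr.symm.zpow_right i).eq, zpow_one_add]
        simp only [mul_assoc]
      have hB : ∀ i j k : ℤ, β * (β ^ i * ρ ^ j * α ^ k) = β ^ (1 + i) * ρ ^ j * α ^ k := by
        intro i j k
        rw [zpow_one_add]
        simp only [mul_assoc]
      have hD : δ = α * ρ := by rw [hρ, ← mul_assoc, ha, one_mul]
      rw [wordVal_cons, map_mul, ih]
      cases l
      · exact ⟨_, _, _, hA i j k⟩
      · exact ⟨_, _, _, hB i j k⟩
      · refine ⟨1 + i, -(1 + j), 1 + k, ?_⟩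
        have : toG gc = β * δ := by rw [hβ, hδ, ← map_mul, gb_mul_gd]
        rw [this, hD, mul_assoc, mul_assoc, hR, hA, hB]
      · refine ⟨i, -(1 + j), 1 + k, ?_⟩
        change δ * _ = _
        rw [hD, mul_assoc, hR, hA]
  have hfin := (((fin β 2 two_ne_zero (by rw [pow_two, hb])).mul (fin ρ 4 four_ne_zero hr)).mul
    (fin α 2 two_ne_zero (by rw [pow_two, ha])))
  refine Set.finite_univ_iff.1 (hfin.subset fun p _ => ?_)
  obtain ⟨g, rfl⟩ := toG_surj p
  obtain ⟨w, rfl⟩ := exists_wordVal g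
  obtain ⟨i, j, k, h⟩ := key w
  rw [h]
  exact Set.mul_mem_mul (Set.mul_mem_mul ⟨i, rfl⟩ ⟨j, rfl⟩) ⟨k, rfl⟩

end Grigorchuk

namespace Grigorchuk

/-! ### Conjugacy under the branching subgroup -/

/-- Conjugacy by an element of `K`. -/
def kSetoid : Setoid Gamma where
  r g h := ∃ k ∈ K, k * g * k⁻¹ = h
  iseqv :=
    { refl := fun g => ⟨1, K.one_mem, by simp⟩
      symm := by
        rintro g _ ⟨k, hk, rfl⟩
        exact ⟨k⁻¹, K.inv_mem hk, by group⟩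
      trans := by
        rintro g _ _ ⟨k, hk, rfl⟩ ⟨l, hl, rfl⟩
        exact ⟨l * k, K.mul_mem hl hk, by group⟩ }

/-- The set of `K`-conjugacy classes. -/
abbrev KClass : Type := Quotient kSetoid

/-- The `K`-conjugacy class of an element. -/
def cls (g : Gamma) : KClass := Quotient.mk kSetoid g

theorem cls_eq {g h : Gamma} : cls g = cls h ↔ ∃ k ∈ K, k * g * k⁻¹ = h :=
  ⟨fun e => Quotient.exact e, fun e => Quotient.sound e⟩

/-- The `K`-conjugacy class of `x g x⁻¹`, where `x` is any element of the coset `p`. -/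
noncomputable def conjCls (g : Gamma) (p : G) : KClass :=
  cls (p.out * g * p.out⁻¹)

theorem cls_conj_eq_of_toG_eq {g x y : Gamma} (h : toG x = toG y) :
    cls (x * g * x⁻¹) = cls (y * g * y⁻¹) := by
  refine cls_eq.2 ⟨y * x⁻¹, ?_, by group⟩
  rw [← toG_eq_one, map_mul, map_inv, h, mul_inv_cancel]

theorem conjCls_toG (g x : Gamma) : conjCls g (toG x) = cls (x * g * x⁻¹) :=
  cls_conj_eq_of_toG_eq (QuotientGroup.out_eq' (toG x))

theorem conjCls_one (g : Gamma) : conjCls g 1 = cls g := by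
  rw [← map_one toG, conjCls_toG]; simp

theorem conjCls_conj (g x : Gamma) (p : G) : conjCls (x * g * x⁻¹) p = conjCls g (p * toG x) := by
  obtain ⟨y, rfl⟩ := toG_surj p
  rw [← map_mul, conjCls_toG, conjCls_toG,
    show y * (x * g * x⁻¹) * y⁻¹ = y * x * g * (y * x)⁻¹ by group]

theorem cls_eq_conjCls_iff {g h : Gamma} {p : G} :
    cls h = conjCls g p ↔ ∃ x, toG x = p ∧ x * g * x⁻¹ = h := by
  obtain ⟨y, rfl⟩ := toG_surj p
  rw [conjCls_toG]
  constructor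
  · intro e
    obtain ⟨k, hk, rfl⟩ := cls_eq.1 e.symm
    exact ⟨k * y, by rw [map_mul, toG_eq_one.2 hk, one_mul], by group⟩
  · rintro ⟨x, hx, rfl⟩
    exact cls_conj_eq_of_toG_eq hx

/-- Conjugacy in the whole group, in terms of `K`-conjugacy classes. -/
theorem isConj_iff_conjCls {g h : Gamma} : IsConj g h ↔ ∃ p, conjCls g p = cls h := by
  rw [isConj_iff]
  constructor
  · rintro ⟨x, rfl⟩
    exact ⟨toG x, conjCls_toG g x⟩
  · rintro ⟨p, hp⟩
    obtain ⟨x, -, hx⟩ := cls_eq_conjCls_iff.1 hp.symm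
    exact ⟨x, hx⟩

theorem sect_conj (g x : Gamma) (e : Bool) :
    sect (x * g * x⁻¹) e = sect x e * sect g (e ^^ par x) * (sect x (e ^^ par g))⁻¹ := by
  have : (((e ^^ (par x ^^ par g))) ^^ par x) = (e ^^ par g) := by
    cases e <;> cases par x <;> cases par g <;> rfl
  simp [this]

theorem par_conj (g x : Gamma) : par (x * g * x⁻¹) = par g := by
  simp only [par_mul, par_inv]
  cases par x <;> cases par g <;> rfl

/-- An element fixing the first level is determined up to `K`-conjugacy by the `K`-conjugacy
classes of its two sections. -/
theorem cls_eq_of_even {g h : Gamma} (hg : par g = false) (hh : par h = false)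
    (hs : ∀ e, cls (sect g e) = cls (sect h e)) : cls g = cls h := by
  choose k hk hkg using fun e => cls_eq.1 (hs e)
  obtain ⟨x, hx, hx0, hx1⟩ := exists_mem_K hk
  refine cls_eq.2 ⟨x, hx, ext_sect (by rw [par_conj, hg, hh]) fun e => ?_⟩
  rw [sect_conj, hx0, hg, Bool.xor_false, hx1, hkg]

/-- An element `(g₀, g₁) a` is determined up to `K`-conjugacy by the `K`-conjugacy class of
`g₀ g₁` and the coset of `g₀`: if `k₀` conjugates `g₀ g₁` to `h₀ h₁`, then `(k₀, h₀⁻¹ k₀ g₀)`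
conjugates `(g₀, g₁) a` to `(h₀, h₁) a`. -/
theorem cls_eq_of_odd {g h : Gamma} (hg : par g = true) (hh : par h = true)
    (hs : cls (sect g false * sect g true) = cls (sect h false * sect h true))
    (hq : toG (sect g false) = toG (sect h false)) : cls g = cls h := by
  obtain ⟨k, hk, hkg⟩ := cls_eq.1 hs
  have hk1 : (sect h false)⁻¹ * k * sect g false ∈ K := by
    rw [← toG_eq_one, map_mul, map_mul, map_inv, toG_eq_one.2 hk, hq, mul_one, inv_mul_cancel]
  obtain ⟨x, hx, hx0, hx1⟩ :=
    exists_mem_K (k := fun e => if e then (sect h false)⁻¹ * k * sect g false else k)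
      (fun e => by cases e <;> simpa)
  refine cls_eq.2 ⟨x, hx, ext_sect (by rw [par_conj, hg, hh]) fun e => ?_⟩
  rw [sect_conj, hx0, hg, Bool.xor_false, hx1, hx1]
  cases e
  · simp only [Bool.false_eq_true, if_false, Bool.false_xor, if_true]
    group
  · have : sect h true = (sect h false)⁻¹ * (k * (sect g false * sect g true) * k⁻¹) := by
      rw [hkg]; group
    simp only [Bool.true_xor, Bool.not_true, Bool.false_eq_true, if_false, if_true]
    rw [this]
    group

/-! ### Tables for the conjugation of sections -/

/-- What conjugation by an element `x` does to the sections of an element: whether `x` interchanges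
the two sections, and the cosets of the sections of `x`. -/
abbrev Move : Type := Bool × G × G

/-- The data of an element. -/
noncomputable def moveOf (x : Gamma) : Move := (par x, toG (sect x false), toG (sect x true))

/-- The data of all elements in the coset `p`. -/
noncomputable def moves (p : G) : List Move :=
  (Set.toFinite {m : Move | ∃ x, toG x = p ∧ moveOf x = m}).toFinset.toList

theorem mem_moves {p : G} {m : Move} : m ∈ moves p ↔ ∃ x, toG x = p ∧ moveOf x = m := by
  rw [moves, Finset.mem_toList, Set.Finite.mem_toFinset]
  rfl

/-- The data of one element in the coset `p`. -/
noncomputable def move (p : G) : Move := moveOf p.out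

theorem move_eq (p : G) : ∃ x, toG x = p ∧ moveOf x = move p :=
  ⟨p.out, QuotientGroup.out_eq' p, rfl⟩

/-- The classes of the sections of a conjugate of an element which fixes the first level. -/
theorem cls_sect_conj_even {g : Gamma} (hg : par g = false) (x : Gamma) (e : Bool) :
    cls (sect (x * g * x⁻¹) e) = conjCls (sect g (e ^^ par x)) (toG (sect x e)) := by
  rw [sect_conj, hg, Bool.xor_false, conjCls_toG]

/-- The class of the product of the sections of a conjugate of an element `(g₀, g₁) a`. -/
theorem cls_sect_conj_odd {g : Gamma} (hg : par g = true) (x : Gamma) :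
    cls (sect (x * g * x⁻¹) false * sect (x * g * x⁻¹) true) =
      conjCls (sect g false * sect g true)
        (if par x then toG (sect x false) * toG (sect g true) else toG (sect x false)) := by
  rw [sect_conj, sect_conj, hg]
  cases par x
  · simp only [Bool.false_eq_true, if_false, conjCls_toG, Bool.false_xor, Bool.xor_false,
      Bool.true_xor, Bool.not_true]
    congr 1; group
  · simp only [if_true, ← map_mul, conjCls_toG, Bool.false_xor, Bool.true_xor, Bool.not_true]
    congr 1; group

theorem toG_sect_conj_odd {g : Gamma} (hg : par g = true) (x : Gamma) :
    toG (sect (x * g * x⁻¹) false) =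
      toG (sect x false) * toG (sect g (par x)) * (toG (sect x true))⁻¹ := by
  rw [sect_conj, hg, map_mul, map_mul, map_inv, Bool.false_xor, Bool.false_xor]

/-! ### Keys -/

/-- The key under which an element is looked up in the dictionary: the numbers of the classes of
its two sections if it fixes the first level, and otherwise the number of the class of the product
of its sections, together with the coset of the first section. -/
inductive Key : Type
  | even (u v : ℕ)
  | odd (u : ℕ) (q : G)

/-- The key of an element, when the classes are numbered by `ids`. -/
noncomputable def keyOf (ids : KClass → ℕ) (h : Gamma) : Key :=
  if par h then .odd (ids (cls (sect h false * sect h true))) (toG (sect h false))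
  else .even (ids (cls (sect h false))) (ids (cls (sect h true)))

/-- All classes which occur in the key of `h` have got a number (the number `0` meaning that there
is none). -/
def Assigned (ids : KClass → ℕ) (h : Gamma) : Prop :=
  if par h then ids (cls (sect h false * sect h true)) ≠ 0
  else ids (cls (sect h false)) ≠ 0 ∧ ids (cls (sect h true)) ≠ 0

/-- The numbering `ids` gives different numbers to different classes which have got one. -/
def InjIds (ids : KClass → ℕ) : Prop := ∀ c c', ids c ≠ 0 → ids c = ids c' → c = c'

theorem cls_eq_of_keyOf_eq {ids : KClass → ℕ} (hi : InjIds ids) {g h : Gamma}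
    (hg : Assigned ids g) (e : keyOf ids g = keyOf ids h) : cls g = cls h := by
  unfold Assigned at hg
  unfold keyOf at e
  rcases Bool.eq_false_or_eq_true (par g) with hpg | hpg <;>
    rcases Bool.eq_false_or_eq_true (par h) with hph | hph <;>
    simp only [hpg, hph, if_true, if_false, Bool.false_eq_true, reduceCtorEq, Key.odd.injEq,
      Key.even.injEq] at e hg
  · exact cls_eq_of_odd hpg hph (hi _ _ hg e.1) e.2
  · exact cls_eq_of_even hpg hph fun b => by
      cases b
      · exact hi _ _ hg.1 e.1
      · exact hi _ _ hg.2 e.2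

/-- The key of `x g x⁻¹` for `g` fixing the first level, from the data of `x`. -/
theorem keyOf_conj_even (ids : KClass → ℕ) {g : Gamma} (hg : par g = false) (x : Gamma) :
    keyOf ids (x * g * x⁻¹) =
      .even (ids (conjCls (sect g (moveOf x).1) (moveOf x).2.1))
        (ids (conjCls (sect g (!(moveOf x).1)) (moveOf x).2.2)) := by
  simp [keyOf, par_conj, hg, cls_sect_conj_even hg, moveOf, -par_mul, -sect_mul]

theorem assigned_conj_even (ids : KClass → ℕ) {g : Gamma} (hg : par g = false) (x : Gamma)
    (h : ∀ e p, ids (conjCls (sect g e) p) ≠ 0) : Assigned ids (x * g * x⁻¹) := by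
  simp [Assigned, par_conj, hg, cls_sect_conj_even hg, h, -par_mul, -sect_mul]

/-- The key of `x g x⁻¹` for `g` not fixing the first level, from the data of `x`. -/
theorem keyOf_conj_odd (ids : KClass → ℕ) {g : Gamma} (hg : par g = true) (x : Gamma) :
    keyOf ids (x * g * x⁻¹) =
      .odd (ids (conjCls (sect g false * sect g true)
          (if (moveOf x).1 then (moveOf x).2.1 * toG (sect g true) else (moveOf x).2.1)))
        ((moveOf x).2.1 * toG (sect g (moveOf x).1) * ((moveOf x).2.2)⁻¹) := by
  simp only [keyOf, par_conj, hg, cls_sect_conj_odd hg, toG_sect_conj_odd hg, if_true, moveOf]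
  rfl

theorem assigned_conj_odd (ids : KClass → ℕ) {g : Gamma} (hg : par g = true) (x : Gamma)
    (h : ∀ p, ids (conjCls (sect g false * sect g true) p) ≠ 0) : Assigned ids (x * g * x⁻¹) := by
  simp only [Assigned, par_conj, hg, cls_sect_conj_odd hg, if_true]
  exact h _

end Grigorchuk

namespace RAM

/-! ### Structured programs for random access machines -/

/-- The contents of registers, memory and input, without the label. -/
structure Raw : Type where
  reg : ℕ → ℕ
  mem : ℕ → ℕ
  inp : List ℕ

/-- All numbers are at most `B`. -/
def Raw.Bdd (B : ℕ) (s : Raw) : Prop := ∀ i, s.reg i ≤ B ∧ s.mem i ≤ B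

/-- The instructions which are not concerned with control. -/
inductive RawOp : Type
  | const (r n : ℕ)
  | move (r s : ℕ)
  | add (r s t : ℕ)
  | sub (r s t : ℕ)
  | load (r s : ℕ)
  | store (r s : ℕ)
  | read (r : ℕ)

/-- The instruction which executes the operation and continues at the label `q`. -/
def RawOp.instr {Λ : Type} (q : Λ) : RawOp → Instr Λ
  | const r n => .const r n q
  | move r s => .move r s q
  | add r s t => .add r s t q
  | sub r s t => .sub r s t q
  | load r s => .load r s q
  | store r s => .store r s q
  | read r => .read r q

/-- The effect of the operation. -/
def RawOp.eval (o : RawOp) (s : Raw) : Raw :=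
  match o with
  | const r n => { s with reg := Function.update s.reg r n }
  | move r i => { s with reg := Function.update s.reg r (s.reg i) }
  | add r i j => { s with reg := Function.update s.reg r (s.reg i + s.reg j) }
  | sub r i j => { s with reg := Function.update s.reg r (s.reg i - s.reg j) }
  | load r i => { s with reg := Function.update s.reg r (s.mem (s.reg i)) }
  | store r i => { s with mem := Function.update s.mem (s.reg r) (s.reg i) }
  | read r => { s with reg := Function.update s.reg r (s.inp.headD 0), inp := s.inp.tail }

/-- Structured programs with conditionals and loops over the registers of the machine. -/
inductive RawCmd : Type
  | nop
  | op (o : RawOp)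
  | seq (c d : RawCmd)
  | ifz (r : ℕ) (c d : RawCmd)
  | loop (r : ℕ) (c : RawCmd)

/-- `RawExec B c s t s'`: started in `s`, the program `c` ends in `s'` after `t` steps, and no
number above `B` is written. -/
inductive RawExec (B : ℕ) : RawCmd → Raw → ℕ → Raw → Prop
  | nop (s) : RawExec B .nop s 0 s
  | op (o s) : (o.eval s).Bdd B → RawExec B (.op o) s 1 (o.eval s)
  | seq {c d s t s' t' s''} : RawExec B c s t s' → RawExec B d s' t' s'' →
      RawExec B (.seq c d) s (t + t') s''
  | ifz_zero {r c d s t s'} : s.reg r = 0 → RawExec B c s t s' →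
      RawExec B (.ifz r c d) s (1 + t) s'
  | ifz_pos {r c d s t s'} : s.reg r ≠ 0 → RawExec B d s t s' →
      RawExec B (.ifz r c d) s (1 + t) s'
  | loop_zero {r c s} : s.reg r = 0 → RawExec B (.loop r c) s 1 s
  | loop_pos {r c s t s' t' s''} : s.reg r ≠ 0 → RawExec B c s t s' →
      RawExec B (.loop r c) s' t' s'' → RawExec B (.loop r c) s (1 + (t + t')) s''

/-- The labels which are needed for a structured program. -/
def RawCmd.Lab : RawCmd → Type
  | nop => Empty
  | op _ => Unit
  | seq c d => c.Lab ⊕ d.Lab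
  | ifz _ c d => Option (c.Lab ⊕ d.Lab)
  | loop _ c => Option c.Lab

instance RawCmd.finite_lab : ∀ c : RawCmd, Finite c.Lab
  | nop => inferInstanceAs (Finite Empty)
  | op _ => inferInstanceAs (Finite Unit)
  | seq c d =>
    have := c.finite_lab
    have := d.finite_lab
    inferInstanceAs (Finite (c.Lab ⊕ d.Lab))
  | ifz _ c d =>
    have := c.finite_lab
    have := d.finite_lab
    inferInstanceAs (Finite (Option (c.Lab ⊕ d.Lab)))
  | loop _ c =>
    have := c.finite_lab
    inferInstanceAs (Finite (Option c.Lab))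

/-- The first label of a structured program whose labels are embedded into a larger set, and which
continues at the label `exit`. -/
def RawCmd.entry {Λ : Type} : (c : RawCmd) → (c.Lab → Λ) → Λ → Λ
  | nop, _, exit => exit
  | op _, emb, _ => emb ()
  | seq c d, emb, exit => c.entry (fun l => emb (.inl l)) (d.entry (fun l => emb (.inr l)) exit)
  | ifz _ _ _, emb, _ => emb none
  | loop _ _, emb, _ => emb none

/-- The instructions of a structured program. -/
def RawCmd.code {Λ : Type} : (c : RawCmd) → (c.Lab → Λ) → Λ → c.Lab → Instr Λ
  | nop, _, _, l => nomatch l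
  | op o, _, exit, _ => o.instr exit
  | seq c d, emb, exit, .inl l =>
    c.code (fun l => emb (.inl l)) (d.entry (fun l => emb (.inr l)) exit) l
  | seq _ d, emb, exit, .inr l => d.code (fun l => emb (.inr l)) exit l
  | ifz r c d, emb, exit, none =>
    .branch r (c.entry (fun l => emb (some (.inl l))) exit)
      (d.entry (fun l => emb (some (.inr l))) exit)
  | ifz _ c _, emb, exit, some (.inl l) => c.code (fun l => emb (some (.inl l))) exit l
  | ifz _ _ d, emb, exit, some (.inr l) => d.code (fun l => emb (some (.inr l))) exit l
  | loop r c, emb, exit, none => .branch r exit (c.entry (fun l => emb (some l)) (emb none))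
  | loop _ c, emb, _, some l => c.code (fun l => emb (some l)) (emb none) l

/-- The configuration with the given label and contents. -/
def Raw.config {Λ : Type} (s : Raw) (l : Λ) : Config Λ := ⟨l, s.reg, s.mem, s.inp⟩

theorem step_op {Λ : Type} {P : Program Λ} {l q : Λ} {o : RawOp} (h : P.code l = o.instr q)
    (s : Raw) : P.step (s.config l) = (o.eval s).config q := by
  unfold Program.step
  rw [show (s.config l).label = l from rfl, h]
  cases o <;> rfl

theorem step_branch {Λ : Type} {P : Program Λ} {l q₀ q₁ : Λ} {r : ℕ}
    (h : P.code l = .branch r q₀ q₁) (s : Raw) :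
    P.step (s.config l) = s.config (if s.reg r = 0 then q₀ else q₁) := by
  unfold Program.step
  rw [show (s.config l).label = l from rfl, h]
  rfl

/-- `P` goes from the configuration `x` to `y` in `t` steps, with all numbers at most `B`. -/
def Goes {Λ : Type} (P : Program Λ) (B : ℕ) (x : Config Λ) (t : ℕ) (y : Config Λ) : Prop :=
  P.step^[t] x = y ∧ ∀ j ≤ t, ∀ i, (P.step^[j] x).reg i ≤ B ∧ (P.step^[j] x).mem i ≤ B

theorem Goes.refl {Λ : Type} {P : Program Λ} {B : ℕ} {x : Config Λ}
    (h : ∀ i, x.reg i ≤ B ∧ x.mem i ≤ B) : Goes P B x 0 x :=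
  ⟨rfl, fun j hj => by rw [Nat.le_zero.1 hj]; exact h⟩

theorem Goes.trans {Λ : Type} {P : Program Λ} {B : ℕ} {x y z : Config Λ} {t t' : ℕ}
    (h : Goes P B x t y) (h' : Goes P B y t' z) : Goes P B x (t + t') z := by
  refine ⟨by rw [add_comm, Function.iterate_add_apply, h.1, h'.1], fun j hj => ?_⟩
  rcases le_total j t with hjt | hjt
  · exact h.2 j hjt
  · obtain ⟨k, rfl⟩ := Nat.exists_eq_add_of_le hjt
    rw [add_comm, Function.iterate_add_apply, h.1]
    exact h'.2 k (by omega)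

theorem Goes.step {Λ : Type} {P : Program Λ} {B : ℕ} {x y : Config Λ}
    (h : P.step x = y) (hx : ∀ i, x.reg i ≤ B ∧ x.mem i ≤ B)
    (hy : ∀ i, y.reg i ≤ B ∧ y.mem i ≤ B) : Goes P B x 1 y := by
  refine ⟨h, fun j hj => ?_⟩
  rcases Nat.le_one_iff_eq_zero_or_eq_one.1 hj with rfl | rfl
  · exact hx
  · rw [Function.iterate_one, h]; exact hy

theorem RawExec.goes {Λ : Type} {P : Program Λ} {B : ℕ} {c : RawCmd} {s s' : Raw} {t : ℕ}
    (h : RawExec B c s t s') : ∀ (emb : c.Lab → Λ) (exit : Λ),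
    (∀ l, P.code (emb l) = c.code emb exit l) → s.Bdd B →
      Goes P B (s.config (c.entry emb exit)) t (s'.config exit) ∧ s'.Bdd B := by
  induction h with
  | nop s => exact fun _ _ _ hs => ⟨Goes.refl hs, hs⟩
  | op o s h => exact fun _ _ hc hs => ⟨Goes.step (step_op (hc ()) s) hs h, h⟩
  | seq _ _ ih ih' =>
    intro emb exit hc hs
    obtain ⟨h1, h2⟩ := ih _ _ (fun l => hc (.inl l)) hs
    obtain ⟨h3, h4⟩ := ih' _ _ (fun l => hc (.inr l)) h2
    exact ⟨h1.trans h3, h4⟩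
  | @ifz_zero _ _ _ s _ _ hr _ ih =>
    intro emb exit hc hs
    obtain ⟨h1, h2⟩ := ih _ _ (fun l => hc (some (.inl l))) hs
    have := step_branch (hc none) s
    rw [if_pos hr] at this
    exact ⟨(Goes.step this hs hs).trans h1, h2⟩
  | @ifz_pos _ _ _ s _ _ hr _ ih =>
    intro emb exit hc hs
    obtain ⟨h1, h2⟩ := ih _ _ (fun l => hc (some (.inr l))) hs
    have := step_branch (hc none) s
    rw [if_neg hr] at this
    exact ⟨(Goes.step this hs hs).trans h1, h2⟩
  | @loop_zero _ _ s hr =>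
    intro emb exit hc hs
    have := step_branch (hc none) s
    rw [if_pos hr] at this
    exact ⟨Goes.step this hs hs, hs⟩
  | @loop_pos _ _ s _ _ _ _ hr _ _ ih ih' =>
    intro emb exit hc hs
    obtain ⟨h1, h2⟩ := ih _ _ (fun l => hc (some l)) hs
    obtain ⟨h3, h4⟩ := ih' emb exit hc h2
    have := step_branch (hc none) s
    rw [if_neg hr] at this
    exact ⟨(Goes.step this hs hs).trans (h1.trans h3), h4⟩

/-- The program which executes `c` and then answers whether the register `r` is positive. -/
def RawCmd.program (c : RawCmd) (r : ℕ) : Program (c.Lab ⊕ Fin 3) where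
  start := c.entry .inl (.inr 0)
  code
    | .inl l => c.code .inl (.inr 0) l
    | .inr 0 => .branch r (.inr 1) (.inr 2)
    | .inr 1 => .halt false
    | .inr 2 => .halt true

theorem RawExec.answers {B : ℕ} {c : RawCmd} {input : List ℕ} {t : ℕ} {s' : Raw} (r : ℕ)
    (h : RawExec B c ⟨fun _ => 0, fun _ => 0, input⟩ t s') :
    (c.program r).AnswersWithin input (t + 1) (decide (s'.reg r ≠ 0)) ∧
      (c.program r).NumbersBoundedBy input B := by
  obtain ⟨h1, h2⟩ := h.goes (P := c.program r) .inl (.inr 0) (fun _ => rfl)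
    (fun _ => ⟨Nat.zero_le _, Nat.zero_le _⟩)
  have hb := step_branch (P := c.program r) (l := .inr 0) rfl s'
  have hg := h1.trans (Goes.step hb h2 h2)
  set q : c.Lab ⊕ Fin 3 := if s'.reg r = 0 then .inr 1 else .inr 2 with hq
  have hhalt : (c.program r).code q = .halt (decide (s'.reg r ≠ 0)) := by
    by_cases h0 : s'.reg r = 0
    · rw [hq, if_pos h0]; simp [h0, RawCmd.program]
    · rw [hq, if_neg h0]; simp [h0, RawCmd.program]
  have hrun : (c.program r).run input (t + 1) = s'.config q := hg.1
  refine ⟨⟨t + 1, le_rfl, by rw [hrun]; exact hhalt⟩, fun j => ?_⟩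
  rcases le_total j (t + 1) with hj | hj
  · exact hg.2 j hj
  · obtain ⟨k, rfl⟩ := Nat.exists_eq_add_of_le hj
    have : (c.program r).run input (t + 1 + k) = s'.config q := by
      induction k with
      | zero => exact hrun
      | succ k ih =>
        rw [Program.run, ← add_assoc, Function.iterate_succ_apply']
        change (c.program r).step ((c.program r).run input (t + 1 + k)) = _
        rw [ih (by omega)]
        unfold Program.step
        rw [show (s'.config q).label = q from rfl, hhalt]
    rw [this]
    exact h2

/-! ### Programs with named registers and several arrays -/

/-- The states of a machine with registers `R`, arrays `A`, an accumulator, and two further arrays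
`row` and `dict`. The point of this division is that sums are formed in the accumulator only and
stored in the array `row` only, while all other numbers can only grow by `1` in a step. -/
structure St (R A : Type) : Type where
  reg : R → ℕ
  arr : A → ℕ → ℕ
  inp : List ℕ
  acc : ℕ
  row : ℕ → ℕ
  dict : ℕ → ℕ

/-- The operations on these states. The array `dict` is addressed by the accumulator. -/
inductive Op (R A : Type) : Type
  | const (r : R) (n : ℕ)
  | move (r s : R)
  | inc (r : R)
  | dec (r : R)
  | sub (r s t : R)
  | load (r : R) (a : A) (i : R)
  | store (a : A) (i r : R)
  | read (r : R)
  | rowLoad (i : R)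
  | accAdd (r : R)
  | rowStore (i : R)
  | dictLoad (r : R)
  | dictStore (r : R)

/-- Structured programs over these operations. -/
inductive Cmd (R A : Type) : Type
  | nop
  | op (o : Op R A)
  | seq (c d : Cmd R A)
  | ifz (r : R) (c d : Cmd R A)
  | loop (r : R) (c : Cmd R A)

section

variable {R A : Type} [DecidableEq R] [DecidableEq A]

/-- The effect of an operation. -/
def Op.eval (o : Op R A) (s : St R A) : St R A :=
  match o with
  | const r n => { s with reg := Function.update s.reg r n }
  | move r i => { s with reg := Function.update s.reg r (s.reg i) }
  | inc r => { s with reg := Function.update s.reg r (s.reg r + 1) }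
  | dec r => { s with reg := Function.update s.reg r (s.reg r - 1) }
  | sub r i j => { s with reg := Function.update s.reg r (s.reg i - s.reg j) }
  | load r a i => { s with reg := Function.update s.reg r (s.arr a (s.reg i)) }
  | store a i r =>
    { s with arr := Function.update s.arr a (Function.update (s.arr a) (s.reg i) (s.reg r)) }
  | read r => { s with reg := Function.update s.reg r (s.inp.headD 0), inp := s.inp.tail }
  | rowLoad i => { s with acc := s.row (s.reg i) }
  | accAdd r => { s with acc := s.acc + s.reg r }
  | rowStore i => { s with row := Function.update s.row (s.reg i) s.acc }
  | dictLoad r => { s with reg := Function.update s.reg r (s.dict s.acc) }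
  | dictStore r => { s with dict := Function.update s.dict s.acc (s.reg r) }

/-- `Exec c s t s'`: started in `s`, the program `c` ends in `s'` after `t` steps. -/
inductive Exec : Cmd R A → St R A → ℕ → St R A → Prop
  | nop (s) : Exec .nop s 0 s
  | op (o s) : Exec (.op o) s 1 (o.eval s)
  | seq {c d s t s' t' s''} : Exec c s t s' → Exec d s' t' s'' → Exec (.seq c d) s (t + t') s''
  | ifz_zero {r c d s t s'} : s.reg r = 0 → Exec c s t s' → Exec (.ifz r c d) s (1 + t) s'
  | ifz_pos {r c d s t s'} : s.reg r ≠ 0 → Exec d s t s' → Exec (.ifz r c d) s (1 + t) s'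
  | loop_zero {r c s} : s.reg r = 0 → Exec (.loop r c) s 1 s
  | loop_pos {r c s t s' t' s''} : s.reg r ≠ 0 → Exec c s t s' → Exec (.loop r c) s' t' s'' →
      Exec (.loop r c) s (1 + (t + t')) s''

/-- The constants of an operation are at most `C`. -/
def Op.ConstLE (C : ℕ) : Op R A → Prop
  | const _ n => n ≤ C
  | _ => True

/-- The constants of a program are at most `C`. -/
def Cmd.ConstLE (C : ℕ) : Cmd R A → Prop
  | nop => True
  | op o => o.ConstLE C
  | seq c d => c.ConstLE C ∧ d.ConstLE C
  | ifz _ c d => c.ConstLE C ∧ d.ConstLE C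
  | loop _ c => c.ConstLE C

omit [DecidableEq R] [DecidableEq A] in
theorem Cmd.ConstLE.mono {C D : ℕ} (h : C ≤ D) {c : Cmd R A} : c.ConstLE C → c.ConstLE D := by
  induction c with
  | nop => exact id
  | op o =>
    cases o with
    | const r n => exact fun h' => le_trans h' h
    | _ => exact id
  | seq c d ih ih' => exact And.imp ih ih'
  | ifz r c d ih ih' => exact And.imp ih ih'
  | loop r c ih => exact ih

omit [DecidableEq R] [DecidableEq A] in
theorem Cmd.exists_constLE (c : Cmd R A) : ∃ C, c.ConstLE C := by
  induction c with
  | nop => exact ⟨0, trivial⟩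
  | op o =>
    cases o with
    | const r n => exact ⟨n, le_refl n⟩
    | _ => exact ⟨0, trivial⟩
  | seq c d ih ih' =>
    obtain ⟨m, hm⟩ := ih
    obtain ⟨n, hn⟩ := ih'
    exact ⟨max m n, hm.mono (le_max_left _ _), hn.mono (le_max_right _ _)⟩
  | ifz r c d ih ih' =>
    obtain ⟨m, hm⟩ := ih
    obtain ⟨n, hn⟩ := ih'
    exact ⟨max m n, hm.mono (le_max_left _ _), hn.mono (le_max_right _ _)⟩
  | loop r c ih => exact ih

/-- The bounds which hold automatically at time `τ`. -/
structure St.Bdd (C τ : ℕ) (s : St R A) : Prop where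
  reg : ∀ r, s.reg r ≤ C + τ
  arr : ∀ a i, s.arr a i ≤ C + τ
  inp : ∀ x ∈ s.inp, x ≤ C
  acc : s.acc ≤ τ * (C + τ)
  row : ∀ i, s.row i ≤ τ * (C + τ)
  dict : ∀ i, s.dict i ≤ C + τ

omit [DecidableEq R] [DecidableEq A] in
theorem St.Bdd.succ {C τ : ℕ} {s : St R A} (h : s.Bdd C τ) : s.Bdd C (τ + 1) where
  reg r := (h.reg r).trans (by omega)
  arr a i := (h.arr a i).trans (by omega)
  inp := h.inp
  acc := h.acc.trans (Nat.mul_le_mul (by omega) (by omega))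
  row i := (h.row i).trans (Nat.mul_le_mul (by omega) (by omega))
  dict i := (h.dict i).trans (by omega)

omit [DecidableEq R] [DecidableEq A] in
theorem St.Bdd.mono {C τ τ' : ℕ} (hτ : τ ≤ τ') {s : St R A} (h : s.Bdd C τ) : s.Bdd C τ' := by
  induction hτ with
  | refl => exact h
  | step _ ih => exact ih.succ

theorem update_le {α : Type} [DecidableEq α] {f : α → ℕ} {B : ℕ} (hf : ∀ i, f i ≤ B) {j : α}
    {n : ℕ} (hn : n ≤ B) (i : α) : Function.update f j n i ≤ B := by
  rcases eq_or_ne i j with rfl | h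
  · rwa [Function.update_self]
  · rw [Function.update_of_ne h]; exact hf i

theorem headD_le {l : List ℕ} {C : ℕ} (h : ∀ x ∈ l, x ≤ C) : l.headD 0 ≤ C := by
  cases l with
  | nil => exact Nat.zero_le _
  | cons x l => exact h x List.mem_cons_self

theorem Op.eval_bdd {C τ : ℕ} {o : Op R A} (ho : o.ConstLE C) {s : St R A} (h : s.Bdd C τ) :
    (o.eval s).Bdd C (τ + 1) := by
  have h' := h.succ
  cases o with
  | const r n => exact { h' with reg := update_le h'.reg (le_trans ho (by omega)) }
  | move r i => exact { h' with reg := update_le h'.reg (h'.reg i) }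
  | inc r => exact { h' with reg := update_le h'.reg (by have := h.reg r; omega) }
  | dec r => exact { h' with reg := update_le h'.reg (by have := h.reg r; omega) }
  | sub r i j => exact { h' with reg := update_le h'.reg (by have := h.reg i; omega) }
  | load r a i => exact { h' with reg := update_le h'.reg (h'.arr a _) }
  | store a i r =>
    refine { h' with arr := fun b j => ?_ }
    rcases eq_or_ne b a with rfl | hb
    · change Function.update s.arr b _ b j ≤ _
      rw [Function.update_self]
      exact update_le (h'.arr b) (h'.reg r) j
    · change Function.update s.arr a _ b j ≤ _
      rw [Function.update_of_ne hb]
      exact h'.arr b j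
  | read r =>
    exact { h' with
      reg := update_le h'.reg ((headD_le h.inp).trans (by omega))
      inp := fun x hx => h.inp x (List.mem_of_mem_tail hx) }
  | rowLoad i => exact { h' with acc := h'.row _ }
  | accAdd r =>
    refine { h' with acc := ?_ }
    have h1 := h.acc
    have h2 := h.reg r
    change s.acc + s.reg r ≤ _
    calc s.acc + s.reg r ≤ τ * (C + τ) + (C + τ) := by omega
      _ = (τ + 1) * (C + τ) := by ring
      _ ≤ _ := Nat.mul_le_mul le_rfl (by omega)
  | rowStore i => exact { h' with row := update_le h'.row h'.acc }
  | dictLoad r => exact { h' with reg := update_le h'.reg (h'.dict _) }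
  | dictStore r => exact { h' with dict := update_le h'.dict (h'.reg r) }

theorem Exec.bdd {C : ℕ} {c : Cmd R A} {s s' : St R A} {t : ℕ} (h : Exec c s t s') :
    ∀ τ, c.ConstLE C → s.Bdd C τ → s'.Bdd C (τ + t) := by
  induction h with
  | nop s => exact fun _ _ h => h
  | op o s => exact fun _ hc h => Op.eval_bdd hc h
  | seq _ _ ih ih' =>
    intro τ hc h
    rw [← add_assoc]
    exact ih' _ hc.2 (ih _ hc.1 h)
  | ifz_zero _ _ ih => exact fun τ hc h => (ih _ hc.1 h).mono (by omega)
  | ifz_pos _ _ ih => exact fun τ hc h => (ih _ hc.2 h).mono (by omega)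
  | loop_zero _ => exact fun τ _ h => h.succ
  | loop_pos _ _ _ ih ih' => exact fun τ hc h => (ih' _ hc (ih _ hc h)).mono (by omega)

/-! ### Translation into the instructions of the machine -/

variable [Finite R] [Finite A]

/-- The number of a register on the machine; the registers `0`, `1` are used for the computation of
addresses, and `2` is the accumulator. -/
noncomputable def rnum (r : R) : ℕ := Finite.equivFin R r + 3

/-- The number of an array. -/
noncomputable def anum (a : A) : ℕ := Finite.equivFin A a

variable (A) in
/-- The number of arrays, including `row` and `dict`. The cell `i` of the array number `k` is at the
address `width * i + k`. -/
noncomputable def width : ℕ := Nat.card A + 2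

omit [DecidableEq R] in
theorem rnum_inj {r r' : R} : rnum r = rnum r' ↔ r = r' := by
  simp [rnum, Fin.val_inj]

omit [DecidableEq A] in
theorem anum_inj {a a' : A} : anum a = anum a' ↔ a = a' := by
  simp [anum, Fin.val_inj]

omit [DecidableEq A] in
theorem anum_lt (a : A) : anum a < Nat.card A := (Finite.equivFin A a).2

omit [DecidableEq A] [Finite A] in
theorem addr_inj {i j k l : ℕ} (hk : k < width A) (hl : l < width A)
    (h : width A * i + k = width A * j + l) : i = j ∧ k = l := by
  have h1 := congrArg (· / width A) h
  have h2 := congrArg (· % width A) h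
  have h0 : 0 < width A := by unfold width; omega
  simp only [Nat.mul_add_div h0, Nat.mul_add_mod, Nat.div_eq_of_lt hk, Nat.div_eq_of_lt hl,
    Nat.mod_eq_of_lt hk, Nat.mod_eq_of_lt hl, add_zero] at h1 h2
  exact ⟨h1, h2⟩

/-- Add the register `i` to the register `0`, `n` times. -/
def addTimes (i : ℕ) : ℕ → RawCmd
  | 0 => .nop
  | n + 1 => .seq (addTimes i n) (.op (.add 0 0 i))

variable (A) in
/-- Compute the address `width * i + k` in the register `0`, where `i` is the content of the given
register. -/
noncomputable def addrCmd (i k : ℕ) : RawCmd :=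
  .seq (.op (.const 0 0)) (.seq (addTimes i (width A))
    (.seq (.op (.const 1 k)) (.op (.add 0 0 1))))

omit [DecidableEq R] [DecidableEq A] [Finite R] [Finite A] in
theorem Raw.Bdd.update_reg {B : ℕ} {s : Raw} (h : s.Bdd B) {r n : ℕ} (hn : n ≤ B) :
    Raw.Bdd B { s with reg := Function.update s.reg r n } := fun i =>
  ⟨update_le (fun i => (h i).1) hn i, (h i).2⟩

omit [DecidableEq R] [DecidableEq A] [Finite R] [Finite A] in
theorem Raw.Bdd.update_mem {B : ℕ} {s : Raw} (h : s.Bdd B) {r n : ℕ} (hn : n ≤ B) :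
    Raw.Bdd B { s with mem := Function.update s.mem r n } := fun i =>
  ⟨(h i).1, update_le (fun i => (h i).2) hn i⟩

omit [DecidableEq R] [DecidableEq A] [Finite R] [Finite A] in
theorem rawExec_addTimes {B : ℕ} {s : Raw} (hs : s.Bdd B) {i : ℕ} (hi : i ≠ 0) (n : ℕ)
    (h : s.reg 0 + n * s.reg i ≤ B) :
    RawExec B (addTimes i n) s n
      { s with reg := Function.update s.reg 0 (s.reg 0 + n * s.reg i) } := by
  induction n with
  | zero => simpa [addTimes] using RawExec.nop s
  | succ n ih =>
    have h1 : s.reg 0 + n * s.reg i ≤ B := le_trans (by rw [Nat.succ_mul]; omega) h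
    have e : (RawOp.add 0 0 i).eval
        { s with reg := Function.update s.reg 0 (s.reg 0 + n * s.reg i) } =
        { s with reg := Function.update s.reg 0 (s.reg 0 + (n + 1) * s.reg i) } := by
      simp [RawOp.eval, Function.update_of_ne hi, Nat.succ_mul, add_assoc]
    refine RawExec.seq (ih h1) ?_
    have := RawExec.op (B := B) (RawOp.add 0 0 i)
      { s with reg := Function.update s.reg 0 (s.reg 0 + n * s.reg i) }
    rw [e] at this
    exact this (hs.update_reg h)

omit [DecidableEq R] [DecidableEq A] [Finite R] [Finite A] in
theorem rawExec_addrCmd {B : ℕ} {s : Raw} (hs : s.Bdd B) {i k : ℕ} (hi : 2 ≤ i)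
    (h : width A * s.reg i + k ≤ B) :
    ∃ s' : Raw, RawExec B (addrCmd A i k) s (width A + 3) s' ∧ s'.Bdd B ∧
      s'.reg 0 = width A * s.reg i + k ∧ (∀ j, 2 ≤ j → s'.reg j = s.reg j) ∧
      s'.mem = s.mem ∧ s'.inp = s.inp := by
  have i0 : i ≠ 0 := by omega
  have h0 := hs.update_reg (r := 0) (Nat.zero_le B)
  have h1 := rawExec_addTimes h0 i0 (width A) (by simp [Function.update_of_ne i0]; omega)
  have hb1 : Raw.Bdd B _ := h0.update_reg (r := 0) (n := width A * s.reg i) (by omega)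
  have hb2 := hb1.update_reg (r := 1) (n := k) (by omega)
  have hb3 := hb2.update_reg (r := 0) (n := width A * s.reg i + k) h
  simp only [Function.update_self, Function.update_of_ne i0, zero_add] at h1
  refine ⟨_, ?_, hb3, by simp, fun j hj => ?_, rfl, rfl⟩
  · rw [show width A + 3 = 1 + (width A + (1 + 1)) by omega]
    refine RawExec.seq (.op _ _ h0) (.seq h1 (.seq (.op _ _ hb2) ?_))
    have := RawExec.op (B := B) (RawOp.add 0 0 1) (Raw.mk (Function.update (Function.update
      (Function.update s.reg 0 0) 0 (width A * s.reg i)) 1 k) s.mem s.inp)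
    simp only [RawOp.eval, Function.update_self, ne_eq, zero_ne_one, not_false_eq_true,
      Function.update_of_ne] at this
    exact this hb3
  · simp [Function.update_of_ne (show j ≠ 0 by omega), Function.update_of_ne (show j ≠ 1 by omega)]

/-- The translation of the operations. The arrays are interleaved in the memory: the arrays `row`
and `dict` have the last two numbers. -/
noncomputable def Op.raw : Op R A → RawCmd
  | const r n => .op (.const (rnum r) n)
  | move r s => .op (.move (rnum r) (rnum s))
  | inc r => .seq (.op (.const 1 1)) (.op (.add (rnum r) (rnum r) 1))
  | dec r => .seq (.op (.const 1 1)) (.op (.sub (rnum r) (rnum r) 1))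
  | sub r s t => .op (.sub (rnum r) (rnum s) (rnum t))
  | load r a i => .seq (addrCmd A (rnum i) (anum a)) (.op (.load (rnum r) 0))
  | store a i r => .seq (addrCmd A (rnum i) (anum a)) (.op (.store 0 (rnum r)))
  | read r => .op (.read (rnum r))
  | rowLoad i => .seq (addrCmd A (rnum i) (Nat.card A)) (.op (.load 2 0))
  | accAdd r => .op (.add 2 2 (rnum r))
  | rowStore i => .seq (addrCmd A (rnum i) (Nat.card A)) (.op (.store 0 2))
  | dictLoad r => .seq (addrCmd A 2 (Nat.card A + 1)) (.op (.load (rnum r) 0))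
  | dictStore r => .seq (addrCmd A 2 (Nat.card A + 1)) (.op (.store 0 (rnum r)))

/-- The translation of programs. -/
noncomputable def Cmd.raw : Cmd R A → RawCmd
  | nop => .nop
  | op o => o.raw
  | seq c d => .seq c.raw d.raw
  | ifz r c d => .ifz (rnum r) c.raw d.raw
  | loop r c => .loop (rnum r) c.raw

/-- The contents of the machine represent the given state. -/
structure Rep (s : St R A) (x : Raw) : Prop where
  reg : ∀ r, x.reg (rnum r) = s.reg r
  acc : x.reg 2 = s.acc
  arr : ∀ a i, x.mem (width A * i + anum a) = s.arr a i
  row : ∀ i, x.mem (width A * i + Nat.card A) = s.row i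
  dict : ∀ i, x.mem (width A * i + (Nat.card A + 1)) = s.dict i
  inp : x.inp = s.inp

omit [DecidableEq R] [DecidableEq A] in
theorem Rep.congr {s : St R A} {x y : Raw} (h : Rep s x) (hr : ∀ j, 2 ≤ j → y.reg j = x.reg j)
    (hm : y.mem = x.mem) (hi : y.inp = x.inp) : Rep s y where
  reg r := by rw [hr _ (by unfold rnum; omega), h.reg]
  acc := by rw [hr _ le_rfl, h.acc]
  arr a i := by rw [hm, h.arr]
  row i := by rw [hm, h.row]
  dict i := by rw [hm, h.dict]
  inp := by rw [hi, h.inp]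

omit [DecidableEq A] in
theorem Rep.update_reg {s : St R A} {x : Raw} (h : Rep s x) (r : R) (n : ℕ) :
    Rep { s with reg := Function.update s.reg r n }
      { x with reg := Function.update x.reg (rnum r) n } where
  reg r' := by
    simp only [Function.update_apply, rnum_inj, h.reg]
  acc := by
    simp only [Function.update_apply, h.acc]
    rw [if_neg (by unfold rnum; omega)]
  arr := h.arr
  row := h.row
  dict := h.dict
  inp := h.inp

omit [DecidableEq R] [DecidableEq A] in
theorem Rep.update_acc {s : St R A} {x : Raw} (h : Rep s x) (n : ℕ) :
    Rep { s with acc := n } { x with reg := Function.update x.reg 2 n } where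
  reg r' := by
    simp only [Function.update_apply, h.reg]
    rw [if_neg (by unfold rnum; omega)]
  acc := by simp
  arr := h.arr
  row := h.row
  dict := h.dict
  inp := h.inp

omit [DecidableEq R] in
theorem Rep.update_arr {s : St R A} {x : Raw} (h : Rep s x) (a : A) (i n : ℕ) :
    Rep { s with arr := Function.update s.arr a (Function.update (s.arr a) i n) }
      { x with mem := Function.update x.mem (width A * i + anum a) n } where
  reg := h.reg
  acc := h.acc
  inp := h.inp
  arr b j := by
    have ha := anum_lt a
    have hb := anum_lt b
    simp only [Function.update_apply]
    by_cases hba : b = a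
    · subst hba
      by_cases hij : j = i
      · subst hij; simp
      · rw [if_neg fun e => hij (addr_inj (by unfold width; omega) (by unfold width; omega) e).1]
        simp [hij, h.arr]
    · rw [if_neg fun e => hba (anum_inj.1 (addr_inj (by unfold width; omega)
        (by unfold width; omega) e).2), if_neg hba, h.arr]
  row j := by
    have ha := anum_lt a
    simp only [Function.update_apply]
    rw [if_neg, h.row]
    intro e
    have := (addr_inj (by unfold width; omega) (by unfold width; omega) e).2
    omega
  dict j := by
    have ha := anum_lt a
    simp only [Function.update_apply]
    rw [if_neg, h.dict]
    intro e
    have := (addr_inj (by unfold width; omega) (by unfold width; omega) e).2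
    omega

omit [DecidableEq R] [DecidableEq A] in
theorem Rep.update_row {s : St R A} {x : Raw} (h : Rep s x) (i n : ℕ) :
    Rep { s with row := Function.update s.row i n }
      { x with mem := Function.update x.mem (width A * i + Nat.card A) n } where
  reg := h.reg
  acc := h.acc
  inp := h.inp
  arr b j := by
    have hb := anum_lt b
    simp only [Function.update_apply]
    rw [if_neg, h.arr]
    intro e
    have := (addr_inj (by unfold width; omega) (by unfold width; omega) e).2
    omega
  row j := by
    simp only [Function.update_apply]
    by_cases hij : j = i
    · subst hij; simp
    · rw [if_neg fun e => hij (addr_inj (by unfold width; omega) (by unfold width; omega) e).1,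
        if_neg hij, h.row]
  dict j := by
    simp only [Function.update_apply]
    rw [if_neg, h.dict]
    intro e
    have := (addr_inj (by unfold width; omega) (by unfold width; omega) e).2
    omega

omit [DecidableEq R] [DecidableEq A] in
theorem Rep.update_dict {s : St R A} {x : Raw} (h : Rep s x) (i n : ℕ) :
    Rep { s with dict := Function.update s.dict i n }
      { x with mem := Function.update x.mem (width A * i + (Nat.card A + 1)) n } where
  reg := h.reg
  acc := h.acc
  inp := h.inp
  arr b j := by
    have hb := anum_lt b
    simp only [Function.update_apply]
    rw [if_neg, h.arr]
    intro e
    have := (addr_inj (by unfold width; omega) (by unfold width; omega) e).2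
    omega
  row j := by
    simp only [Function.update_apply]
    rw [if_neg, h.row]
    intro e
    have := (addr_inj (by unfold width; omega) (by unfold width; omega) e).2
    omega
  dict j := by
    simp only [Function.update_apply]
    by_cases hij : j = i
    · subst hij; simp
    · rw [if_neg fun e => hij (addr_inj (by unfold width; omega) (by unfold width; omega) e).1,
        if_neg hij, h.dict]

variable (A) in
/-- The bound on all numbers on the machine during the first `T` steps. -/
noncomputable def numBound (C T : ℕ) : ℕ := width A * ((T + 1) * (C + T + 1) + 1)

omit [DecidableEq A] [Finite A] in
theorem le_numBound {C T x k : ℕ} (hx : x ≤ (T + 1) * (C + T + 1)) (hk : k ≤ width A) :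
    width A * x + k ≤ numBound A C T := by
  unfold numBound
  rw [Nat.mul_add, mul_one]
  exact Nat.add_le_add (Nat.mul_le_mul le_rfl hx) hk

omit [DecidableEq A] [Finite A] in
theorem le_numBound' {C T x : ℕ} (hx : x ≤ (T + 1) * (C + T + 1)) : x ≤ numBound A C T := by
  refine le_trans ?_ (le_numBound hx (Nat.zero_le _))
  exact Nat.le_mul_of_pos_left _ (by unfold width; omega)

theorem small_le {C T : ℕ} : C + T ≤ (T + 1) * (C + T + 1) := by
  calc C + T ≤ 1 * (C + T + 1) := by omega
    _ ≤ _ := Nat.mul_le_mul (by omega) le_rfl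

theorem big_le {C T : ℕ} : T * (C + T) ≤ (T + 1) * (C + T + 1) :=
  Nat.mul_le_mul (by omega) (by omega)

/-- The translation of an operation takes a constant time. The bounds hold for all numbers including
the addresses. -/
theorem Op.raw_exec {C T : ℕ} {o : Op R A} (ho : o.ConstLE C) {s : St R A} {x : Raw}
    (hs : s.Bdd C T) (hs' : (o.eval s).Bdd C T) (hx : Rep s x) (hb : x.Bdd (numBound A C T)) :
    ∃ t ≤ width A + 4, ∃ x', RawExec (numBound A C T) o.raw x t x' ∧ Rep (o.eval s) x' ∧
      x'.Bdd (numBound A C T) := by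
  have hr : ∀ r : R, s.reg r ≤ numBound A C T := fun r =>
    le_numBound' ((hs.reg r).trans small_le)
  have h1 : 1 ≤ numBound A C T := le_numBound' (le_trans (by omega) (Nat.mul_le_mul
    (Nat.succ_le_succ (Nat.zero_le T)) (Nat.succ_le_succ (Nat.zero_le (C + T)))))
  have h2 : ∀ r : R, 2 ≤ rnum r := fun r => by unfold rnum; omega
  have haddr : ∀ (r : R) (k), k ≤ width A → width A * x.reg (rnum r) + k ≤ numBound A C T :=
    fun r k hk => le_numBound (by rw [hx.reg]; exact (hs.reg r).trans small_le) hk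
  have haddr2 : width A * x.reg 2 + (Nat.card A + 1) ≤ numBound A C T :=
    le_numBound (by rw [hx.acc]; exact hs.acc.trans big_le) (by unfold width; omega)
  have ha : ∀ a : A, anum a ≤ width A := fun a => by have := anum_lt a; unfold width; omega
  have hcard : Nat.card A ≤ width A := by unfold width; omega
  have hne : ∀ r : R, rnum r ≠ 1 := fun r => by unfold rnum; omega
  cases o with
  | const r n =>
    have hb' := hb.update_reg (r := rnum r) (n := n) (le_numBound' (le_trans
      (le_trans ho (Nat.le_add_right _ _)) small_le))
    exact ⟨1, by omega, _, .op _ _ hb', hx.update_reg r n, hb'⟩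
  | move r i =>
    have hb' := hb.update_reg (r := rnum r) (n := s.reg i) (hr i)
    rw [← hx.reg i] at hb'
    refine ⟨1, by omega, _, .op _ _ hb', ?_, hb'⟩
    have := hx.update_reg r (s.reg i)
    rw [← hx.reg i] at this
    simpa [Op.eval, RawOp.eval, hx.reg] using this
  | inc r =>
    have hn := hs'.reg r
    simp only [Op.eval, Function.update_self] at hn
    have hb0 := hb.update_reg (r := 1) h1
    have hb' := hb0.update_reg (r := rnum r) (n := s.reg r + 1)
      (le_numBound' (hn.trans small_le))
    have e : (RawOp.add (rnum r) (rnum r) 1).eval ((RawOp.const 1 1).eval x) =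
        { x with reg := Function.update (Function.update x.reg 1 1) (rnum r) (s.reg r + 1) } := by
      simp [RawOp.eval, Function.update_of_ne (hne r), hx.reg]
    refine ⟨1 + 1, by omega, _, .seq (.op _ _ hb0) (.op _ _ (by rw [e]; exact hb')), ?_,
      by rw [e]; exact hb'⟩
    rw [e]
    have hx0 : Rep s { x with reg := Function.update x.reg 1 1 } :=
      hx.congr (fun j hj => Function.update_of_ne (by omega) _ _) rfl rfl
    exact hx0.update_reg r _
  | dec r =>
    have hn := hs'.reg r
    simp only [Op.eval, Function.update_self] at hn
    have hb0 := hb.update_reg (r := 1) h1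
    have hb' := hb0.update_reg (r := rnum r) (n := s.reg r - 1)
      (le_numBound' (hn.trans small_le))
    have e : (RawOp.sub (rnum r) (rnum r) 1).eval ((RawOp.const 1 1).eval x) =
        { x with reg := Function.update (Function.update x.reg 1 1) (rnum r) (s.reg r - 1) } := by
      simp [RawOp.eval, Function.update_of_ne (hne r), hx.reg]
    refine ⟨1 + 1, by omega, _, .seq (.op _ _ hb0) (.op _ _ (by rw [e]; exact hb')), ?_,
      by rw [e]; exact hb'⟩
    rw [e]
    have hx0 : Rep s { x with reg := Function.update x.reg 1 1 } :=
      hx.congr (fun j hj => Function.update_of_ne (by omega) _ _) rfl rfl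
    exact hx0.update_reg r _
  | sub r i j =>
    have hb' := hb.update_reg (r := rnum r) (n := s.reg i - s.reg j)
      ((Nat.sub_le _ _).trans (hr i))
    have e : (RawOp.sub (rnum r) (rnum i) (rnum j)).eval x =
        { x with reg := Function.update x.reg (rnum r) (s.reg i - s.reg j) } := by
      simp [RawOp.eval, hx.reg]
    refine ⟨1, by omega, _, .op _ _ (by rw [e]; exact hb'), ?_, by rw [e]; exact hb'⟩
    rw [e]
    exact hx.update_reg r _
  | load r a i =>
    obtain ⟨y, hy, hyb, hy0, hyr, hym, hyi⟩ := rawExec_addrCmd hb (h2 i) (haddr i _ (ha a))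
    have e : (RawOp.load (rnum r) 0).eval y =
        { y with reg := Function.update y.reg (rnum r) (s.arr a (s.reg i)) } := by
      simp [RawOp.eval, hy0, hym, hx.reg, hx.arr]
    have hb' := hyb.update_reg (r := rnum r) (n := s.arr a (s.reg i))
      (le_numBound' ((hs.arr _ _).trans small_le))
    refine ⟨_, by omega, _, .seq hy (.op _ _ (by rw [e]; exact hb')), ?_, by rw [e]; exact hb'⟩
    rw [e]
    exact (hx.congr hyr hym hyi).update_reg r _
  | store a i r =>
    obtain ⟨y, hy, hyb, hy0, hyr, hym, hyi⟩ := rawExec_addrCmd hb (h2 i) (haddr i _ (ha a))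
    have e : (RawOp.store 0 (rnum r)).eval y =
        { y with mem := Function.update y.mem (width A * s.reg i + anum a) (s.reg r) } := by
      simp [RawOp.eval, hy0, hyr _ (h2 r), hx.reg]
    have hb' := hyb.update_mem (r := width A * s.reg i + anum a) (n := s.reg r) (hr r)
    refine ⟨_, by omega, _, .seq hy (.op _ _ (by rw [e]; exact hb')), ?_, by rw [e]; exact hb'⟩
    rw [e]
    exact (hx.congr hyr hym hyi).update_arr a _ _
  | read r =>
    have e : (RawOp.read (rnum r)).eval x =
        { x with reg := Function.update x.reg (rnum r) (s.inp.headD 0), inp := s.inp.tail } := by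
      simp [RawOp.eval, hx.inp]
    have hb' := hb.update_reg (r := rnum r) (n := s.inp.headD 0)
      (le_numBound' (((headD_le hs.inp).trans (Nat.le_add_right _ _)).trans small_le))
    refine ⟨_, by omega, _, .op _ _ (by rw [e]; exact hb'), ?_, by rw [e]; exact hb'⟩
    rw [e]
    exact { hx.update_reg r (s.inp.headD 0) with inp := rfl }
  | rowLoad i =>
    obtain ⟨y, hy, hyb, hy0, hyr, hym, hyi⟩ := rawExec_addrCmd hb (h2 i) (haddr i _ hcard)
    have e : (RawOp.load 2 0).eval y =
        { y with reg := Function.update y.reg 2 (s.row (s.reg i)) } := by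
      simp [RawOp.eval, hy0, hym, hx.reg, hx.row]
    have hb' := hyb.update_reg (r := 2) (n := s.row (s.reg i))
      (le_numBound' ((hs.row _).trans big_le))
    refine ⟨_, by omega, _, .seq hy (.op _ _ (by rw [e]; exact hb')), ?_, by rw [e]; exact hb'⟩
    rw [e]
    exact (hx.congr hyr hym hyi).update_acc _
  | accAdd r =>
    have hn := hs'.acc
    simp only [Op.eval] at hn
    have e : (RawOp.add 2 2 (rnum r)).eval x =
        { x with reg := Function.update x.reg 2 (s.acc + s.reg r) } := by
      simp [RawOp.eval, hx.reg, hx.acc]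
    have hb' := hb.update_reg (r := 2) (n := s.acc + s.reg r) (le_numBound' (hn.trans big_le))
    refine ⟨_, by omega, _, .op _ _ (by rw [e]; exact hb'), ?_, by rw [e]; exact hb'⟩
    rw [e]
    exact hx.update_acc _
  | rowStore i =>
    obtain ⟨y, hy, hyb, hy0, hyr, hym, hyi⟩ := rawExec_addrCmd hb (h2 i) (haddr i _ hcard)
    have e : (RawOp.store 0 2).eval y =
        { y with mem := Function.update y.mem (width A * s.reg i + Nat.card A) s.acc } := by
      simp [RawOp.eval, hy0, hyr, hx.reg, hx.acc]
    have hb' := hyb.update_mem (r := width A * s.reg i + Nat.card A) (n := s.acc)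
      (le_numBound' (hs.acc.trans big_le))
    refine ⟨_, by omega, _, .seq hy (.op _ _ (by rw [e]; exact hb')), ?_, by rw [e]; exact hb'⟩
    rw [e]
    exact (hx.congr hyr hym hyi).update_row _ _
  | dictLoad r =>
    obtain ⟨y, hy, hyb, hy0, hyr, hym, hyi⟩ := rawExec_addrCmd hb le_rfl haddr2
    have e : (RawOp.load (rnum r) 0).eval y =
        { y with reg := Function.update y.reg (rnum r) (s.dict s.acc) } := by
      simp [RawOp.eval, hy0, hym, hx.acc, hx.dict]
    have hb' := hyb.update_reg (r := rnum r) (n := s.dict s.acc)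
      (le_numBound' ((hs.dict _).trans small_le))
    refine ⟨_, by omega, _, .seq hy (.op _ _ (by rw [e]; exact hb')), ?_, by rw [e]; exact hb'⟩
    rw [e]
    exact (hx.congr hyr hym hyi).update_reg r _
  | dictStore r =>
    obtain ⟨y, hy, hyb, hy0, hyr, hym, hyi⟩ := rawExec_addrCmd hb le_rfl haddr2
    have e : (RawOp.store 0 (rnum r)).eval y =
        { y with mem := Function.update y.mem (width A * s.acc + (Nat.card A + 1)) (s.reg r) } := by
      simp [RawOp.eval, hy0, hyr _ (h2 r), hx.reg, hx.acc]
    have hb' := hyb.update_mem (r := width A * s.acc + (Nat.card A + 1)) (n := s.reg r) (hr r)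
    refine ⟨_, by omega, _, .seq hy (.op _ _ (by rw [e]; exact hb')), ?_, by rw [e]; exact hb'⟩
    rw [e]
    exact (hx.congr hyr hym hyi).update_dict _ _

/-- The translation of a program, started at the time `τ`. -/
theorem Exec.raw_exec {C T : ℕ} {c : Cmd R A} {s s' : St R A} {t : ℕ} (h : Exec c s t s') :
    ∀ τ, τ + t ≤ T → c.ConstLE C → s.Bdd C τ → ∀ x, Rep s x → x.Bdd (numBound A C T) →
    ∃ t' ≤ (width A + 4) * t, ∃ x', RawExec (numBound A C T) c.raw x t' x' ∧ Rep s' x' ∧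
      x'.Bdd (numBound A C T) := by
  induction h with
  | nop s => exact fun τ _ _ _ x hx hb => ⟨0, Nat.zero_le _, x, .nop x, hx, hb⟩
  | op o s =>
    intro τ hτ hc hs x hx hb
    rw [mul_one]
    exact Op.raw_exec hc (hs.mono (by omega)) ((Op.eval_bdd hc hs).mono hτ) hx hb
  | seq h _ ih ih' =>
    intro τ hτ hc hs x hx hb
    obtain ⟨t1, ht1, y, hy, hy1, hy2⟩ := ih τ (by omega) hc.1 hs x hx hb
    obtain ⟨t2, ht2, z, hz, hz1, hz2⟩ := ih' _ (by omega) hc.2 (h.bdd τ hc.1 hs) y hy1 hy2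
    exact ⟨_, by rw [Nat.mul_add]; exact Nat.add_le_add ht1 ht2, z, .seq hy hz, hz1, hz2⟩
  | ifz_zero hr _ ih =>
    intro τ hτ hc hs x hx hb
    obtain ⟨t1, ht1, y, hy, hy1, hy2⟩ := ih τ (by omega) hc.1 hs x hx hb
    exact ⟨_, by rw [Nat.mul_add]; omega, y, .ifz_zero (by rw [hx.reg, hr]) hy, hy1, hy2⟩
  | ifz_pos hr _ ih =>
    intro τ hτ hc hs x hx hb
    obtain ⟨t1, ht1, y, hy, hy1, hy2⟩ := ih τ (by omega) hc.2 hs x hx hb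
    exact ⟨_, by rw [Nat.mul_add]; omega, y, .ifz_pos (by rwa [hx.reg]) hy, hy1, hy2⟩
  | loop_zero hr =>
    intro τ hτ hc hs x hx hb
    exact ⟨1, by omega, x, .loop_zero (by rw [hx.reg, hr]), hx, hb⟩
  | loop_pos hr h _ ih ih' =>
    intro τ hτ hc hs x hx hb
    obtain ⟨t1, ht1, y, hy, hy1, hy2⟩ := ih τ (by omega) hc hs x hx hb
    obtain ⟨t2, ht2, z, hz, hz1, hz2⟩ := ih' _ (by omega) hc (h.bdd τ hc hs) y hy1 hy2
    exact ⟨_, by rw [Nat.mul_add, Nat.mul_add]; omega, z,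
      .loop_pos (by rwa [hx.reg]) hy hz, hz1, hz2⟩

/-- The initial state. -/
def St.init (input : List ℕ) : St R A where
  reg _ := 0
  arr _ _ := 0
  inp := input
  acc := 0
  row _ := 0
  dict _ := 0

/-- A structured program which takes at most `T` steps yields a program for the machine which takes
`O(T)` steps, with numbers of size `O((T + 1) ^ 2)`. -/
theorem Exec.answers {C : ℕ} {c : Cmd R A} (hc : c.ConstLE C) {input : List ℕ}
    (hi : ∀ x ∈ input, x ≤ C) {t T : ℕ} (hT : t ≤ T) {s' : St R A}
    (h : Exec c (.init input) t s') (r : R) :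
    (c.raw.program (rnum r)).AnswersWithin input ((width A + 4) * T + 1)
        (decide (s'.reg r ≠ 0)) ∧
      (c.raw.program (rnum r)).NumbersBoundedBy input (numBound A C T) := by
  obtain ⟨t', ht', x, hx, hx1, -⟩ := h.raw_exec (T := T) (C := C) 0 (by omega) hc
    ⟨fun _ => Nat.zero_le _, fun _ _ => Nat.zero_le _, hi, Nat.zero_le _, fun _ => Nat.zero_le _,
      fun _ => Nat.zero_le _⟩ ⟨fun _ => 0, fun _ => 0, input⟩
    ⟨fun _ => rfl, rfl, fun _ _ => rfl, fun _ => rfl, fun _ => rfl, rfl⟩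
    (fun _ => ⟨Nat.zero_le _, Nat.zero_le _⟩)
  obtain ⟨⟨j, hj, hj'⟩, h2⟩ := hx.answers (rnum r)
  rw [hx1.reg] at hj'
  exact ⟨⟨j, hj.trans (Nat.add_le_add_right (ht'.trans (Nat.mul_le_mul_left _ hT)) 1), hj'⟩, h2⟩

end

end RAM

namespace RAM

/-! ### Reasoning about structured programs -/

section

variable {R A : Type} [DecidableEq R] [DecidableEq A]

/-- Started in `s`, the program `c` ends after at most `T` steps in a state which satisfies `Q`. -/
def Reaches (c : Cmd R A) (s : St R A) (T : ℕ) (Q : St R A → Prop) : Prop :=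
  ∃ t ≤ T, ∃ s', Exec c s t s' ∧ Q s'

theorem Reaches.mono {c : Cmd R A} {s : St R A} {T T' : ℕ} {Q Q' : St R A → Prop}
    (h : Reaches c s T Q) (hT : T ≤ T') (hQ : ∀ s', Q s' → Q' s') : Reaches c s T' Q' := by
  obtain ⟨t, ht, s', h1, h2⟩ := h
  exact ⟨t, ht.trans hT, s', h1, hQ _ h2⟩

theorem Reaches.seq {c d : Cmd R A} {s : St R A} {T T' : ℕ} {P Q : St R A → Prop}
    (h : Reaches c s T P) (h' : ∀ s', P s' → Reaches d s' T' Q) :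
    Reaches (.seq c d) s (T + T') Q := by
  obtain ⟨t, ht, s', h1, h2⟩ := h
  obtain ⟨t', ht', s'', h3, h4⟩ := h' s' h2
  exact ⟨_, Nat.add_le_add ht ht', s'', .seq h1 h3, h4⟩

theorem Reaches.loop_zero {r : R} {c : Cmd R A} {s : St R A} {T : ℕ} {Q : St R A → Prop}
    (hr : s.reg r = 0) (hT : 1 ≤ T) (h : Q s) : Reaches (.loop r c) s T Q :=
  ⟨1, hT, s, .loop_zero hr, h⟩

theorem Reaches.loop_pos {r : R} {c : Cmd R A} {s : St R A} {T T' : ℕ} {Q : St R A → Prop}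
    (hr : s.reg r ≠ 0) (h : Reaches c s T fun s' => Reaches (.loop r c) s' T' Q) :
    Reaches (.loop r c) s (1 + (T + T')) Q := by
  obtain ⟨t, ht, s', h1, t', ht', s'', h2, h3⟩ := h
  exact ⟨_, by omega, s'', .loop_pos hr h1 h2, h3⟩

/-- Loops are handled by an invariant with a ghost parameter, on which the potential depends that
pays for the time. -/
theorem Reaches.loop {γ : Type} {r : R} {c : Cmd R A} (I : γ → St R A → Prop) (Φ : γ → ℕ)
    (h : ∀ g s, I g s → s.reg r ≠ 0 → ∃ T, Reaches c s T fun s' => ∃ g',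
      T + 1 + Φ g' ≤ Φ g ∧ I g' s')
    {g : γ} {s : St R A} (hs : I g s) :
    Reaches (.loop r c) s (Φ g + 1) fun s' => (∃ g', I g' s') ∧ s'.reg r = 0 := by
  induction hn : Φ g using Nat.strong_induction_on generalizing g s with
  | _ n ih =>
    by_cases hr : s.reg r = 0
    · exact .loop_zero hr (by omega) ⟨⟨g, hs⟩, hr⟩
    · obtain ⟨T, t, ht, s', h1, g', h3, h2⟩ := h g s hs hr
      obtain ⟨t', ht', s'', h4, h5⟩ := ih (Φ g') (by omega) h2 rfl
      exact ⟨_, by omega, s'', .loop_pos hr h1 h4, h5⟩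

/-- The effect of a program without loops. -/
def Cmd.eval : Cmd R A → St R A → St R A
  | nop, s => s
  | op o, s => o.eval s
  | seq c d, s => d.eval (c.eval s)
  | ifz r c d, s => if s.reg r = 0 then c.eval s else d.eval s
  | loop _ _, s => s

/-- There are no loops in the program. -/
def Cmd.LoopFree : Cmd R A → Prop
  | nop => True
  | op _ => True
  | seq c d => c.LoopFree ∧ d.LoopFree
  | ifz _ c d => c.LoopFree ∧ d.LoopFree
  | loop _ _ => False

/-- A bound for the time of a program without loops. -/
def Cmd.cost : Cmd R A → ℕ
  | nop => 0
  | op _ => 1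
  | seq c d => c.cost + d.cost
  | ifz _ c d => 1 + (c.cost + d.cost)
  | loop _ _ => 0

theorem Cmd.exec_eval {c : Cmd R A} : c.LoopFree → ∀ s, ∃ t ≤ c.cost, Exec c s t (c.eval s) := by
  induction c with
  | nop => exact fun _ s => ⟨0, le_rfl, .nop s⟩
  | op o => exact fun _ s => ⟨1, le_rfl, .op o s⟩
  | seq c d ih ih' =>
    intro h s
    obtain ⟨t, ht, h1⟩ := ih h.1 s
    obtain ⟨t', ht', h2⟩ := ih' h.2 (c.eval s)
    exact ⟨_, Nat.add_le_add ht ht', .seq h1 h2⟩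
  | ifz r c d ih ih' =>
    intro h s
    obtain ⟨t, ht, h1⟩ := ih h.1 s
    obtain ⟨t', ht', h2⟩ := ih' h.2 s
    by_cases hr : s.reg r = 0
    · refine ⟨_, ?_, by rw [eval, if_pos hr]; exact .ifz_zero hr h1⟩
      simp only [cost]; omega
    · refine ⟨_, ?_, by rw [eval, if_neg hr]; exact .ifz_pos hr h2⟩
      simp only [cost]; omega
  | loop => exact fun h => h.elim

theorem Cmd.LoopFree.reaches {c : Cmd R A} (hc : c.LoopFree) {s : St R A} {Q : St R A → Prop}
    (h : Q (c.eval s)) : Reaches c s c.cost Q := by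
  obtain ⟨t, ht, h1⟩ := Cmd.exec_eval hc s
  exact ⟨t, ht, _, h1, h⟩

/-- A sequence of operations. -/
def Cmd.block : List (Op R A) → Cmd R A
  | [] => .nop
  | o :: l => .seq (.op o) (block l)

omit [DecidableEq R] [DecidableEq A] in
theorem Cmd.loopFree_block (l : List (Op R A)) : (block l).LoopFree := by
  induction l with
  | nil => trivial
  | cons o l ih => exact ⟨trivial, ih⟩

theorem Cmd.eval_block_nil (s : St R A) : (block []).eval s = s := rfl

theorem Cmd.eval_block_cons (o : Op R A) (l : List (Op R A)) (s : St R A) :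
    (block (o :: l)).eval s = (block l).eval (o.eval s) := rfl

theorem Cmd.eval_seq (c d : Cmd R A) (s : St R A) : (seq c d).eval s = d.eval (c.eval s) := rfl

/-- Execute `f k`, where `k` is the content of the register `tmp`, which is counted down. -/
def Cmd.select (tmp : R) : ℕ → (ℕ → Cmd R A) → Cmd R A
  | 0, _ => .nop
  | n + 1, f => .ifz tmp (f 0) (.seq (.op (.dec tmp)) (select tmp n fun i => f (i + 1)))

/-- Execute `f k`, where `k` is the content of the register `r`, if `k < n`. -/
def Cmd.switch (tmp r : R) (n : ℕ) (f : ℕ → Cmd R A) : Cmd R A :=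
  .seq (.op (.move tmp r)) (select tmp n f)

theorem Cmd.eval_select {tmp : R} {n : ℕ} : ∀ {f : ℕ → Cmd R A} {s : St R A},
    s.reg tmp < n → (select tmp n f).eval s =
      (f (s.reg tmp)).eval { s with reg := Function.update s.reg tmp 0 } := by
  induction n with
  | zero => exact fun h => absurd h (by omega)
  | succ n ih =>
    intro f s h
    rw [select, eval]
    by_cases h0 : s.reg tmp = 0
    · rw [if_pos h0, h0]
      congr 1
      rw [show Function.update s.reg tmp 0 = s.reg by rw [← h0, Function.update_eq_self]]
    · rw [if_neg h0, eval, eval, ih]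
      · simp only [Op.eval, Function.update_self, Function.update_idem]
        congr 2
        omega
      · simp only [Op.eval, Function.update_self]; omega

theorem Cmd.eval_switch {tmp r : R} {n : ℕ} {f : ℕ → Cmd R A} {s : St R A} {k : ℕ}
    (hk : s.reg r = k) (h : k < n) : (switch tmp r n f).eval s =
      (f k).eval { s with reg := Function.update s.reg tmp 0 } := by
  subst hk
  rw [switch, eval, eval, eval_select (by simpa [Op.eval] using h)]
  simp [Op.eval]

omit [DecidableEq R] [DecidableEq A] in
theorem Cmd.loopFree_select {tmp : R} {n : ℕ} : ∀ {f : ℕ → Cmd R A}, (∀ i, (f i).LoopFree) →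
    (select tmp n f).LoopFree := by
  induction n with
  | zero => exact fun _ => trivial
  | succ n ih => exact fun h => ⟨h 0, trivial, ih fun i => h (i + 1)⟩

omit [DecidableEq R] [DecidableEq A] in
theorem Cmd.loopFree_switch {tmp r : R} {n : ℕ} {f : ℕ → Cmd R A} (h : ∀ i, (f i).LoopFree) :
    (switch tmp r n f).LoopFree := ⟨trivial, loopFree_select h⟩

/-- The number of an element of a finite type. -/
noncomputable def code {T : Type} [Finite T] (x : T) : ℕ := Finite.equivFin T x

theorem code_inj {T : Type} [Finite T] {x y : T} : code x = code y ↔ x = y := by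
  simp [code, Fin.val_inj]

/-- Execute `f x`, where `code x` is the content of the register `r`. -/
noncomputable def Cmd.cases {T : Type} [Finite T] (tmp r : R) (f : T → Cmd R A) : Cmd R A :=
  switch tmp r (Nat.card T) fun i =>
    if h : i < Nat.card T then f ((Finite.equivFin T).symm ⟨i, h⟩) else .nop

theorem Cmd.eval_cases {T : Type} [Finite T] {tmp r : R} {f : T → Cmd R A} {s : St R A} {x : T}
    (h : s.reg r = code x) : (cases tmp r f).eval s =
      (f x).eval { s with reg := Function.update s.reg tmp 0 } := by
  have hx : code x < Nat.card T := (Finite.equivFin T x).2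
  rw [cases, eval_switch h hx, dif_pos hx]
  simp [code]

omit [DecidableEq R] [DecidableEq A] in
theorem Cmd.loopFree_cases {T : Type} [Finite T] {tmp r : R} {f : T → Cmd R A}
    (h : ∀ x, (f x).LoopFree) : (cases tmp r f).LoopFree := by
  refine loopFree_switch fun i => ?_
  split
  · exact h _
  · trivial

/-- Execute `f x` for all `x` in a list, one after the other. -/
def Cmd.each {T : Type} (l : List T) (f : T → Cmd R A) : Cmd R A :=
  l.foldr (fun x c => .seq (f x) c) .nop

theorem Cmd.eval_each_nil {T : Type} (f : T → Cmd R A) (s : St R A) : (each [] f).eval s = s := rfl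

theorem Cmd.eval_each_cons {T : Type} (x : T) (l : List T) (f : T → Cmd R A) (s : St R A) :
    (each (x :: l) f).eval s = (each l f).eval ((f x).eval s) := rfl

omit [DecidableEq R] [DecidableEq A] in
theorem Cmd.loopFree_each {T : Type} {l : List T} {f : T → Cmd R A} (h : ∀ x, (f x).LoopFree) :
    (each l f).LoopFree := by
  induction l with
  | nil => trivial
  | cons x l ih => exact ⟨h x, ih⟩

/-- An assertion which depends on the part of the list which has been dealt with. -/
theorem Cmd.eval_each {T : Type} {f : T → Cmd R A} (I : List T → St R A → Prop)
    (h : ∀ l x s, I l s → I (l ++ [x]) ((f x).eval s)) :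
    ∀ (l l' : List T) (s : St R A), I l' s → I (l' ++ l) ((each l f).eval s) := by
  intro l
  induction l with
  | nil => intro l' s hs; simpa [each, eval] using hs
  | cons x l ih =>
    intro l' s hs
    have := ih _ _ (h _ x _ hs)
    rwa [List.append_assoc] at this

end

end RAM

namespace Grigorchuk

/-! ### Splitting a word into the words of its sections -/

/-- The elements of the subgroup `{1, b, c, d}`. -/
inductive Run : Type
  | one | b | c | d

namespace Run

instance : Finite Run :=
  Finite.of_surjective (fun i : Fin 4 => match i with | 0 => one | 1 => b | 2 => c | 3 => d)
    (by rintro (_ | _ | _ | _); exacts [⟨0, rfl⟩, ⟨1, rfl⟩, ⟨2, rfl⟩, ⟨3, rfl⟩])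

/-- The element of the group. -/
noncomputable def val : Run → Gamma
  | one => 1
  | b => gb
  | c => gc
  | d => gd

@[simp] theorem val_one : val .one = 1 := rfl
@[simp] theorem val_b : val .b = gb := rfl
@[simp] theorem val_c : val .c = gc := rfl
@[simp] theorem val_d : val .d = gd := rfl

/-- The multiplication of the Klein four-group. -/
def mul : Run → Run → Run
  | one, r => r
  | r, one => r
  | b, b => one
  | b, c => d
  | b, d => c
  | c, b => d
  | c, c => one
  | c, d => b
  | d, b => c
  | d, c => b
  | d, d => one

theorem val_mul (r s : Run) : (r.mul s).val = r.val * s.val := by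
  cases r <;> cases s <;>
    simp [mul, val, gb_mul_gc, gc_mul_gd, gd_mul_gb, gc_mul_gb, gd_mul_gc, gb_mul_gd]

@[simp] theorem par_val (r : Run) : par r.val = false := by cases r <;> simp [val]

/-- The word of the section in the subtree below `e`. -/
def image : Run → Bool → List Letter
  | one, _ => []
  | b, false => [.a]
  | b, true => [.c]
  | c, false => [.a]
  | c, true => [.d]
  | d, false => []
  | d, true => [.b]

theorem wordVal_image (r : Run) (e : Bool) : wordVal (r.image e) = sect r.val e := by
  cases r <;> cases e <;> simp [image, val]

end Run

/-- Weights of the letters for which the sections of a word are lighter than the word by the factor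
`η = 5/6`. They are `6³` times the numbers `1 - η³`, `η³`, `η + η³ - 1`, `η² + η³ - 1`, so that each
of `ab`, `ac`, `ad` has sections whose weights add up to exactly `η` times its own weight. Moreover
each of `b`, `c`, `d` has at most the weight of the other two together. -/
def Letter.weight : Letter → ℕ
  | .a => 91
  | .b => 125
  | .c => 89
  | .d => 59

/-- The sum of the weights of the letters. -/
def weight (w : List Letter) : ℕ := (w.map Letter.weight).sum

@[simp] theorem weight_nil : weight [] = 0 := rfl
@[simp] theorem weight_cons (l : Letter) (w : List Letter) :
    weight (l :: w) = l.weight + weight w := by simp [weight]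
@[simp] theorem weight_append (v w : List Letter) : weight (v ++ w) = weight v + weight w := by
  simp [weight]

theorem length_le_weight (w : List Letter) : 59 * w.length ≤ weight w := by
  induction w with
  | nil => simp
  | cons l w ih => cases l <;> simp [Letter.weight] <;> omega

theorem weight_le_length (w : List Letter) : weight w ≤ 125 * w.length := by
  induction w with
  | nil => simp
  | cons l w ih => cases l <;> simp [Letter.weight] <;> omega

namespace Run

/-- The weight of the letter, or `0` for the trivial element. -/
def weight : Run → ℕ
  | one => 0
  | b => 125
  | c => 89
  | d => 59

@[simp] theorem weight_one : weight .one = 0 := rfl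
@[simp] theorem weight_b : weight .b = 125 := rfl
@[simp] theorem weight_c : weight .c = 89 := rfl
@[simp] theorem weight_d : weight .d = 59 := rfl

theorem weight_mul_le (r s : Run) : (r.mul s).weight ≤ r.weight + s.weight := by
  cases r <;> cases s <;> simp [mul, weight]

theorem weight_image_le (r : Run) :
    6 * (Grigorchuk.weight (r.image false) + Grigorchuk.weight (r.image true)) ≤
      5 * (91 + r.weight) := by
  cases r <;> simp [image, weight, Letter.weight]

end Run

/-- The state of the automaton which reads a word `w = r₀ a r₁ a ⋯ a rₘ`, with runs `rᵢ` of the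
letters `b`, `c`, `d`, and writes a section of the conjugate `a r₁ a ⋯ a (rₘ r₀)`. The components
are the subtree in which the section at the present position lands, the value of the present run,
the value of the first run if it is complete, and the coset of the word which has been written. -/
structure Scan : Type where
  side : Bool
  run : Run
  first : Option Run
  coset : G

namespace Scan

instance : Finite Scan :=
  Finite.of_injective (fun σ : Scan => (σ.side, σ.run, σ.first, σ.coset)) (by
    rintro ⟨_, _, _, _⟩ ⟨_, _, _, _⟩ h
    simpa using h)

/-- The initial state for the section in the subtree below `e`. -/
noncomputable def start (e : Bool) : Scan := ⟨e, .one, none, 1⟩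

/-- The state after a letter. -/
noncomputable def next (σ : Scan) : Letter → Scan
  | .a =>
    match σ.first with
    | none => ⟨!σ.side, .one, some σ.run, σ.coset⟩
    | some r => ⟨!σ.side, .one, some r, σ.coset * toG (wordVal (σ.run.image σ.side))⟩
  | .b => { σ with run := σ.run.mul .b }
  | .c => { σ with run := σ.run.mul .c }
  | .d => { σ with run := σ.run.mul .d }

/-- What is written when a letter is read. -/
def out (σ : Scan) : Letter → List Letter
  | .a =>
    match σ.first with
    | none => []
    | some _ => σ.run.image σ.side
  | _ => []

/-- The state after the end of the word. -/
noncomputable def finish (σ : Scan) : Scan :=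
  match σ.first with
  | none => σ
  | some r => { σ with coset := σ.coset * toG (wordVal ((σ.run.mul r).image σ.side)) }

/-- What is written at the end of the word. -/
def finishOut (σ : Scan) : List Letter :=
  match σ.first with
  | none => []
  | some r => (σ.run.mul r).image σ.side

/-- The state after reading a word, and the word which is written. -/
noncomputable def scan (σ : Scan) : List Letter → Scan × List Letter
  | [] => (σ.finish, σ.finishOut)
  | l :: w => ((scan (σ.next l) w).1, σ.out l ++ (scan (σ.next l) w).2)

/-- Once the first run `r` is complete, the section of the product of the present run, the rest of
the word, and `r` is written. -/
theorem scan_of_first {r : Run} (w : List Letter) : ∀ σ : Scan, σ.first = some r →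
    (σ.scan w).1.first = some r ∧ (σ.scan w).1.side = (σ.side ^^ par (wordVal w)) ∧
    (σ.scan w).1.coset = σ.coset * toG (wordVal (σ.scan w).2) ∧
    wordVal (σ.scan w).2 = sect (σ.run.val * wordVal w * r.val) σ.side := by
  induction w with
  | nil =>
    rintro ⟨e, s, f, q⟩ rfl
    simp [scan, finish, finishOut, Run.wordVal_image, Run.val_mul]
  | cons l w ih =>
    rintro ⟨e, s, f, q⟩ rfl
    cases l
    · obtain ⟨h1, h2, h3, h4⟩ := ih (next ⟨e, s, some r, q⟩ .a) rfl
      refine ⟨h1, ?_, ?_, ?_⟩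
      · rw [scan, h2]; simp [next]
      · rw [scan, h3]; simp [next, out, mul_assoc]
      · rw [scan, wordVal_append, h4]
        simp [out, next, Run.wordVal_image, mul_assoc]
    · obtain ⟨h1, h2, h3, h4⟩ := ih (next ⟨e, s, some r, q⟩ .b) rfl
      refine ⟨h1, ?_, ?_, ?_⟩
      · rw [scan, h2]; simp [next]
      · rw [scan, h3]; simp [next, out]
      · rw [scan, wordVal_append, h4]
        simp [out, next, Run.val_mul, mul_assoc]
    · obtain ⟨h1, h2, h3, h4⟩ := ih (next ⟨e, s, some r, q⟩ .c) rfl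
      refine ⟨h1, ?_, ?_, ?_⟩
      · rw [scan, h2]; simp [next]
      · rw [scan, h3]; simp [next, out]
      · rw [scan, wordVal_append, h4]
        simp [out, next, Run.val_mul, mul_assoc]
    · obtain ⟨h1, h2, h3, h4⟩ := ih (next ⟨e, s, some r, q⟩ .d) rfl
      refine ⟨h1, ?_, ?_, ?_⟩
      · rw [scan, h2]; simp [next]
      · rw [scan, h3]; simp [next, out]
      · rw [scan, wordVal_append, h4]
        simp [out, next, Run.val_mul, mul_assoc]

/-- If the word which is read contains no letter `a`, then its value is found in the state. -/
theorem scan_eq_none (w : List Letter) : ∀ σ : Scan, σ.first = none →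
    (σ.scan w).1.first = none →
    (σ.scan w).1.run.val = σ.run.val * wordVal w ∧ (σ.scan w).2 = [] := by
  induction w with
  | nil =>
    rintro ⟨e, s, f, q⟩ rfl h
    simp [scan, finish, finishOut]
  | cons l w ih =>
    rintro ⟨e, s, f, q⟩ rfl h
    cases l
    · have := (scan_of_first w (next ⟨e, s, none, q⟩ .a) rfl).1
      rw [scan] at h
      rw [h] at this
      exact absurd this (by simp)
    all_goals
      obtain ⟨h1, h2⟩ := ih (next ⟨e, s, none, q⟩ _) rfl h
      rw [scan, h1, h2]
      simp [next, out, Run.val_mul, mul_assoc]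

/-- If the word which is read contains a letter `a`, then the word which is written is a section of
the conjugate by the first run. -/
theorem scan_eq_some {r : Run} (w : List Letter) : ∀ σ : Scan, σ.first = none →
    (σ.scan w).1.first = some r →
    (σ.scan w).1.side = (σ.side ^^ par (wordVal w)) ∧
    (σ.scan w).1.coset = σ.coset * toG (wordVal (σ.scan w).2) ∧
    wordVal (σ.scan w).2 = sect (r.val⁻¹ * (σ.run.val * wordVal w) * r.val) σ.side := by
  induction w with
  | nil =>
    rintro ⟨e, s, f, q⟩ rfl h
    simp [scan, finish] at h
  | cons l w ih =>
    rintro ⟨e, s, f, q⟩ rfl h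
    cases l
    · obtain ⟨h1, h2, h3, h4⟩ := scan_of_first w (next ⟨e, s, none, q⟩ .a) rfl
      rw [scan] at h
      obtain rfl : s = r := Option.some.inj (h1.symm.trans h)
      refine ⟨?_, ?_, ?_⟩
      · rw [scan, h2]; simp [next]
      · rw [scan, h3]; simp [next, out]
      · rw [scan, wordVal_append, h4]
        simp [next, out]
    all_goals
      obtain ⟨h1, h2, h3⟩ := ih (next ⟨e, s, none, q⟩ _) rfl h
      refine ⟨?_, ?_, ?_⟩
      · rw [scan, h1]; simp [next]
      · rw [scan, h2]; simp [next, out]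
      · rw [scan, wordVal_append, h3]
        simp [next, out, Run.val_mul, mul_assoc]

/-- The first run does not depend on the subtree. -/
theorem scan_first_congr (w : List Letter) : ∀ σ τ : Scan, σ.run = τ.run → σ.first = τ.first →
    (σ.scan w).1.first = (τ.scan w).1.first := by
  induction w with
  | nil =>
    rintro ⟨e, s, f, q⟩ ⟨e', s', f', q'⟩ rfl rfl
    cases f <;> rfl
  | cons l w ih =>
    rintro ⟨e, s, f, q⟩ ⟨e', s', f', q'⟩ rfl rfl
    rw [scan, scan]
    refine ih _ _ ?_ ?_ <;> cases l <;> cases f <;> rfl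

/-- Both sections together are lighter than what is read. Every letter `a` is paired with the run
whose two images are written when it is read, and an extra weight `91` of a letter `a` is needed for
the last run, which is written at the end. -/
theorem weight_scan_of_first {r : Run} (w : List Letter) : ∀ σ τ : Scan, σ.run = τ.run →
    σ.first = some r → τ.first = some r → (σ.side = !τ.side) →
    6 * (weight (σ.scan w).2 + weight (τ.scan w).2) ≤
      5 * (91 + σ.run.weight + weight w + r.weight) := by
  have him : ∀ (s : Run) (e : Bool), 6 * (weight (s.image (!e)) + weight (s.image e)) ≤
      5 * (91 + s.weight) := by
    intro s e
    have := s.weight_image_le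
    cases e <;> simp only [Bool.not_true, Bool.not_false] <;> omega
  induction w with
  | nil =>
    rintro ⟨e, s, f, q⟩ ⟨e', s', f', q'⟩ rfl rfl rfl h
    obtain rfl : e = !e' := h
    have h1 := him (s.mul r) e'
    have h2 := s.weight_mul_le r
    simp only [scan, finishOut, weight_nil]
    omega
  | cons l w ih =>
    rintro ⟨e, s, f, q⟩ ⟨e', s', f', q'⟩ rfl rfl rfl h
    obtain rfl : e = !e' := h
    have h3 := ih (next ⟨!e', s, some r, q⟩ l) (next ⟨e', s, some r, q'⟩ l)
      (by cases l <;> rfl) (by cases l <;> rfl) (by cases l <;> rfl) (by cases l <;> rfl)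
    have h1 := him s e'
    cases l
    · simp only [scan, out, weight_append, weight_cons, Letter.weight]
      simp only [next, Run.weight_one] at h3 ⊢
      omega
    all_goals
      simp only [scan, out, weight_append, weight_cons, Letter.weight, weight_nil]
      simp only [next] at h3 ⊢
      have h2 := s.weight_mul_le
      first
        | have h2 := h2 .b; rw [Run.weight_b] at h2; omega
        | have h2 := h2 .c; rw [Run.weight_c] at h2; omega
        | have h2 := h2 .d; rw [Run.weight_d] at h2; omega

/-- The first letter `a` provides the weight needed for the last run. -/
theorem weight_scan (w : List Letter) : ∀ σ τ : Scan, σ.run = τ.run →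
    σ.first = none → τ.first = none → (σ.side = !τ.side) →
    6 * (weight (σ.scan w).2 + weight (τ.scan w).2) ≤ 5 * (σ.run.weight + weight w) := by
  induction w with
  | nil =>
    rintro ⟨e, s, f, q⟩ ⟨e', s', f', q'⟩ rfl rfl rfl h
    obtain rfl : e = !e' := h
    simp [scan, finishOut]
  | cons l w ih =>
    rintro ⟨e, s, f, q⟩ ⟨e', s', f', q'⟩ rfl rfl rfl h
    obtain rfl : e = !e' := h
    have h3 := ih (next ⟨!e', s, none, q⟩ l) (next ⟨e', s, none, q'⟩ l) (by cases l <;> rfl)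
    cases l
    · have h3 := weight_scan_of_first w (next ⟨!e', s, none, q⟩ .a) (next ⟨e', s, none, q'⟩ .a)
        rfl rfl rfl rfl
      simp only [scan, out, weight_append, weight_cons, Letter.weight, weight_nil]
      simp only [next, Run.weight_one] at h3 ⊢
      omega
    all_goals
      have h3 := h3 rfl rfl rfl
      simp only [scan, out, weight_append, weight_cons, Letter.weight, weight_nil]
      simp only [next] at h3 ⊢
      have h2 := s.weight_mul_le
      first
        | have h2 := h2 .b; rw [Run.weight_b] at h2; omega
        | have h2 := h2 .c; rw [Run.weight_c] at h2; omega
        | have h2 := h2 .d; rw [Run.weight_d] at h2; omega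

end Scan

/-- What the machine records about a word: its value if there is no letter `a` in it; otherwise the
first run, whether the element fixes the first level, and if not, the cosets of its sections. -/
inductive Info : Type
  | leaf (r : Run)
  | even (r : Run)
  | odd (r : Run) (q₀ q₁ : G)

instance : Finite Info :=
  Finite.of_injective (β := Run ⊕ Run ⊕ (Run × G × G))
    (fun i => match i with
      | .leaf r => .inl r
      | .even r => .inr (.inl r)
      | .odd r q₀ q₁ => .inr (.inr (r, q₀, q₁)))
    (by rintro (_ | _ | _) (_ | _ | _) h <;> simp_all)

/-- The information about a word, from the states after the two scans. -/
def Scan.info (σ τ : Scan) : Info :=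
  match σ.first with
  | none => .leaf σ.run
  | some r => if σ.side then .odd r σ.coset τ.coset else .even r

/-- The information about a word. -/
noncomputable def infoOf (w : List Letter) : Info :=
  ((Scan.start false).scan w).1.info ((Scan.start true).scan w).1

/-- The shorter words to which a word is reduced: those of its two sections, or that of the product
of the sections if the first level is not fixed (always up to conjugation by the first run). -/
noncomputable def split (w : List Letter) : List (List Letter) :=
  match infoOf w with
  | .leaf _ => []
  | .even _ => [((Scan.start false).scan w).2, ((Scan.start true).scan w).2]
  | .odd _ _ _ => [((Scan.start false).scan w).2 ++ ((Scan.start true).scan w).2]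

theorem infoOf_leaf {w : List Letter} {r : Run} (h : infoOf w = .leaf r) :
    wordVal w = r.val ∧ ((Scan.start false).scan w).2 = [] ∧
      ((Scan.start true).scan w).2 = [] := by
  unfold infoOf Scan.info at h
  split at h
  next hf =>
    obtain ⟨h1, h2⟩ := Scan.scan_eq_none w (Scan.start false) rfl hf
    have h3 := (Scan.scan_eq_none w (Scan.start true) rfl
      ((Scan.scan_first_congr w (Scan.start true) (Scan.start false) rfl rfl).trans hf)).2
    obtain rfl := Info.leaf.inj h
    exact ⟨by simpa [Scan.start] using h1.symm, h2, h3⟩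
  next hf => split at h <;> exact absurd h (by simp)

/-- The conjugate of the value of a word by its first run. -/
noncomputable def core (r : Run) (w : List Letter) : Gamma := r.val⁻¹ * wordVal w * r.val

theorem wordVal_eq_core (r : Run) (w : List Letter) : wordVal w = r.val * core r w * r.val⁻¹ := by
  unfold core; group

theorem par_core (r : Run) (w : List Letter) : par (core r w) = par (wordVal w) := by
  simp [core]

theorem infoOf_even {w : List Letter} {r : Run} (h : infoOf w = .even r) :
    par (core r w) = false ∧
      ∀ e, wordVal ((Scan.start e).scan w).2 = sect (core r w) e := by
  unfold infoOf Scan.info at h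
  split at h
  next => exact absurd h (by simp)
  next r' hf =>
    split at h
    next => exact absurd h (by simp)
    next hs =>
      obtain rfl := Info.even.inj h
      have key : ∀ e, ((Scan.start e).scan w).1.first = some r' := fun e =>
        (Scan.scan_first_congr w (Scan.start e) (Scan.start false) rfl rfl).trans hf
      refine ⟨?_, fun e => ?_⟩
      · have := (Scan.scan_eq_some w (Scan.start false) rfl (key false)).1
        rw [par_core]
        simpa [Scan.start] using this.symm.trans (by simpa using hs)
      · have := (Scan.scan_eq_some w (Scan.start e) rfl (key e)).2.2
        rw [this]
        simp [Scan.start, core]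

theorem infoOf_odd {w : List Letter} {r : Run} {q₀ q₁ : G} (h : infoOf w = .odd r q₀ q₁) :
    par (core r w) = true ∧ q₀ = toG (sect (core r w) false) ∧ q₁ = toG (sect (core r w) true) ∧
      ∀ e, wordVal ((Scan.start e).scan w).2 = sect (core r w) e := by
  unfold infoOf Scan.info at h
  split at h
  next => exact absurd h (by simp)
  next r' hf =>
    split at h
    next hs =>
      obtain ⟨rfl, rfl, rfl⟩ := Info.odd.inj h
      have key : ∀ e, ((Scan.start e).scan w).1.first = some r' := fun e =>
        (Scan.scan_first_congr w (Scan.start e) (Scan.start false) rfl rfl).trans hf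
      have key2 : ∀ e, wordVal ((Scan.start e).scan w).2 = sect (core r' w) e := fun e => by
        have := (Scan.scan_eq_some w (Scan.start e) rfl (key e)).2.2
        rw [this]
        simp [Scan.start, core]
      refine ⟨?_, ?_, ?_, key2⟩
      · have := (Scan.scan_eq_some w (Scan.start false) rfl (key false)).1
        rw [par_core]
        simpa [Scan.start] using this.symm.trans hs
      · rw [(Scan.scan_eq_some w (Scan.start false) rfl (key false)).2.1, key2]
        exact one_mul _
      · rw [(Scan.scan_eq_some w (Scan.start true) rfl (key true)).2.1, key2]
        exact one_mul _
    next => exact absurd h (by simp)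

/-- The words to which a word is reduced are lighter by the factor `5/6`. -/
theorem weight_split (w : List Letter) : 6 * ((split w).map weight).sum ≤ 5 * weight w := by
  have h := Scan.weight_scan w (Scan.start false) (Scan.start true) rfl rfl rfl rfl
  simp only [Scan.start, Run.weight_one, zero_add] at h
  unfold split
  split
  · simp
  · simpa [Scan.start] using h
  · simpa [Scan.start] using h

theorem length_split_le (w : List Letter) : (split w).length ≤ 2 := by
  unfold split
  split <;> simp

theorem split_nil : split [] = [] := by
  simp [split, infoOf, Scan.scan, Scan.finish, Scan.start, Scan.info]

end Grigorchuk

namespace Grigorchuk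

open RAM

/-! ### Registers and arrays of the program -/

/-- The registers of the program. Among them are the ends `head`, `tail` of the queue of words, the
number `cnt` of all words and `roots` of the given words, the first number `next` that no class has
got, and the answer `ans`. -/
inductive Reg : Type
  | tmp | x | y | u | v | st | st' | pos | head | tail | cnt | i | roots | nonempty | empties | ans
  | next | c₀ | c₁
  deriving DecidableEq

instance : Finite Reg :=
  Finite.of_injective (fun r => (⟨r.ctorIdx, by cases r <;> decide⟩ : Fin 19)) (fun r r' h => by
    cases r <;> cases r' <;> first | rfl | exact absurd h (by decide))

/-- The arrays of the program: the queue of words, as a string of codes; for each word, the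
information on it, the index of the first of the words to which it is reduced, and (in `vec p`) the
number of the class `conjCls g p` of its value `g`; the dictionary for the keys of the elements
which do not fix the first level, one array for each coset; and marks for the numbers which belong
to conjugates of the given words. -/
inductive Arr : Type
  | word | info | child | used
  | vec (p : G)
  | odd (q : G)

noncomputable instance : DecidableEq Arr := Classical.decEq _

instance : Finite Arr :=
  Finite.of_injective (β := Fin 4 ⊕ G ⊕ G)
    (fun a => match a with
      | .word => .inl 0
      | .info => .inl 1
      | .child => .inl 2
      | .used => .inl 3
      | .vec p => .inr (.inl p)
      | .odd q => .inr (.inr q))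
    (by rintro (_ | _ | _ | _ | _ | _) (_ | _ | _ | _ | _ | _) h <;> simp_all)

/-- The states of the program. -/
abbrev State : Type := St Reg Arr

/-- The commands of the program. -/
abbrev Code : Type := Cmd Reg Arr

/-- `s'` differs from `s` at most in the given registers and arrays. -/
structure Frame (rs : List Reg) (as : List Arr) (s s' : State) : Prop where
  reg : ∀ r, r ∉ rs → s'.reg r = s.reg r
  arr : ∀ a, a ∉ as → s'.arr a = s.arr a
  row : s'.row = s.row
  dict : s'.dict = s.dict

theorem Frame.refl (rs : List Reg) (as : List Arr) (s : State) : Frame rs as s s :=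
  ⟨fun _ _ => rfl, fun _ _ => rfl, rfl, rfl⟩

theorem Frame.trans {rs : List Reg} {as : List Arr} {s s' s'' : State} (h : Frame rs as s s')
    (h' : Frame rs as s' s'') : Frame rs as s s'' :=
  ⟨fun r hr => (h'.reg r hr).trans (h.reg r hr), fun a ha => (h'.arr a ha).trans (h.arr a ha),
    h'.row.trans h.row, h'.dict.trans h.dict⟩

theorem Frame.mono {rs rs' : List Reg} {as as' : List Arr} {s s' : State} (h : Frame rs as s s')
    (hr : rs ⊆ rs') (ha : as ⊆ as') : Frame rs' as' s s' :=
  ⟨fun r hr' => h.reg r fun h => hr' (hr h), fun a ha' => h.arr a fun h => ha' (ha h),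
    h.row, h.dict⟩

/-- The dictionary and the marks are still empty. -/
structure Clean (s : State) : Prop where
  used : s.arr .used = fun _ => 0
  odd : ∀ q, s.arr (.odd q) = fun _ => 0
  row : s.row = fun _ => 0
  dict : s.dict = fun _ => 0

/-- The string `l` is in the array `word`, and `tail` is its length. -/
structure Holds (s : State) (l : List ℕ) : Prop where
  tail : s.reg .tail = l.length
  word : ∀ (j) (h : j < l.length), s.arr .word j = l[j]

theorem holds_push {s s' : State} {l : List ℕ} {n : ℕ} (h : Holds s l)
    (ht : s'.reg .tail = s.reg .tail + 1)
    (hw : s'.arr .word = Function.update (s.arr .word) (s.reg .tail) n) : Holds s' (l ++ [n]) where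
  tail := by rw [ht, h.tail]; simp
  word j hj := by
    rw [hw, h.tail, Function.update_apply]
    rcases lt_or_eq_of_le (Nat.lt_succ_iff.1 (by simpa using hj)) with h1 | h1
    · rw [if_neg h1.ne, h.word j h1, List.getElem_append_left h1]
    · subst h1
      simp

/-! ### Copying the input -/

/-- Deal with the symbol in the register `x`, and read the next one. -/
def copyBody : Code :=
  .seq (.block [.store .word .tail .x, .inc .tail, .const .y 5, .sub .y .y .x])
    (.seq
      (.ifz .y
        (.seq (.op (.inc .cnt))
          (.seq
            (.ifz .nonempty (.ifz .empties (.op (.const .empties 1)) (.op (.const .ans 1))) .nop)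
            (.op (.const .nonempty 0))))
        (.op (.const .nonempty 1)))
      (.ifz .ans (.op (.read .x)) (.op (.const .x 0))))

theorem loopFree_copyBody : copyBody.LoopFree :=
  ⟨Cmd.loopFree_block _, by simp [Cmd.LoopFree]⟩

/-- While the input is copied: the string `l` has been copied, which consists of `n` words with `e`
empty words among them and perhaps the beginning of another word (`f` says whether it has begun),
and `str` has still to be copied. -/
structure Copying (l : List ℕ) (n e f : ℕ) (str : List ℕ) (s : State) : Prop where
  clean : Clean s
  holds : Holds s l
  cnt : s.reg .cnt = n
  empties : s.reg .empties = e
  nonempty : s.reg .nonempty = f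
  ans : s.reg .ans = 0
  x : s.reg .x = str.headD 0
  inp : s.inp = str.tail

theorem Copying.letter {l : List ℕ} {n e f : ℕ} {z : Letter} {str : List ℕ} {s : State}
    (h : Copying l n e f (z.code :: str) s) :
    Copying (l ++ [z.code]) n e 1 str (copyBody.eval s) := by
  have hx : s.reg .x = z.code := h.x
  have hi : s.inp = str := h.inp
  have hy : 5 - z.code ≠ 0 := by cases z <;> simp [Letter.code]
  have key : copyBody.eval s = (Op.read .x).eval ((Op.const .nonempty 1).eval
      ((Cmd.block [.store .word .tail .x, .inc .tail, .const .y 5, .sub .y .y .x]).eval s)) := by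
    simp [copyBody, Cmd.eval, Op.eval, Cmd.eval_block_cons, Cmd.eval_block_nil, hx, hy,
      h.ans]
  rw [key]
  constructor
  · constructor <;> simp [Op.eval, Cmd.eval_block_cons, Cmd.eval_block_nil, h.clean.used,
      h.clean.odd, h.clean.row, h.clean.dict]
  · refine holds_push h.holds ?_ ?_ <;>
      simp [Op.eval, Cmd.eval_block_cons, Cmd.eval_block_nil, hx]
  all_goals simp [Op.eval, Cmd.eval_block_cons, Cmd.eval_block_nil, h.cnt,
    h.empties, h.ans, hi]

theorem Copying.marker {l : List ℕ} {n e f : ℕ} {str : List ℕ} {s : State}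
    (h : Copying l n e f (5 :: str) s) (hef : f ≠ 0 ∨ e = 0) :
    Copying (l ++ [5]) (n + 1) (if f = 0 then 1 else e) 0 str (copyBody.eval s) := by
  have hx : s.reg .x = 5 := h.x
  have hi : s.inp = str := h.inp
  have key : copyBody.eval s = (Op.read .x).eval ((Op.const .nonempty 0).eval
      ((Op.const .empties (if f = 0 then 1 else e)).eval ((Op.inc .cnt).eval
      ((Cmd.block [.store .word .tail .x, .inc .tail, .const .y 5, .sub .y .y .x]).eval s)))) := by
    by_cases hf : f = 0
    · have he : e = 0 := by tauto
      simp [copyBody, Cmd.eval, Op.eval, Cmd.eval_block_cons, Cmd.eval_block_nil, hx,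
        h.ans, h.nonempty, h.empties, hf, he]
    · have : ∀ g : Reg → ℕ, g .empties = e → Function.update g .empties e = g := by
        rintro g rfl; simp
      simp [copyBody, Cmd.eval, Op.eval, Cmd.eval_block_cons, Cmd.eval_block_nil, hx,
        h.ans, h.nonempty, hf]
      rw [this]
      simp [h.empties]
  rw [key]
  constructor
  · constructor <;> simp [Op.eval, Cmd.eval_block_cons, Cmd.eval_block_nil, h.clean.used,
      h.clean.odd, h.clean.row, h.clean.dict]
  · refine holds_push h.holds ?_ ?_ <;>
      simp [Op.eval, Cmd.eval_block_cons, Cmd.eval_block_nil, hx]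
  all_goals simp [Op.eval, Cmd.eval_block_cons, Cmd.eval_block_nil, h.cnt,
    h.ans, hi]

theorem Copying.second_empty {l : List ℕ} {n e : ℕ} {str : List ℕ} {s : State}
    (h : Copying l n e 0 (5 :: str) s) (he : e ≠ 0) :
    (copyBody.eval s).reg .ans = 1 ∧ (copyBody.eval s).reg .x = 0 := by
  have hx : s.reg .x = 5 := h.x
  constructor <;> simp [copyBody, Cmd.eval, Op.eval, Cmd.eval_block_cons, Cmd.eval_block_nil, hx,
    h.nonempty, h.empties, he]

theorem reaches_copy_letters {Q : State → Prop} {T e n : ℕ} {str : List ℕ} (w : List Letter) :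
    ∀ {l : List ℕ} {f : ℕ} {s : State}, Copying l n e f (w.map Letter.code ++ str) s →
    (∀ s', Copying (l ++ w.map Letter.code) n e (if w = [] then f else 1) str s' →
      Reaches (.loop .x copyBody) s' T Q) →
    Reaches (.loop .x copyBody) s (T + (copyBody.cost + 1) * w.length) Q := by
  induction w with
  | nil =>
    intro l f s h hQ
    exact hQ s (by simpa using h)
  | cons z w ih =>
    intro l f s h hQ
    have h0 : s.reg .x ≠ 0 := by
      rw [h.x]; cases z <;> simp [Letter.code]
    refine (Reaches.loop_pos (T' := T + (copyBody.cost + 1) * w.length) h0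
      (loopFree_copyBody.reaches ?_)).mono ?_ fun _ h => h
    · refine ih h.letter fun s' hs' => hQ s' ?_
      have : (if w = [] then 1 else 1) = 1 := by split <;> rfl
      rw [this] at hs'
      simpa using hs'
    · rw [List.length_cons, Nat.mul_succ]; omega

/-- The number of empty words. -/
def numEmpty (ws : List (List Letter)) : ℕ := ws.countP List.isEmpty

theorem encode_cons (w : List Letter) (ws : List (List Letter)) :
    encode (w :: ws) = w.map Letter.code ++ 5 :: encode ws := by
  simp [encode]

theorem encode_append (ws ws' : List (List Letter)) :
    encode (ws ++ ws') = encode ws ++ encode ws' := by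
  simp [encode]

/-- The time depends on the total length only, since the loop is left at the second empty word. -/
theorem reaches_copy_loop (ws : List (List Letter)) : ∀ {l : List ℕ} {n e : ℕ} {s : State},
    Copying l n e 0 (encode ws) s → e ≤ 1 →
    Reaches (.loop .x copyBody) s ((copyBody.cost + 1) * (2 * totalLength ws + 2 - e) + 1) fun s' =>
      (s'.reg .ans = 1 ∧ 2 ≤ e + numEmpty ws) ∨
      (Copying (l ++ encode ws) (n + ws.length) (e + numEmpty ws) 0 [] s' ∧
        e + numEmpty ws ≤ 1) := by
  induction ws with
  | nil =>
    intro l n e s h he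
    refine .loop_zero h.x (by omega) (Or.inr ?_)
    exact ⟨by simpa [numEmpty, encode] using h, by simpa [numEmpty] using he⟩
  | cons w ws ih =>
    intro l n e s h he
    have htl : totalLength (w :: ws) = w.length + totalLength ws := by simp [totalLength]
    rw [encode_cons] at h
    have h0 : ∀ s' : State, s'.reg .x = (5 :: encode ws).headD 0 → s'.reg .x ≠ 0 := by
      intro s' h; rw [h]; simp
    by_cases hw : w = []
    · subst hw
      have hne : numEmpty ([] :: ws) = numEmpty ws + 1 := by simp [numEmpty]
      by_cases he0 : e = 0
      · subst he0
        have hm : Copying _ _ 1 0 _ _ := h.marker (Or.inr rfl)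
        refine (Reaches.loop_pos (h0 s h.x) (loopFree_copyBody.reaches
          (ih hm le_rfl))).mono ?_ ?_
        · rw [htl, List.length_nil, zero_add,
            show 2 * totalLength ws + 2 - 0 = 2 * totalLength ws + 2 - 1 + 1 by omega, Nat.mul_succ]
          omega
        · rintro s' (⟨h1, h2⟩ | ⟨h1, h2⟩)
          · exact Or.inl ⟨h1, by omega⟩
          · refine Or.inr ⟨?_, by omega⟩
            rw [hne, encode_cons, show 0 + (numEmpty ws + 1) = 1 + numEmpty ws by omega]
            simpa [add_assoc, add_comm 1] using h1
      · have := h.second_empty he0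
        refine (Reaches.loop_pos (h0 s h.x) (loopFree_copyBody.reaches
          (Reaches.loop_zero (T := 1) this.2 le_rfl (Or.inl ⟨this.1, by omega⟩)))).mono ?_
          fun _ h => h
        have : copyBody.cost + 1 ≤ (copyBody.cost + 1) * (2 * totalLength ([] :: ws) + 2 - e) :=
          Nat.le_mul_of_pos_right _ (by omega)
        omega
    · have hne : numEmpty (w :: ws) = numEmpty ws := by simp [numEmpty, hw]
      have hpos : 1 ≤ w.length := List.length_pos_iff.2 hw
      have step : ∀ s' : State, Copying (l ++ w.map Letter.code) n e (if w = [] then 0 else 1)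
          (5 :: encode ws) s' → _ := fun s' hs' => by
        rw [if_neg hw] at hs'
        have hm : Copying _ _ e 0 _ _ := hs'.marker (Or.inl one_ne_zero)
        exact Reaches.loop_pos (h0 s' hs'.x) (loopFree_copyBody.reaches (ih hm he))
      refine (reaches_copy_letters w h step).mono ?_ ?_
      · rw [htl]
        have e1 : 2 * (w.length + totalLength ws) + 2 - e =
            (2 * totalLength ws + 2 - e) + (w.length + w.length) := by omega
        rw [e1, Nat.mul_add, Nat.mul_add _ w.length]
        have : (copyBody.cost + 1) * 1 ≤ (copyBody.cost + 1) * w.length :=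
          Nat.mul_le_mul_left _ hpos
        omega
      · rintro s' (⟨h1, h2⟩ | ⟨h1, h2⟩)
        · exact Or.inl ⟨h1, by omega⟩
        · refine Or.inr ⟨?_, by omega⟩
          rw [hne, encode_cons]
          simpa [add_assoc, add_comm 1] using h1

/-- Copy the input to the array `word`, unless there are two empty words. -/
def copy : Code := .seq (.op (.read .x)) (.loop .x copyBody)

theorem reaches_copy (ws : List (List Letter)) :
    Reaches copy (.init (encode ws)) (1 + ((copyBody.cost + 1) * (2 * totalLength ws + 2) + 1))
      fun s' => (s'.reg .ans = 1 ∧ 2 ≤ numEmpty ws) ∨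
        (Clean s' ∧ Holds s' (encode ws) ∧ s'.reg .cnt = ws.length ∧ s'.reg .ans = 0 ∧
          numEmpty ws ≤ 1) := by
  have h0 : Copying [] 0 0 0 (encode ws) ((Op.read .x).eval (.init (encode ws) : State)) := by
    constructor
    · constructor <;> simp [Op.eval, St.init]
    · constructor <;> simp [Op.eval, St.init]
    all_goals simp [Op.eval, St.init]
  refine ((Cmd.LoopFree.reaches (c := .op (.read .x)) trivial ?_).seq (P := fun s =>
    Copying [] 0 0 0 (encode ws) s) fun s' hs' => reaches_copy_loop ws hs' (Nat.zero_le 1)).mono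
      le_rfl ?_
  · exact h0
  · rintro s' (⟨h1, h2⟩ | ⟨h1, h2⟩)
    · exact Or.inl ⟨h1, by omega⟩
    · exact Or.inr ⟨h1.clean, by simpa using h1.holds, by simpa using h1.cnt, h1.ans, by omega⟩

theorem length_le_totalLength (ws : List (List Letter)) :
    ws.length ≤ totalLength ws + numEmpty ws := by
  induction ws with
  | nil => simp
  | cons w ws ih =>
    have htl : totalLength (w :: ws) = w.length + totalLength ws := by simp [totalLength]
    cases w with
    | nil =>
      have : numEmpty ([] :: ws) = numEmpty ws + 1 := by simp [numEmpty]
      simp only [List.length_cons, List.length_nil] at *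
      omega
    | cons l w =>
      have : numEmpty ((l :: w) :: ws) = numEmpty ws := by simp [numEmpty]
      simp only [List.length_cons] at *
      omega

theorem hasConjugatePair_of_numEmpty {ws : List (List Letter)} (h : 2 ≤ numEmpty ws) :
    HasConjugatePair ws := by
  rw [numEmpty, List.countP_eq_length_filter] at h
  obtain ⟨a, b, l, hl⟩ : ∃ a b l, ws.filter List.isEmpty = a :: b :: l := by
    match hf : ws.filter List.isEmpty, h with
    | a :: b :: l, _ => exact ⟨a, b, l, rfl⟩
  have hsub : [a, b].Sublist ws := by
    refine List.Sublist.trans ?_ (List.filter_sublist (p := List.isEmpty))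
    rw [hl]
    exact (List.nil_sublist l).cons_cons b |>.cons_cons a
  have hmem : ∀ c ∈ [a, b], c = [] := by
    intro c hc
    have : c ∈ ws.filter List.isEmpty := by rw [hl]; simp only [List.mem_cons] at hc ⊢; tauto
    simpa using (List.mem_filter.1 this).2
  obtain ⟨f, hf⟩ := List.sublist_iff_exists_fin_orderEmbedding_get_eq.1 hsub
  refine ⟨f 0, f 1, fun e => absurd (f.injective e) (by simp), ?_⟩
  rw [← hf, ← hf, hmem _ (List.get_mem _ _), hmem _ (List.get_mem _ _)]

end Grigorchuk

namespace Grigorchuk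

open RAM

/-! ### Reducing all words to shorter words -/

/-- Append a string to the array `word`. -/
def emit (m : List ℕ) : Code :=
  .each m fun n => .block [.const .v n, .store .word .tail .v, .inc .tail]

theorem loopFree_emit (m : List ℕ) : (emit m).LoopFree :=
  Cmd.loopFree_each fun _ => Cmd.loopFree_block _

theorem eval_emit (m : List ℕ) {l : List ℕ} {s : State} (h : Holds s l) :
    Holds ((emit m).eval s) (l ++ m) ∧ Frame [.v, .tail] [.word] s ((emit m).eval s) := by
  rw [emit]
  have := Cmd.eval_each
    (f := fun n => (.block [.const .v n, .store .word .tail .v, .inc .tail] : Code))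
    (fun m s' => Holds s' (l ++ m) ∧ Frame [.v, .tail] [.word] s s') ?_ m [] s
    ⟨by simpa using h, .refl _ _ _⟩
  · simpa using this
  · rintro m n s' ⟨h1, h2⟩
    constructor
    · rw [← List.append_assoc]
      refine holds_push h1 ?_ ?_ <;>
        simp [Op.eval, Cmd.eval_block_cons, Cmd.eval_block_nil]
    · refine h2.trans ⟨fun r hr => ?_, fun a ha => ?_, rfl, rfl⟩
      · simp only [List.mem_cons, List.not_mem_nil, or_false, not_or] at hr
        simp [Op.eval, Cmd.eval_block_cons, Cmd.eval_block_nil, Function.update_of_ne hr.1,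
          Function.update_of_ne hr.2]
      · simp only [List.mem_cons, List.not_mem_nil, or_false] at ha
        simp [Op.eval, Cmd.eval_block_cons, Cmd.eval_block_nil, Function.update_of_ne ha]

/-- What the scanning automaton does on a symbol, the code `5` being the end marker. -/
noncomputable def Scan.onSymbol (σ : Scan) : ℕ → Scan × List Letter
  | 1 => (σ.next .a, σ.out .a)
  | 2 => (σ.next .b, σ.out .b)
  | 3 => (σ.next .c, σ.out .c)
  | 4 => (σ.next .d, σ.out .d)
  | _ => (σ.finish, σ.finishOut)

theorem Scan.onSymbol_code (σ : Scan) (z : Letter) : σ.onSymbol z.code = (σ.next z, σ.out z) := by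
  cases z <;> rfl

/-- Let the automaton read one symbol. -/
noncomputable def passBody : Code :=
  .seq (.block [.load .x .word .pos, .inc .pos])
    (.seq
      (.cases .tmp .st fun σ : Scan => .switch .tmp .x 6 fun n =>
        .seq (.op (.const .st (code (σ.onSymbol n).1))) (emit ((σ.onSymbol n).2.map Letter.code)))
      (.block [.const .y 5, .sub .y .y .x]))

theorem loopFree_passBody : passBody.LoopFree :=
  ⟨Cmd.loopFree_block _, Cmd.loopFree_cases fun _ => Cmd.loopFree_switch fun _ =>
    ⟨trivial, loopFree_emit _⟩, Cmd.loopFree_block _⟩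

/-- The registers which are changed in the course of a scan. -/
abbrev scanRegs : List Reg := [.tmp, .x, .y, .v, .st, .pos, .tail]

theorem eval_passBody {l : List ℕ} {s : State} (h : Holds s l) {p n : ℕ} (hp : s.reg .pos = p)
    (hl : l[p]? = some n) (hn : n ≤ 5) {σ : Scan} (hσ : s.reg .st = code σ) :
    Holds (passBody.eval s) (l ++ (σ.onSymbol n).2.map Letter.code) ∧
      (passBody.eval s).reg .st = code (σ.onSymbol n).1 ∧ (passBody.eval s).reg .pos = p + 1 ∧
      (passBody.eval s).reg .y = 5 - n ∧ (passBody.eval s).reg .x = n ∧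
      Frame scanRegs [.word] s (passBody.eval s) := by
  obtain ⟨hpl, hl⟩ := List.getElem?_eq_some_iff.1 hl
  have hw := h.word p hpl
  rw [hl] at hw
  rw [passBody, Cmd.eval_seq, Cmd.eval_seq, Cmd.eval_cases (x := σ), Cmd.eval_switch (k := n),
    Cmd.eval_seq]
  rotate_left
  · simp [Op.eval, Cmd.eval_block_cons, Cmd.eval_block_nil, hp, hw]
  · omega
  · simp [Op.eval, Cmd.eval_block_cons, Cmd.eval_block_nil, hσ]
  set s1 : State := (Cmd.op _ : Code).eval _ with hs1
  have h1 : Holds s1 l := by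
    constructor
    · rw [← h.tail, hs1]
      simp [Op.eval, Cmd.eval, Cmd.eval_block_cons, Cmd.eval_block_nil]
    · simpa [hs1, Op.eval, Cmd.eval, Cmd.eval_block_cons, Cmd.eval_block_nil] using h.word
  obtain ⟨h2, h3⟩ := eval_emit ((σ.onSymbol n).2.map Letter.code) h1
  have hF : Frame scanRegs [.word] s s1 := by
    refine ⟨fun r hr => ?_, fun a _ => ?_, ?_, ?_⟩
    · simp only [List.mem_cons, List.not_mem_nil, or_false, not_or] at hr
      simp [hs1, Op.eval, Cmd.eval, Cmd.eval_block_cons, Cmd.eval_block_nil,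
        Function.update_of_ne, hr]
    all_goals simp [hs1, Op.eval, Cmd.eval, Cmd.eval_block_cons, Cmd.eval_block_nil]
  have hx : s1.reg .x = n := by
    simp [hs1, Op.eval, Cmd.eval, Cmd.eval_block_cons, Cmd.eval_block_nil, hp, hw]
  have hx2 := (h3.reg .x (by simp)).trans hx
  set s2 := (emit _).eval s1
  refine ⟨⟨?_, ?_⟩, ?_, ?_, ?_, ?_, ?_⟩
  · rw [← h2.tail]
    simp [Op.eval, Cmd.eval_block_cons, Cmd.eval_block_nil]
  · simpa [Op.eval, Cmd.eval_block_cons, Cmd.eval_block_nil] using h2.word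
  · simp [Op.eval, Cmd.eval_block_cons, Cmd.eval_block_nil, h3.reg .st]
    simp [hs1, Op.eval, Cmd.eval]
  · simp [Op.eval, Cmd.eval_block_cons, Cmd.eval_block_nil, h3.reg .pos]
    simp [hs1, Op.eval, Cmd.eval, Cmd.eval_block_cons, Cmd.eval_block_nil, hp]
  · simp [Op.eval, Cmd.eval_block_cons, Cmd.eval_block_nil, hx2]
  · simp [Op.eval, Cmd.eval_block_cons, Cmd.eval_block_nil, hx2]
  · refine (hF.trans (h3.mono (by simp) (by simp))).trans ⟨fun r hr => ?_, fun a _ => ?_, ?_, ?_⟩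
    · simp only [List.mem_cons, List.not_mem_nil, or_false, not_or] at hr
      simp [Op.eval, Cmd.eval_block_cons, Cmd.eval_block_nil, Function.update_of_ne, hr]
    all_goals simp [Op.eval, Cmd.eval_block_cons, Cmd.eval_block_nil]

/-- Let the automaton read a word, starting at the position `pos`. -/
noncomputable def pass : Code := .seq (.op (.const .y 1)) (.loop .y passBody)

theorem reaches_pass_loop {post : List ℕ} (w : List Letter) : ∀ {pre l : List ℕ} {s : State}
    {σ : Scan}, Holds s l → (pre ++ (w.map Letter.code ++ 5 :: post)) <+: l →
    s.reg .pos = pre.length → s.reg .st = code σ → s.reg .y ≠ 0 →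
    Reaches (.loop .y passBody) s ((passBody.cost + 1) * (w.length + 1) + 1) fun s' =>
      Holds s' (l ++ (σ.scan w).2.map Letter.code) ∧ s'.reg .st = code (σ.scan w).1 ∧
      s'.reg .pos = pre.length + w.length + 1 ∧ Frame scanRegs [.word] s s' := by
  induction w with
  | nil =>
    rintro pre l s σ h ⟨l', hl⟩ hp hσ hy
    have hl' : l[pre.length]? = some 5 := by simp [← hl]
    obtain ⟨h1, h2, h3, h4, -, h5⟩ := eval_passBody h hp hl' le_rfl hσ
    refine (Reaches.loop_pos (T' := 1) hy (loopFree_passBody.reaches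
      (Reaches.loop_zero h4 le_rfl ?_))).mono ?_ fun _ h => h
    · exact ⟨h1, h2, h3, h5⟩
    · simp only [List.length_nil]; omega
  | cons z w ih =>
    rintro pre l s σ h ⟨l', hl⟩ hp hσ hy
    have hl' : l[pre.length]? = some z.code := by simp [← hl]
    have hz : z.code ≤ 4 := by cases z <;> simp [Letter.code]
    obtain ⟨h1, h2, h3, h4, -, h5⟩ := eval_passBody h hp hl' (by omega) hσ
    rw [Scan.onSymbol_code] at h1 h2
    have := ih (pre := pre ++ [z.code]) h1
      ⟨l' ++ (σ.out z).map Letter.code, by simp [← hl]⟩ (by simp [h3]) h2 (by omega)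
    refine (Reaches.loop_pos hy (loopFree_passBody.reaches this)).mono ?_ ?_
    · rw [List.length_cons, Nat.mul_succ _ (w.length + 1)]; omega
    · rintro s' ⟨g1, g2, g3, g4⟩
      refine ⟨by simpa [Scan.scan] using g1, g2, ?_, h5.trans g4⟩
      rw [g3]; simp only [List.length_append, List.length_cons, List.length_nil]; omega

theorem reaches_pass {post pre l : List ℕ} {w : List Letter} {s : State} {σ : Scan}
    (h : Holds s l) (hl : (pre ++ (w.map Letter.code ++ 5 :: post)) <+: l)
    (hp : s.reg .pos = pre.length) (hσ : s.reg .st = code σ) :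
    Reaches pass s (1 + ((passBody.cost + 1) * (w.length + 1) + 1)) fun s' =>
      Holds s' (l ++ (σ.scan w).2.map Letter.code) ∧ s'.reg .st = code (σ.scan w).1 ∧
      s'.reg .pos = pre.length + w.length + 1 ∧ Frame scanRegs [.word] s s' := by
  set s1 : State := (Op.const .y 1).eval s with hs1
  have h1 : Holds s1 l := ⟨by rw [← h.tail]; simp [hs1, Op.eval], by
    simpa [hs1, Op.eval] using h.word⟩
  refine Reaches.seq (P := fun s' => s' = s1)
    (Cmd.LoopFree.reaches (c := (.op (.const .y 1) : Code)) trivial rfl) ?_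
  rintro s' rfl
  refine (reaches_pass_loop w h1 hl (by simpa [hs1, Op.eval] using hp)
    (by simpa [hs1, Op.eval] using hσ) (by simp [hs1, Op.eval])).mono le_rfl ?_
  have hF : Frame scanRegs [.word] s s1 := by
    refine ⟨fun r hr => ?_, fun _ _ => rfl, rfl, rfl⟩
    simp only [List.mem_cons, List.not_mem_nil, or_false, not_or] at hr
    simp [hs1, Op.eval, Function.update_of_ne, hr]
  rintro s' ⟨g1, g2, g3, g4⟩
  exact ⟨g1, g2, g3, hF.trans g4⟩

/-- Prepare the first scan of the word at `head`. -/
noncomputable def nodeStart : Code :=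
  .block [.move .pos .head, .const .st (code (Scan.start false))]

/-- Between the two scans, an end marker is written if the two sections are kept apart. -/
noncomputable def nodeMid : Code :=
  .seq (.block [.move .st' .st])
    (.seq
      (.cases .tmp .st fun σ : Scan =>
        match σ.first with
        | none => .nop
        | some _ => if σ.side then .nop else emit [5])
      (.block [.move .pos .head, .const .st (code (Scan.start true))]))

/-- Record the information on the word. -/
noncomputable def nodeEnd : Code :=
  .seq
    (.cases .tmp .st' fun σ : Scan => .cases .tmp .st fun τ : Scan =>
      .seq (.block [.const .v (code (σ.info τ)), .store .info .i .v, .store .child .i .cnt])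
        (match σ.info τ with
          | .leaf _ => .nop
          | .even _ => .seq (emit [5]) (.block [.inc .cnt, .inc .cnt])
          | .odd _ _ _ => .seq (emit [5]) (.block [.inc .cnt])))
    (.block [.move .head .pos, .inc .i, .sub .y .cnt .i])

theorem loopFree_nodeMid : nodeMid.LoopFree := by
  refine ⟨Cmd.loopFree_block _, Cmd.loopFree_cases fun σ => ?_, Cmd.loopFree_block _⟩
  cases σ.first with
  | none => trivial
  | some r =>
    dsimp only
    split
    · trivial
    · exact loopFree_emit _

theorem loopFree_nodeEnd : nodeEnd.LoopFree := by
  refine ⟨Cmd.loopFree_cases fun σ => Cmd.loopFree_cases fun τ => ⟨Cmd.loopFree_block _, ?_⟩,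
    Cmd.loopFree_block _⟩
  cases σ.info τ with
  | leaf r => trivial
  | even r => exact ⟨loopFree_emit _, Cmd.loopFree_block _⟩
  | odd r q₀ q₁ => exact ⟨loopFree_emit _, Cmd.loopFree_block _⟩

/-- Deal with one word of the queue. -/
noncomputable def nodeBody : Code :=
  .seq nodeStart (.seq pass (.seq nodeMid (.seq pass nodeEnd)))

/-- The time for a word is at most `nodeCost * (length + 1)`. -/
noncomputable def nodeCost : ℕ :=
  nodeStart.cost + nodeMid.cost + nodeEnd.cost + 4 + 2 * (passBody.cost + 1)

/-- The registers which are changed when a word is dealt with. -/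
abbrev nodeRegs : List Reg := scanRegs ++ [.st', .head, .cnt, .i]

/-- Whether a marker is written between the sections. -/
def Scan.sep (σ : Scan) : List ℕ :=
  match σ.first with
  | none => []
  | some _ => if σ.side then [] else [5]

theorem eval_nodeMid {l : List ℕ} {s : State} (h : Holds s l) {σ : Scan}
    (hσ : s.reg .st = code σ) :
    Holds (nodeMid.eval s) (l ++ σ.sep) ∧ (nodeMid.eval s).reg .st' = code σ ∧
      (nodeMid.eval s).reg .st = code (Scan.start true) ∧
      (nodeMid.eval s).reg .pos = s.reg .head ∧
      Frame (scanRegs ++ [.st']) [.word] s (nodeMid.eval s) := by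
  set s1 : State := ⟨Function.update (Function.update s.reg .st' (code σ)) .tmp 0, s.arr, s.inp,
    s.acc, s.row, s.dict⟩ with hs1
  have h1 : Holds s1 l := ⟨by rw [← h.tail]; simp [hs1], h.word⟩
  have e1 : nodeMid.eval s = (Cmd.block [.move .pos .head, .const .st (code (Scan.start true))] :
      Code).eval ((emit σ.sep).eval s1) := by
    rw [nodeMid, Cmd.eval_seq, Cmd.eval_seq, Cmd.eval_cases (x := σ)]
    · congr 1
      unfold Scan.sep
      cases σ.first with
      | none => simp [Op.eval, Cmd.eval, Cmd.eval_block_cons, Cmd.eval_block_nil, emit,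
          Cmd.eval_each_nil, hs1, hσ]
      | some r =>
        cases σ.side <;> simp [Op.eval, Cmd.eval, Cmd.eval_block_cons, Cmd.eval_block_nil, emit,
          Cmd.eval_each_nil, hs1, hσ]
    · simp [Op.eval, Cmd.eval_block_cons, Cmd.eval_block_nil, hσ]
  obtain ⟨h2, h3⟩ := eval_emit σ.sep h1
  rw [e1]
  set s2 := (emit σ.sep).eval s1
  have hF : Frame (scanRegs ++ [.st']) [.word] s s1 := by
    refine ⟨fun r hr => ?_, fun a _ => rfl, rfl, rfl⟩
    simp only [List.cons_append, List.nil_append, List.mem_cons, List.not_mem_nil, or_false,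
      not_or] at hr
    simp [hs1, Function.update_of_ne, hr]
  refine ⟨⟨?_, ?_⟩, ?_, ?_, ?_, ?_⟩
  · rw [← h2.tail]
    simp [Op.eval, Cmd.eval_block_cons, Cmd.eval_block_nil]
  · simpa [Op.eval, Cmd.eval_block_cons, Cmd.eval_block_nil] using h2.word
  · simp [Op.eval, Cmd.eval_block_cons, Cmd.eval_block_nil, h3.reg .st', hs1]
  · simp [Op.eval, Cmd.eval_block_cons, Cmd.eval_block_nil]
  · simp [Op.eval, Cmd.eval_block_cons, Cmd.eval_block_nil, h3.reg .head, hs1]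
  · refine (hF.trans (h3.mono (by simp) (by simp))).trans ⟨fun r hr => ?_, fun a _ => ?_, ?_, ?_⟩
    · simp only [List.cons_append, List.nil_append, List.mem_cons, List.not_mem_nil, or_false,
        not_or] at hr
      simp [Op.eval, Cmd.eval_block_cons, Cmd.eval_block_nil, Function.update_of_ne, hr]
    all_goals simp [Op.eval, Cmd.eval_block_cons, Cmd.eval_block_nil]

/-- The marker after the sections. -/
def Info.sep : Info → List ℕ
  | .leaf _ => []
  | _ => [5]

/-- The number of words to which a word is reduced. -/
def Info.arity : Info → ℕ
  | .leaf _ => 0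
  | .even _ => 2
  | .odd _ _ _ => 1

theorem eval_nodeEnd {l : List ℕ} {s : State} (h : Holds s l) {σ τ : Scan}
    (hσ : s.reg .st' = code σ) (hτ : s.reg .st = code τ) :
    Holds (nodeEnd.eval s) (l ++ (σ.info τ).sep) ∧
      (nodeEnd.eval s).reg .cnt = s.reg .cnt + (σ.info τ).arity ∧
      (nodeEnd.eval s).reg .head = s.reg .pos ∧ (nodeEnd.eval s).reg .i = s.reg .i + 1 ∧
      (nodeEnd.eval s).reg .y = s.reg .cnt + (σ.info τ).arity - (s.reg .i + 1) ∧
      (nodeEnd.eval s).arr .info =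
        Function.update (s.arr .info) (s.reg .i) (code (σ.info τ)) ∧
      (nodeEnd.eval s).arr .child = Function.update (s.arr .child) (s.reg .i) (s.reg .cnt) ∧
      Frame nodeRegs [.word, .info, .child] s (nodeEnd.eval s) := by
  set s1 : State := (Cmd.block [.const .v (code (σ.info τ)), .store .info .i .v,
    .store .child .i .cnt] : Code).eval ⟨Function.update s.reg .tmp 0, s.arr, s.inp,
    s.acc, s.row, s.dict⟩ with hs1
  have h1 : Holds s1 l := by
    constructor
    · rw [← h.tail]; simp [hs1, Op.eval, Cmd.eval_block_cons, Cmd.eval_block_nil]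
    · simpa [hs1, Op.eval, Cmd.eval_block_cons, Cmd.eval_block_nil] using h.word
  obtain ⟨h2, h3⟩ := eval_emit (σ.info τ).sep h1
  set s2 := (emit (σ.info τ).sep).eval s1 with hs2
  set s3 : State := ⟨Function.update s2.reg .cnt (s2.reg .cnt + (σ.info τ).arity), s2.arr, s2.inp,
    s2.acc, s2.row, s2.dict⟩ with hs3
  have e1 : nodeEnd.eval s = (Cmd.block [.move .head .pos, .inc .i, .sub .y .cnt .i] :
      Code).eval s3 := by
    rw [nodeEnd, Cmd.eval_seq, Cmd.eval_cases hσ, Cmd.eval_cases (x := τ)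
      (by simpa using hτ), Cmd.eval_seq]
    simp only [Function.update_idem]
    rw [← hs1]
    congr 1
    cases hi : σ.info τ with
    | leaf r =>
      have : s2 = s1 := by rw [hs2, hi]; rfl
      simp [hs3, this, hi, Info.arity, Cmd.eval]
    | even r =>
      have : s2 = (emit [5]).eval s1 := by rw [hs2, hi]; rfl
      simp [hs3, this, hi, Info.arity, Cmd.eval, Op.eval, Cmd.eval_block_cons, Cmd.eval_block_nil]
    | odd r q₀ q₁ =>
      have : s2 = (emit [5]).eval s1 := by rw [hs2, hi]; rfl
      simp [hs3, this, hi, Info.arity, Cmd.eval, Op.eval, Cmd.eval_block_cons, Cmd.eval_block_nil]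
  rw [e1]
  have hF : Frame nodeRegs [.word, .info, .child] s s1 := by
    refine ⟨fun r hr => ?_, fun a ha => ?_, ?_, ?_⟩
    · simp only [List.cons_append, List.nil_append, List.mem_cons, List.not_mem_nil, or_false,
        not_or] at hr
      simp [hs1, Op.eval, Cmd.eval_block_cons, Cmd.eval_block_nil, Function.update_of_ne, hr]
    · simp only [List.mem_cons, List.not_mem_nil, or_false, not_or] at ha
      simp [hs1, Op.eval, Cmd.eval_block_cons, Cmd.eval_block_nil, Function.update_of_ne, ha]
    all_goals simp [hs1, Op.eval, Cmd.eval_block_cons, Cmd.eval_block_nil]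
  have hcnt : s2.reg .cnt = s.reg .cnt := by
    rw [h3.reg .cnt (by simp)]
    simp [hs1, Op.eval, Cmd.eval_block_cons, Cmd.eval_block_nil]
  have hi : s2.reg .i = s.reg .i := by
    rw [h3.reg .i (by simp)]
    simp [hs1, Op.eval, Cmd.eval_block_cons, Cmd.eval_block_nil]
  have hpos : s2.reg .pos = s.reg .pos := by
    rw [h3.reg .pos (by simp)]
    simp [hs1, Op.eval, Cmd.eval_block_cons, Cmd.eval_block_nil]
  refine ⟨⟨?_, ?_⟩, ?_, ?_, ?_, ?_, ?_, ?_, ?_⟩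
  · rw [← h2.tail]
    simp [Op.eval, Cmd.eval_block_cons, Cmd.eval_block_nil, hs3]
  · simpa [Op.eval, Cmd.eval_block_cons, Cmd.eval_block_nil, hs3] using h2.word
  · simp [Op.eval, Cmd.eval_block_cons, Cmd.eval_block_nil, hs3, hcnt]
  · simp [Op.eval, Cmd.eval_block_cons, Cmd.eval_block_nil, hs3, hpos]
  · simp [Op.eval, Cmd.eval_block_cons, Cmd.eval_block_nil, hs3, hi]
  · simp [Op.eval, Cmd.eval_block_cons, Cmd.eval_block_nil, hs3, hcnt, hi]
  · simp [Op.eval, Cmd.eval_block_cons, Cmd.eval_block_nil, hs3, h3.arr .info]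
    simp [hs1, Op.eval, Cmd.eval_block_cons, Cmd.eval_block_nil]
  · simp [Op.eval, Cmd.eval_block_cons, Cmd.eval_block_nil, hs3, h3.arr .child]
    simp [hs1, Op.eval, Cmd.eval_block_cons, Cmd.eval_block_nil]
  · refine (hF.trans (h3.mono (by simp) (by simp))).trans ⟨fun r hr => ?_, fun a _ => ?_, ?_, ?_⟩
    · simp only [List.cons_append, List.nil_append, List.mem_cons, List.not_mem_nil, or_false,
        not_or] at hr
      simp [Op.eval, Cmd.eval_block_cons, Cmd.eval_block_nil, Function.update_of_ne, hr, hs3]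
    all_goals simp [Op.eval, Cmd.eval_block_cons, Cmd.eval_block_nil, hs3]

theorem encode_split (w : List Letter) : encode (split w) =
    ((Scan.start false).scan w).2.map Letter.code ++ (((Scan.start false).scan w).1.sep ++
      (((Scan.start true).scan w).2.map Letter.code ++ (infoOf w).sep)) := by
  have hsep : ∀ σ τ : Scan, σ.sep =
      match σ.info τ with
      | .even _ => [5]
      | _ => [] := by
    rintro ⟨e, s, f, q⟩ τ
    cases f <;> cases e <;> rfl
  rw [hsep _ ((Scan.start true).scan w).1, ← infoOf]
  unfold split
  cases hi : infoOf w with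
  | leaf r =>
    obtain ⟨-, h1, h2⟩ := infoOf_leaf hi
    simp [encode, Info.sep, h1, h2]
  | even r => simp [encode, Info.sep]
  | odd r q₀ q₁ => simp [encode, Info.sep]

theorem length_split (w : List Letter) : (split w).length = (infoOf w).arity := by
  unfold split
  cases infoOf w <;> rfl

theorem encode_eq {W : List (List Letter)} {i : ℕ} {w : List Letter} (hw : W[i]? = some w) :
    encode W = encode (W.take i) ++ (w.map Letter.code ++ 5 :: encode (W.drop (i + 1))) := by
  obtain ⟨hi, hw⟩ := List.getElem?_eq_some_iff.1 hw
  rw [← encode_cons, ← hw, ← List.drop_eq_getElem_cons hi, ← encode_append, List.take_append_drop]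

theorem reaches_nodeBody {W : List (List Letter)} {i : ℕ} {w : List Letter} {s : State}
    (h : Holds s (encode W)) (hw : W[i]? = some w) (hi : s.reg .i = i)
    (hhead : s.reg .head = (encode (W.take i)).length) (hcnt : s.reg .cnt = W.length) :
    Reaches nodeBody s (nodeCost * (w.length + 1)) fun s' =>
      Holds s' (encode (W ++ split w)) ∧ s'.reg .cnt = (W ++ split w).length ∧
      s'.reg .head = (encode ((W ++ split w).take (i + 1))).length ∧ s'.reg .i = i + 1 ∧
      s'.reg .y = (W ++ split w).length - (i + 1) ∧
      s'.arr .info = Function.update (s.arr .info) i (code (infoOf w)) ∧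
      s'.arr .child = Function.update (s.arr .child) i W.length ∧
      Frame nodeRegs [.word, .info, .child] s s' := by
  have hpre : scanRegs ⊆ nodeRegs := List.subset_append_left _ _
  obtain ⟨hiW, hwi⟩ := List.getElem?_eq_some_iff.1 hw
  set s1 : State := nodeStart.eval s with hs1
  have h1 : Holds s1 (encode W) := by
    constructor
    · rw [← h.tail]; simp [hs1, nodeStart, Op.eval, Cmd.eval_block_cons, Cmd.eval_block_nil]
    · simpa [hs1, nodeStart, Op.eval, Cmd.eval_block_cons, Cmd.eval_block_nil] using h.word
  have hF1 : Frame scanRegs [.word] s s1 := by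
    refine ⟨fun r hr => ?_, fun a ha => ?_, ?_, ?_⟩
    · simp only [List.mem_cons, List.not_mem_nil, or_false, not_or] at hr
      simp [hs1, nodeStart, Op.eval, Cmd.eval_block_cons, Cmd.eval_block_nil,
        Function.update_of_ne, hr]
    all_goals simp [hs1, nodeStart, Op.eval, Cmd.eval_block_cons, Cmd.eval_block_nil]
  have hpos1 : s1.reg .pos = (encode (W.take i)).length := by
    simp [hs1, nodeStart, Op.eval, Cmd.eval_block_cons, Cmd.eval_block_nil, hhead]
  have hst1 : s1.reg .st = code (Scan.start false) := by
    simp [hs1, nodeStart, Op.eval, Cmd.eval_block_cons, Cmd.eval_block_nil]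
  have hl1 : (encode (W.take i) ++ (w.map Letter.code ++ 5 :: encode (W.drop (i + 1)))) <+:
      encode W := by rw [encode_eq hw]
  refine (Reaches.seq (P := fun s' => s' = s1) ((Cmd.loopFree_block _).reaches rfl)
    (T' := 1 + ((passBody.cost + 1) * (w.length + 1) + 1) + (nodeMid.cost +
      (1 + ((passBody.cost + 1) * (w.length + 1) + 1) + nodeEnd.cost))) ?_).mono ?_ fun _ h => h
  rotate_left
  · have e1 : nodeCost * (w.length + 1) =
        (nodeStart.cost + nodeMid.cost + nodeEnd.cost + 4) * (w.length + 1) +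
          ((passBody.cost + 1) * (w.length + 1) + (passBody.cost + 1) * (w.length + 1)) := by
      unfold nodeCost; ring
    have e2 := Nat.le_mul_of_pos_right (nodeStart.cost + nodeMid.cost + nodeEnd.cost + 4)
      (show 0 < w.length + 1 by omega)
    rw [e1]
    unfold nodeStart at *
    omega
  rintro s' rfl
  refine (reaches_pass h1 hl1 hpos1 hst1).seq ?_
  rintro s2 ⟨g1, g2, g3, g4⟩
  obtain ⟨k1, k2, k3, k4, k5⟩ := eval_nodeMid g1 g2
  refine (loopFree_nodeMid.reaches (Q := fun s' => s' = nodeMid.eval s2) rfl).seq ?_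
  rintro s3 rfl
  have hl3 := hl1.trans ((List.prefix_append _ (((Scan.start false).scan w).2.map
    Letter.code)).trans (List.prefix_append _ (((Scan.start false).scan w).1.sep)))
  have h12 : Frame scanRegs [.word] s s2 := hF1.trans g4
  have h13 : Frame (scanRegs ++ [.st']) [.word] s (nodeMid.eval s2) :=
    (h12.mono (List.subset_append_left _ _) (List.Subset.refl _)).trans k5
  have hpos3 : (nodeMid.eval s2).reg .pos = (encode (W.take i)).length := by
    rw [k4, h12.reg .head (by simp), hhead]
  refine (reaches_pass k1 hl3 hpos3 k3).seq ?_
  rintro s4 ⟨m1, m2, m3, m4⟩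
  have h14 : Frame (scanRegs ++ [.st']) [.word] s s4 :=
    h13.trans (m4.mono (List.subset_append_left _ _) (List.Subset.refl _))
  have hst4 : s4.reg .st' = code ((Scan.start false).scan w).1 := by
    rw [m4.reg .st' (by simp), k2]
  obtain ⟨n1, n2, n3, n4, n5, n6, n7, n8⟩ := eval_nodeEnd m1 hst4 m2
  rw [← infoOf] at n1 n2 n5 n6
  refine loopFree_nodeEnd.reaches ?_
  have hi4 : s4.reg .i = i := by rw [h14.reg .i (by simp), hi]
  have hcnt4 : s4.reg .cnt = W.length := by rw [h14.reg .cnt (by simp), hcnt]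
  refine ⟨?_, ?_, ?_, ?_, ?_, ?_, ?_, ?_⟩
  · rw [encode_append, encode_split]
    simpa only [List.append_assoc] using n1
  · rw [n2, hcnt4, List.length_append, length_split]
  · rw [n3, m3, List.take_append_of_le_length (by omega), List.take_succ_eq_append_getElem hiW,
      encode_append, hwi]
    simp [encode, add_assoc]
  · rw [n4, hi4]
  · rw [n5, hcnt4, hi4, List.length_append, length_split]
  · rw [n6, hi4, h14.arr .info (by simp)]
  · rw [n7, hi4, hcnt4, h14.arr .child (by simp)]
  · exact (h14.mono (by simp) (by simp)).trans n8

/-- What has been recorded about the word number `j`. -/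
def NodeOk (s : State) (W : List (List Letter)) (j : ℕ) : Prop :=
  ∀ w, W[j]? = some w → s.arr .info j = code (infoOf w) ∧ j < s.arr .child j ∧
    ∀ m u, (split w)[m]? = some u → W[s.arr .child j + m]? = some u

/-- A potential, which is large enough to pay for the present and all later words. -/
def potential (W : List (List Letter)) : ℕ := (W.map fun w => 6 * weight w + 1).sum

theorem potential_cons (w : List Letter) (W : List (List Letter)) :
    potential (w :: W) = 6 * weight w + 1 + potential W := by simp [potential]

theorem potential_append (W W' : List (List Letter)) :
    potential (W ++ W') = potential W + potential W' := by simp [potential]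

theorem potential_eq (W : List (List Letter)) :
    potential W = 6 * (W.map weight).sum + W.length := by
  induction W with
  | nil => rfl
  | cons w W ih =>
    rw [potential_cons, ih, List.map_cons, List.sum_cons, List.length_cons]
    ring

/-- Dealing with a word sets free enough potential to pay for it. -/
theorem potential_split (w : List Letter) :
    potential (split w) + (w.length + 1) ≤ 6 * weight w + 1 := by
  have h1 := weight_split w
  have h2 := length_split_le w
  have h3 := length_le_weight w
  rw [potential_eq]
  cases w with
  | nil => simp [split_nil]
  | cons z w =>
    simp only [List.length_cons] at *
    omega

/-- While the queue is dealt with: the queue is `W`, and `n` words have been dealt with. The number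
of words is bounded by means of the potential. -/
structure Queue (ws : List (List Letter)) (N : ℕ) (g : List (List Letter) × ℕ) (s : State) :
    Prop where
  clean : Clean s
  holds : Holds s (encode g.1)
  cnt : s.reg .cnt = g.1.length
  head : s.reg .head = (encode (g.1.take g.2)).length
  i : s.reg .i = g.2
  y : s.reg .y = g.1.length - g.2
  roots : ws <+: g.1
  le : g.2 ≤ g.1.length
  node : ∀ j < g.2, NodeOk s g.1 j
  bound : g.2 + potential (g.1.drop g.2) ≤ N

/-- Deal with all words of the queue. -/
noncomputable def reduceAll : Code :=
  .seq (.block [.const .head 0, .const .i 0, .sub .y .cnt .i]) (.loop .y nodeBody)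

theorem getElem?_append_of_eq_some {α : Type} {l l' : List α} {i : ℕ} {x : α}
    (h : l[i]? = some x) : (l ++ l')[i]? = some x := by
  rw [List.getElem?_append_left (List.getElem?_eq_some_iff.1 h).1, h]

theorem reaches_reduceAll {ws : List (List Letter)} {s : State} (hc : Clean s)
    (h : Holds s (encode ws)) (hcnt : s.reg .cnt = ws.length) (rs : List Reg)
    (hrs : ∀ r ∈ rs, r ∉ nodeRegs) :
    Reaches reduceAll s (3 + ((nodeCost + 1) * potential ws + 1)) fun s' =>
      (∃ W, ws <+: W ∧ Clean s' ∧ s'.reg .cnt = W.length ∧ W.length ≤ potential ws ∧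
        ∀ j < W.length, NodeOk s' W j) ∧ ∀ r ∈ rs, s'.reg r = s.reg r := by
  refine Reaches.seq (P := fun s' => Queue ws (potential ws) (ws, 0) s' ∧
    ∀ r ∈ rs, s'.reg r = s.reg r) (T := 3) ((Cmd.loopFree_block _).reaches ?_) ?_
  · refine ⟨⟨⟨?_, ?_, ?_, ?_⟩, ⟨?_, ?_⟩, ?_, ?_, ?_, ?_, List.prefix_rfl, Nat.zero_le _, ?_, ?_⟩,
      fun r hr => ?_⟩
    · simp [Op.eval, Cmd.eval_block_cons, Cmd.eval_block_nil, hc.used]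
    · simp [Op.eval, Cmd.eval_block_cons, Cmd.eval_block_nil, hc.odd]
    · simp [Op.eval, Cmd.eval_block_cons, Cmd.eval_block_nil, hc.row]
    · simp [Op.eval, Cmd.eval_block_cons, Cmd.eval_block_nil, hc.dict]
    · rw [← h.tail]; simp [Op.eval, Cmd.eval_block_cons, Cmd.eval_block_nil]
    · simpa [Op.eval, Cmd.eval_block_cons, Cmd.eval_block_nil] using h.word
    · simp [Op.eval, Cmd.eval_block_cons, Cmd.eval_block_nil, hcnt]
    · simp [Op.eval, Cmd.eval_block_cons, Cmd.eval_block_nil, encode]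
    · simp [Op.eval, Cmd.eval_block_cons, Cmd.eval_block_nil]
    · simp [Op.eval, Cmd.eval_block_cons, Cmd.eval_block_nil, hcnt]
    · simp
    · simp
    · have := hrs r hr
      simp only [List.cons_append, List.nil_append, List.mem_cons, List.not_mem_nil, or_false,
        not_or] at this
      simp [Op.eval, Cmd.eval_block_cons, Cmd.eval_block_nil, Function.update_of_ne, this]
  rintro s0 ⟨h0, hreg0⟩
  refine (Reaches.loop (fun g s' => Queue ws (potential ws) g s' ∧ ∀ r ∈ rs, s'.reg r = s.reg r)
    (fun g => (nodeCost + 1) * potential (g.1.drop g.2)) ?_ (g := (ws, 0)) ⟨h0, hreg0⟩).mono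
    (by simp) ?_
  · rintro ⟨W, i⟩ s1 ⟨q, hreg⟩ hy
    have hiW : i < W.length := by
      have := q.y
      simp only at this
      omega
    have hwi : W[i]? = some W[i] := List.getElem?_eq_getElem hiW
    set w := W[i] with hw
    have hpot : potential (W.drop i) = 6 * weight w + 1 + potential (W.drop (i + 1)) := by
      rw [List.drop_eq_getElem_cons hiW, potential_cons]
    have hpot' : potential ((W ++ split w).drop (i + 1)) =
        potential (W.drop (i + 1)) + potential (split w) := by
      rw [List.drop_append_of_le_length (by omega), potential_append]
    have hsp := potential_split w
    refine ⟨_, (reaches_nodeBody q.holds hwi q.i q.head q.cnt).mono le_rfl ?_⟩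
    rintro s2 ⟨r1, r2, r3, r4, r5, r6, r7, r8⟩
    refine ⟨(W ++ split w, i + 1), ?_, ⟨⟨?_, ?_, ?_, ?_⟩, r1, r2, r3, r4, r5,
      q.roots.trans (List.prefix_append _ _), ?_, ?_, ?_⟩, fun r hr => ?_⟩
    · have e : (nodeCost + 1) * potential (W.drop i) = (nodeCost + 1) *
          potential ((W ++ split w).drop (i + 1)) + (nodeCost + 1) *
            (6 * weight w + 1 - potential (split w)) := by
        rw [← Nat.mul_add]; congr 1; omega
      have e2 : (nodeCost + 1) * (w.length + 1) ≤ (nodeCost + 1) *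
            (6 * weight w + 1 - potential (split w)) := Nat.mul_le_mul_left _ (by omega)
      have e3 : (nodeCost + 1) * (w.length + 1) = nodeCost * (w.length + 1) + (w.length + 1) := by
        ring
      simp only
      omega
    · rw [r8.arr .used (by simp), q.clean.used]
    · intro q'; rw [r8.arr (.odd q') (by simp), q.clean.odd]
    · rw [r8.row, q.clean.row]
    · rw [r8.dict, q.clean.dict]
    · simp only [List.length_append]; omega
    · intro j hj v hv
      simp only at hj hv ⊢
      rcases Nat.lt_succ_iff_lt_or_eq.1 hj with hj | rfl
      · have hjW : j < W.length := by omega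
        rw [List.getElem?_append_left hjW] at hv
        obtain ⟨a1, a2, a3⟩ := q.node j hj v hv
        rw [r6, r7, Function.update_of_ne (by omega), Function.update_of_ne (by omega)]
        exact ⟨a1, a2, fun m u hu => getElem?_append_of_eq_some (a3 m u hu)⟩
      · rw [List.getElem?_append_left hiW, hwi] at hv
        obtain rfl := Option.some.inj hv
        rw [r6, r7, Function.update_self, Function.update_self]
        refine ⟨rfl, hiW, fun m u hu => ?_⟩
        change (W ++ split W[j])[W.length + m]? = some u
        rw [List.getElem?_append_right (Nat.le_add_right _ _)]
        simpa using hu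
    · have := q.bound
      simp only at this ⊢
      omega
    · rw [r8.reg r (hrs r hr), hreg r hr]
  · rintro s1 ⟨⟨⟨W, i⟩, q, hreg⟩, hy⟩
    have h1 := q.y
    have h2 := q.le
    have h3 := q.bound
    simp only at h1 h2 h3
    have : i = W.length := by omega
    subst this
    exact ⟨⟨W, q.roots, q.clean, q.cnt, by omega, q.node⟩, hreg⟩

end Grigorchuk

namespace Grigorchuk

open RAM

/-! ### The dictionary of classes -/

/-- The keys which may occur in a dictionary with rows of length `M`. -/
def Key.Valid (M : ℕ) : Key → Prop
  | .even _ v => v < M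
  | .odd _ _ => True

/-- The number stored under a key. -/
def look (M : ℕ) (s : State) : Key → ℕ
  | .even u v => s.dict (u * M + v)
  | .odd u q => s.arr (.odd q) u

/-- The dictionary `f` describes the numbering `ids`: what is stored under a key is the number of
the elements which have this key, and all elements of the classes with a number can be found. -/
structure Consistent (ids : KClass → ℕ) (M : ℕ) (f : Key → ℕ) : Prop where
  inj : InjIds ids
  lt : ∀ c, ids c < M
  sound : ∀ κ : Key, κ.Valid M → f κ ≠ 0 →
    ∃ h, Assigned ids h ∧ keyOf ids h = κ ∧ ids (cls h) = f κ
  complete : ∀ h, ids (cls h) ≠ 0 → Assigned ids h ∧ f (keyOf ids h) = ids (cls h)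

/-- `ids'` gives the same numbers as `ids` to the classes which have got a number in `ids`. -/
def Extends (ids ids' : KClass → ℕ) : Prop := ∀ c, ids c ≠ 0 → ids' c = ids c

theorem valid_keyOf {ids : KClass → ℕ} {M : ℕ} (h : ∀ c, ids c < M) (g : Gamma) :
    (keyOf ids g).Valid M := by
  unfold keyOf
  split
  · trivial
  · exact h _

theorem Extends.assigned {ids ids' : KClass → ℕ} (h : Extends ids ids') {g : Gamma}
    (hg : Assigned ids g) : Assigned ids' g := by
  unfold Assigned at hg ⊢
  split at hg <;> rename_i hp
  · rw [if_pos hp, h _ hg]; exact hg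
  · rw [if_neg hp, h _ hg.1, h _ hg.2]; exact hg

theorem Extends.keyOf_eq {ids ids' : KClass → ℕ} (h : Extends ids ids') {g : Gamma}
    (hg : Assigned ids g) : keyOf ids' g = keyOf ids g := by
  unfold Assigned at hg
  unfold keyOf
  split at hg <;> rename_i hp
  · rw [if_pos hp, if_pos hp, h _ hg]
  · rw [if_neg hp, if_neg hp, h _ hg.1, h _ hg.2]

open Classical in
theorem extends_update {ids : KClass → ℕ} {c : KClass} (hc : ids c = 0) (n : ℕ) :
    Extends ids (Function.update ids c n) := by
  intro c' h
  rw [Function.update_of_ne]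
  rintro rfl
  exact h hc

open Classical in
/-- A new class gets the number `n`, which is stored under the keys of its elements. -/
theorem Consistent.extend {ids : KClass → ℕ} {M : ℕ} {f f' : Key → ℕ} (hf : Consistent ids M f)
    {c : KClass} (hc : ids c = 0) {n : ℕ} (hnM : n < M) (hnew : ∀ c', ids c' ≠ n)
    {S : List Key} (h1 : ∀ h, cls h = c → Assigned ids h ∧ keyOf ids h ∈ S)
    (h2 : ∀ κ ∈ S, ∃ h, cls h = c ∧ keyOf ids h = κ)
    (hf' : ∀ κ : Key, κ.Valid M → f' κ = if κ ∈ S then n else f κ) :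
    Consistent (Function.update ids c n) M f' := by
  have hext := extends_update hc n
  refine ⟨fun c₁ c₂ hc₁ he => ?_, fun c' => ?_, fun κ hv hκ => ?_, fun h hh => ?_⟩
  · by_cases e1 : c₁ = c <;> by_cases e2 : c₂ = c
    · rw [e1, e2]
    · subst e1
      rw [Function.update_self, Function.update_of_ne e2] at he
      exact absurd he.symm (hnew _)
    · subst e2
      rw [Function.update_self, Function.update_of_ne e1] at he
      exact absurd he (hnew _)
    · rw [Function.update_of_ne e1] at hc₁ he
      rw [Function.update_of_ne e2] at he
      exact hf.inj _ _ hc₁ he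
  · by_cases e : c' = c
    · rw [e, Function.update_self]; exact hnM
    · rw [Function.update_of_ne e]; exact hf.lt _
  · rw [hf' κ hv] at hκ ⊢
    split at hκ <;> rename_i hS
    · rw [if_pos hS]
      obtain ⟨h, hh, rfl⟩ := h2 κ hS
      have ha := (h1 h hh).1
      exact ⟨h, hext.assigned ha, hext.keyOf_eq ha, by rw [hh, Function.update_self]⟩
    · rw [if_neg hS]
      obtain ⟨h, ha, rfl, hh⟩ := hf.sound κ hv hκ
      refine ⟨h, hext.assigned ha, hext.keyOf_eq ha, ?_⟩
      rw [hext _ (by rw [hh]; exact hκ), hh]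
  · by_cases e : cls h = c
    · obtain ⟨ha, hS⟩ := h1 h e
      refine ⟨hext.assigned ha, ?_⟩
      rw [hext.keyOf_eq ha, hf' _ (valid_keyOf hf.lt h), if_pos hS, e, Function.update_self]
    · rw [Function.update_of_ne e] at hh ⊢
      obtain ⟨ha, hk⟩ := hf.complete h hh
      refine ⟨hext.assigned ha, ?_⟩
      rw [hext.keyOf_eq ha, hf' _ (valid_keyOf hf.lt h), if_neg, hk]
      intro hS
      obtain ⟨h', hh', hk'⟩ := h2 _ hS
      exact e ((cls_eq_of_keyOf_eq hf.inj ha hk'.symm).trans hh')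

/-- A way to form a key from the numbers stored for the words to which a word is reduced. -/
inductive Slot : Type
  | two (e : Bool) (s t : G)
  | one (s q : G)

/-- The registers with the indices of the two shorter words. -/
def childReg (e : Bool) : Reg := if e then .c₁ else .c₀

/-- The key which is formed. -/
def Slot.key (s : State) : Slot → Key
  | two e p q => .even (s.arr (.vec p) (s.reg (childReg e))) (s.arr (.vec q) (s.reg (childReg !e)))
  | one p q => .odd (s.arr (.vec p) (s.reg .c₀)) q

/-- Load the number stored under the key into the register `y`. -/
def Slot.read : Slot → Code
  | two e p q => .block [.load .u (.vec p) (childReg e), .load .v (.vec q) (childReg !e),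
      .rowLoad .u, .accAdd .v, .dictLoad .y]
  | one p q => .block [.load .u (.vec p) .c₀, .load .y (.odd q) .u]

/-- Store the number in the register `next` under the key. -/
def Slot.write : Slot → Code
  | two e p q => .block [.load .u (.vec p) (childReg e), .load .v (.vec q) (childReg !e),
      .rowLoad .u, .accAdd .v, .dictStore .next]
  | one p q => .block [.load .u (.vec p) .c₀, .store (.odd q) .u .next]

/-- `s'` differs from `s` at most in the given registers and in the dictionary. -/
structure Quiet (rs : List Reg) (s s' : State) : Prop where
  reg : ∀ r, r ∉ rs → s'.reg r = s.reg r
  arr : ∀ a, (∀ q, a ≠ .odd q) → s'.arr a = s.arr a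
  row : s'.row = s.row

theorem Quiet.trans {rs : List Reg} {s s' s'' : State} (h : Quiet rs s s')
    (h' : Quiet rs s' s'') : Quiet rs s s'' :=
  ⟨fun r hr => (h'.reg r hr).trans (h.reg r hr), fun a ha => (h'.arr a ha).trans (h.arr a ha),
    h'.row.trans h.row⟩

/-- The key is valid, and the entry of the table `row` which is needed to find it is there. -/
def Key.Ok (M : ℕ) (s : State) : Key → Prop
  | .even u v => v < M ∧ s.row u = u * M
  | .odd _ _ => True

theorem childReg_ne {r : Reg} (h : r ≠ .c₀) (h' : r ≠ .c₁) (e : Bool) : childReg e ≠ r := by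
  cases e
  · exact h.symm
  · exact h'.symm

theorem Slot.key_congr {s s' : State} (h : ∀ p, s'.arr (.vec p) = s.arr (.vec p))
    (h₀ : s'.reg .c₀ = s.reg .c₀) (h₁ : s'.reg .c₁ = s.reg .c₁) (σ : Slot) :
    σ.key s' = σ.key s := by
  cases σ with
  | two e p q => cases e <;> simp [key, h, h₀, h₁, childReg]
  | one p q => simp [key, h, h₀]

theorem Slot.eval_read {M : ℕ} {s : State} {σ : Slot} (h : (σ.key s).Ok M s) :
    (σ.read.eval s).reg .y = look M s (σ.key s) ∧
      Frame [.u, .v, .y] [] s (σ.read.eval s) := by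
  cases σ with
  | two e p q =>
    have h1 : childReg (!e) ≠ .u := childReg_ne (by decide) (by decide) _
    refine ⟨?_, ?_, ?_, ?_, ?_⟩
    · simp only [key, Key.Ok] at h
      simp [read, Cmd.eval_block_cons, Cmd.eval_block_nil, Op.eval, h1, key, look, h.2,
        Function.update_of_ne]
    · intro r hr
      simp only [List.mem_cons, List.not_mem_nil, or_false, not_or] at hr
      simp [read, Cmd.eval_block_cons, Cmd.eval_block_nil, Op.eval, Function.update_of_ne, hr]
    all_goals simp [read, Cmd.eval_block_cons, Cmd.eval_block_nil, Op.eval]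
  | one p q =>
    refine ⟨?_, ?_, ?_, ?_, ?_⟩
    · simp [read, Cmd.eval_block_cons, Cmd.eval_block_nil, Op.eval, key, look]
    · intro r hr
      simp only [List.mem_cons, List.not_mem_nil, or_false, not_or] at hr
      simp [read, Cmd.eval_block_cons, Cmd.eval_block_nil, Op.eval, Function.update_of_ne, hr]
    all_goals simp [read, Cmd.eval_block_cons, Cmd.eval_block_nil, Op.eval]

theorem mul_add_inj {M u v u' v' : ℕ} (hv : v < M) (hv' : v' < M)
    (h : u * M + v = u' * M + v') : u = u' ∧ v = v' := by
  have h1 : u = u' := by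
    have := congrArg (· / M) h
    simpa [Nat.add_div_of_dvd_right, Nat.div_eq_of_lt, hv, hv', (by omega : 0 < M),
      Nat.mul_div_cancel, Nat.add_comm _ v, Nat.add_comm _ v', Nat.add_mul_div_right] using this
  subst h1
  exact ⟨rfl, by omega⟩

open Classical in
/-- The effect of the change of one entry in the dictionary. -/
theorem look_dictStore {M u v n : ℕ} (hv : v < M) {s s' : State}
    (hd : s'.dict = Function.update s.dict (u * M + v) n)
    (ho : ∀ q, s'.arr (.odd q) = s.arr (.odd q)) {κ : Key} (hκ : κ.Valid M) :
    look M s' κ = if κ = .even u v then n else look M s κ := by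
  cases κ with
  | even u' v' =>
    simp only [look, hd, Function.update_apply, Key.even.injEq]
    refine if_congr ⟨fun h => mul_add_inj hκ hv h, fun h => by rw [h.1, h.2]⟩ rfl rfl
  | odd u' q' => simp [look, ho]

open Classical in
theorem look_oddStore {M u n : ℕ} {q : G} {s s' : State} (hd : s'.dict = s.dict)
    (ho : s'.arr = Function.update s.arr (.odd q) (Function.update (s.arr (.odd q)) u n))
    (κ : Key) : look M s' κ = if κ = .odd u q then n else look M s κ := by
  cases κ with
  | even u' v' => simp [look, hd]
  | odd u' q' =>
    by_cases hq : q' = q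
    · subst hq
      simp [look, ho, Function.update_apply]
    · simp [look, ho, Function.update_of_ne, hq]

open Classical in
theorem Slot.eval_write {M : ℕ} {s : State} {σ : Slot} (h : (σ.key s).Ok M s) :
    Quiet [.u, .v] s (σ.write.eval s) ∧ ∀ κ : Key, κ.Valid M →
      look M (σ.write.eval s) κ = if κ = σ.key s then s.reg .next else look M s κ := by
  cases σ with
  | two e p q =>
    have h1 : childReg (!e) ≠ .u := childReg_ne (by decide) (by decide) _
    simp only [key, Key.Ok] at h
    refine ⟨⟨?_, ?_, ?_⟩, fun κ hκ => look_dictStore h.1 ?_ ?_ hκ⟩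
    · intro r hr
      simp only [List.mem_cons, List.not_mem_nil, or_false, not_or] at hr
      simp [write, Cmd.eval_block_cons, Cmd.eval_block_nil, Op.eval, Function.update_of_ne, hr]
    · simp [write, Cmd.eval_block_cons, Cmd.eval_block_nil, Op.eval]
    · simp [write, Cmd.eval_block_cons, Cmd.eval_block_nil, Op.eval]
    · simp [write, Cmd.eval_block_cons, Cmd.eval_block_nil, Op.eval, h1, h.2,
        Function.update_of_ne]
    · simp [write, Cmd.eval_block_cons, Cmd.eval_block_nil, Op.eval]
  | one p q =>
    refine ⟨⟨?_, ?_, ?_⟩, fun κ hκ => look_oddStore ?_ ?_ κ⟩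
    · intro r hr
      simp only [List.mem_cons, List.not_mem_nil, or_false, not_or] at hr
      simp [write, Cmd.eval_block_cons, Cmd.eval_block_nil, Op.eval, Function.update_of_ne, hr]
    · intro a ha
      simp [write, Cmd.eval_block_cons, Cmd.eval_block_nil, Op.eval, Function.update_of_ne, ha]
    all_goals simp [write, Cmd.eval_block_cons, Cmd.eval_block_nil, Op.eval]

open Classical in
theorem Slot.eval_writeAll {M : ℕ} (l : List Slot) : ∀ {s : State},
    (∀ σ ∈ l, (σ.key s).Ok M s) →
    Quiet [.u, .v] s ((Cmd.each l Slot.write).eval s) ∧ ∀ κ : Key, κ.Valid M →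
      look M ((Cmd.each l Slot.write).eval s) κ =
        if κ ∈ l.map (Slot.key s) then s.reg .next else look M s κ := by
  induction l with
  | nil =>
    intro s _
    exact ⟨⟨fun _ _ => rfl, fun _ _ => rfl, rfl⟩, fun κ _ => by simp [Cmd.eval_each_nil]⟩
  | cons σ l ih =>
    intro s h
    obtain ⟨q1, e1⟩ := Slot.eval_write (h σ (List.mem_cons_self ..))
    have hk : ∀ τ : Slot, τ.key (σ.write.eval s) = τ.key s := fun τ =>
      Slot.key_congr (fun p => q1.arr _ (by simp)) (q1.reg _ (by simp)) (q1.reg _ (by simp)) τ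
    have hok : ∀ τ ∈ l, (τ.key (σ.write.eval s)).Ok M (σ.write.eval s) := by
      intro τ hτ
      rw [hk]
      have := h τ (List.mem_cons_of_mem _ hτ)
      revert this
      cases τ.key s <;> simp [Key.Ok, q1.row]
    obtain ⟨q2, e2⟩ := ih hok
    rw [Cmd.eval_each_cons]
    refine ⟨q1.trans q2, fun κ hκ => ?_⟩
    rw [e2 κ hκ, e1 κ hκ, q1.reg .next (by simp), List.map_congr_left fun τ _ => hk τ]
    by_cases h1 : κ ∈ l.map (Slot.key s) <;> by_cases h2 : κ = σ.key s <;> simp [h1, h2]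

end Grigorchuk

namespace Grigorchuk

open RAM

/-! ### Numbers for the classes of the short elements -/

/-- All cosets of the branching subgroup. -/
noncomputable def allG : List G := (Set.toFinite (Set.univ : Set G)).toFinset.toList

theorem mem_allG (p : G) : p ∈ allG := by simp [allG]

/-- The classes of the conjugates of the elements of length at most `1`. -/
def seeds : Set KClass := {c | ∃ g ∈ [1, ga, gb, gc, gd], ∃ p, conjCls g p = c}

instance : Finite seeds := by
  have : seeds = ⋃ g ∈ [1, ga, gb, gc, gd], Set.range (conjCls g) := by
    ext c
    simp only [seeds, Set.mem_ofPred_eq, Set.mem_iUnion, Set.mem_range, exists_prop]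
  rw [this]
  exact (Set.Finite.biUnion (List.finite_toSet [1, ga, gb, gc, gd])
    fun g _ => Set.finite_range _).to_subtype

theorem conjCls_mem_seeds {g : Gamma} (hg : g ∈ [1, ga, gb, gc, gd]) (p : G) :
    conjCls g p ∈ seeds := ⟨g, hg, p, rfl⟩

open Classical in
/-- The numbers of these classes are constants of the program. -/
noncomputable def seedIds (c : KClass) : ℕ := if h : c ∈ seeds then code (⟨c, h⟩ : seeds) + 1 else 0

theorem seedIds_ne_zero {c : KClass} : seedIds c ≠ 0 ↔ c ∈ seeds := by
  unfold seedIds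
  split <;> simp_all

theorem seedIds_le (c : KClass) : seedIds c ≤ Nat.card seeds := by
  unfold seedIds
  split
  · exact (Finite.equivFin seeds _).2
  · exact Nat.zero_le _

theorem injIds_seedIds : InjIds seedIds := by
  intro c c' hc h
  have hc' : seedIds c' ≠ 0 := h ▸ hc
  rw [seedIds_ne_zero] at hc hc'
  rw [seedIds, seedIds, dif_pos hc, dif_pos hc', Nat.add_right_cancel_iff, code_inj] at h
  exact congrArg Subtype.val h

/-- The sections of short elements are short. -/
theorem assigned_seedIds {h : Gamma} (hh : cls h ∈ seeds) : Assigned seedIds h := by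
  obtain ⟨g, hg, p, hp⟩ := hh
  obtain ⟨x, -, rfl⟩ := cls_eq_conjCls_iff.1 hp.symm
  rcases Bool.eq_false_or_eq_true (par g) with hpar | hpar
  · refine assigned_conj_odd _ hpar x fun q => seedIds_ne_zero.2 (conjCls_mem_seeds ?_ q)
    simp only [List.mem_cons, List.not_mem_nil, or_false] at hg
    rcases hg with rfl | rfl | rfl | rfl | rfl <;> simp_all
  · refine assigned_conj_even _ hpar x fun e q => seedIds_ne_zero.2 (conjCls_mem_seeds ?_ q)
    simp only [List.mem_cons, List.not_mem_nil, or_false] at hg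
    rcases hg with rfl | rfl | rfl | rfl | rfl <;> cases e <;> simp_all

theorem finite_seedPairs : {x : Key × ℕ | ∃ h, cls h ∈ seeds ∧
    x = (keyOf seedIds h, seedIds (cls h))}.Finite := by
  refine Set.Finite.subset (((((Set.finite_Iic (Nat.card seeds)).image2 Key.even
    (Set.finite_Iic (Nat.card seeds))).union ((Set.finite_Iic (Nat.card seeds)).image2 Key.odd
    (Set.toFinite (Set.univ : Set G)))).prod (Set.finite_Iic (Nat.card seeds)))) ?_
  rintro _ ⟨h, -, rfl⟩
  refine ⟨?_, seedIds_le _⟩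
  unfold keyOf
  split
  · exact Or.inr ⟨_, seedIds_le _, _, trivial, rfl⟩
  · exact Or.inl ⟨_, seedIds_le _, _, seedIds_le _, rfl⟩

/-- The keys of the short elements, and the numbers of their classes. -/
noncomputable def seedPairs : List (Key × ℕ) := finite_seedPairs.toFinset.toList

theorem mem_seedPairs {x : Key × ℕ} : x ∈ seedPairs ↔
    ∃ h, cls h ∈ seeds ∧ x = (keyOf seedIds h, seedIds (cls h)) := by
  simp [seedPairs]

/-- Store a constant number under a constant key. -/
def writeConst : Key × ℕ → Code
  | (.even u v, n) => .block [.const .u u, .const .v v, .rowLoad .u, .accAdd .v, .const .y n,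
      .dictStore .y]
  | (.odd u q, n) => .block [.const .u u, .const .y n, .store (.odd q) .u .y]

open Classical in
theorem eval_writeConst {M : ℕ} {s : State} {κ₀ : Key} {n : ℕ} (h : κ₀.Ok M s) :
    Quiet [.u, .v, .y] s ((writeConst (κ₀, n)).eval s) ∧ ∀ κ : Key, κ.Valid M →
      look M ((writeConst (κ₀, n)).eval s) κ = if κ = κ₀ then n else look M s κ := by
  cases κ₀ with
  | even u v =>
    simp only [Key.Ok] at h
    refine ⟨⟨?_, ?_, ?_⟩, fun κ hκ => look_dictStore h.1 ?_ ?_ hκ⟩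
    · intro r hr
      simp only [List.mem_cons, List.not_mem_nil, or_false, not_or] at hr
      simp [writeConst, Cmd.eval_block_cons, Cmd.eval_block_nil, Op.eval, Function.update_of_ne, hr]
    · simp [writeConst, Cmd.eval_block_cons, Cmd.eval_block_nil, Op.eval]
    · simp [writeConst, Cmd.eval_block_cons, Cmd.eval_block_nil, Op.eval]
    · simp [writeConst, Cmd.eval_block_cons, Cmd.eval_block_nil, Op.eval, h.2]
    · simp [writeConst, Cmd.eval_block_cons, Cmd.eval_block_nil, Op.eval]
  | odd u q =>
    refine ⟨⟨?_, ?_, ?_⟩, fun κ hκ => look_oddStore ?_ ?_ κ⟩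
    · intro r hr
      simp only [List.mem_cons, List.not_mem_nil, or_false, not_or] at hr
      simp [writeConst, Cmd.eval_block_cons, Cmd.eval_block_nil, Op.eval, Function.update_of_ne, hr]
    · intro a ha
      simp [writeConst, Cmd.eval_block_cons, Cmd.eval_block_nil, Op.eval, Function.update_of_ne, ha]
    all_goals simp [writeConst, Cmd.eval_block_cons, Cmd.eval_block_nil, Op.eval]

/-- If every key has only one value in the list, then this is the value stored under the key. -/
theorem eval_writeConstAll {M : ℕ} (l : List (Key × ℕ)) : ∀ {s : State},
    (∀ x ∈ l, x.1.Ok M s) → (∀ x ∈ l, ∀ y ∈ l, x.1 = y.1 → x.2 = y.2) →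
    Quiet [.u, .v, .y] s ((Cmd.each l writeConst).eval s) ∧ ∀ κ : Key, κ.Valid M →
      (∀ n, (κ, n) ∈ l → look M ((Cmd.each l writeConst).eval s) κ = n) ∧
      ((∀ n, (κ, n) ∉ l) → look M ((Cmd.each l writeConst).eval s) κ = look M s κ) := by
  induction l with
  | nil =>
    intro s _ _
    exact ⟨⟨fun _ _ => rfl, fun _ _ => rfl, rfl⟩, fun κ _ => by simp [Cmd.eval_each_nil]⟩
  | cons x l ih =>
    obtain ⟨κ₀, n₀⟩ := x
    intro s h hu
    obtain ⟨q1, e1⟩ := eval_writeConst (n := n₀) (h _ (List.mem_cons_self ..))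
    have hok : ∀ x ∈ l, x.1.Ok M ((writeConst (κ₀, n₀)).eval s) := by
      intro x hx
      have := h x (List.mem_cons_of_mem _ hx)
      revert this
      cases x.1 <;> simp [Key.Ok, q1.row]
    obtain ⟨q2, e2⟩ := ih hok fun x hx y hy =>
      hu x (List.mem_cons_of_mem _ hx) y (List.mem_cons_of_mem _ hy)
    rw [Cmd.eval_each_cons]
    refine ⟨q1.trans q2, fun κ hκ => ⟨fun n hn => ?_, fun hn => ?_⟩⟩
    · by_cases hl : ∃ m, (κ, m) ∈ l
      · obtain ⟨m, hm⟩ := hl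
        rw [(e2 κ hκ).1 m hm]
        exact hu _ (List.mem_cons_of_mem _ hm) _ hn rfl
      · rw [(e2 κ hκ).2 fun m hm => hl ⟨m, hm⟩, e1 κ hκ]
        rcases List.mem_cons.1 hn with hn | hn
        · obtain ⟨rfl, rfl⟩ := Prod.mk.inj hn
          rw [if_pos rfl]
        · exact absurd ⟨n, hn⟩ hl
    · rw [(e2 κ hκ).2 fun m hm => hn m (List.mem_cons_of_mem _ hm), e1 κ hκ, if_neg]
      rintro rfl
      exact hn n₀ (List.mem_cons_self ..)

/-! ### Numbering the classes -/

/-- The length of the rows of the dictionary, for `n` words: there will be fewer classes. -/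
noncomputable def rowSize (n : ℕ) : ℕ := allG.length * n + (Nat.card seeds + 1)

/-- Append an entry to the table of the beginnings of the rows, which is the table of the multiples
of `rowSize cnt`. -/
noncomputable def newRow : Code :=
  .seq (.block [.move .u .next, .dec .u, .rowLoad .u])
    (.seq (.each allG fun _ => .op (.accAdd .cnt))
      (.block [.const .u (Nat.card seeds + 1), .accAdd .u, .rowStore .next, .inc .next]))

theorem eval_each_accAdd {T : Type} (l : List T) (r : Reg) (s : State) :
    (Cmd.each l fun _ => (.op (.accAdd r) : Code)).eval s =
      { s with acc := s.acc + l.length * s.reg r } := by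
  induction l generalizing s with
  | nil => simp [Cmd.eval_each_nil]
  | cons x l ih =>
    rw [Cmd.eval_each_cons, ih]
    simp only [Cmd.eval, Op.eval, List.length_cons]
    congr 1
    ring

theorem eval_newRow (s : State) : (newRow.eval s).reg .next = s.reg .next + 1 ∧
    (∀ r ∉ [Reg.u, Reg.next], (newRow.eval s).reg r = s.reg r) ∧
    (newRow.eval s).arr = s.arr ∧ (newRow.eval s).dict = s.dict ∧
    (newRow.eval s).row = Function.update s.row (s.reg .next)
      (s.row (s.reg .next - 1) + rowSize (s.reg .cnt)) := by
  simp only [newRow, Cmd.eval_seq, eval_each_accAdd]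
  refine ⟨?_, fun r hr => ?_, ?_, ?_, ?_⟩
  · simp [Cmd.eval_block_cons, Cmd.eval_block_nil, Op.eval]
  · simp only [List.mem_cons, List.not_mem_nil, or_false, not_or] at hr
    simp [Cmd.eval_block_cons, Cmd.eval_block_nil, Op.eval, Function.update_of_ne, hr]
  · simp [Cmd.eval_block_cons, Cmd.eval_block_nil, Op.eval]
  · simp [Cmd.eval_block_cons, Cmd.eval_block_nil, Op.eval]
  · simp [Cmd.eval_block_cons, Cmd.eval_block_nil, Op.eval, rowSize, Nat.add_assoc]

/-- There is a table of the first multiples of `M`. -/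
structure Rows (M : ℕ) (s : State) : Prop where
  size : M = rowSize (s.reg .cnt)
  pos : 1 ≤ s.reg .next
  row : ∀ u < s.reg .next, s.row u = u * M

theorem Rows.newRow {M : ℕ} {s : State} (h : Rows M s) : Rows M (newRow.eval s) := by
  obtain ⟨h1, h2, -, -, h5⟩ := eval_newRow s
  refine ⟨by rw [h2 _ (by simp), h.size], by omega, fun u hu => ?_⟩
  rw [h5, Function.update_apply]
  have hp := h.pos
  split <;> rename_i he
  · rw [he, h.row _ (by omega), ← h.size]
    conv_lhs => rw [← Nat.succ_mul]
    congr 1; omega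
  · exact h.row u (by omega)

/-- The dictionary of the program describes the numbering `ids`. -/
structure Table (ids : KClass → ℕ) (M : ℕ) (s : State) : Prop extends Rows M s where
  cons : Consistent ids M (look M s)
  seeds : Extends seedIds ids
  lt : ∀ c, ids c < s.reg .next

theorem look_congr {s s' : State} (hd : s'.dict = s.dict)
    (ho : ∀ q, s'.arr (.odd q) = s.arr (.odd q)) (M : ℕ) : look M s' = look M s := by
  funext κ
  cases κ with
  | even u v => simp [look, hd]
  | odd u q => simp [look, ho]

theorem Table.congr {ids : KClass → ℕ} {M : ℕ} {s s' : State} (h : Table ids M s)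
    (hn : s'.reg .next = s.reg .next) (hc : s'.reg .cnt = s.reg .cnt) (hr : s'.row = s.row)
    (hd : s'.dict = s.dict) (ho : ∀ q, s'.arr (.odd q) = s.arr (.odd q)) : Table ids M s' where
  size := by rw [hc, h.size]
  pos := by rw [hn]; exact h.pos
  row u hu := by rw [hr]; exact h.row u (hn ▸ hu)
  cons := by rw [look_congr hd ho]; exact h.cons
  seeds := h.seeds
  lt c := by rw [hn]; exact h.lt c

/-- Set up the dictionary. -/
noncomputable def initTable : Code :=
  .seq (.op (.const .next 1))
    (.seq (.each (List.range (Nat.card seeds)) fun _ => newRow) (.each seedPairs writeConst))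

theorem eval_initRows {T : Type} (l : List T) : ∀ {M : ℕ} {s : State}, Rows M s →
    Rows M ((Cmd.each l fun _ => newRow).eval s) ∧
    ((Cmd.each l fun _ => newRow).eval s).reg .next = s.reg .next + l.length ∧
    (∀ r ∉ [Reg.u, Reg.next], ((Cmd.each l fun _ => newRow).eval s).reg r = s.reg r) ∧
    ((Cmd.each l fun _ => newRow).eval s).arr = s.arr ∧
    ((Cmd.each l fun _ => newRow).eval s).dict = s.dict := by
  induction l with
  | nil => exact fun h => ⟨h, rfl, fun _ _ => rfl, rfl, rfl⟩
  | cons x l ih =>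
    intro M s h
    obtain ⟨h1, h2, h3, h4, -⟩ := eval_newRow s
    obtain ⟨g1, g2, g3, g4, g5⟩ := ih h.newRow
    rw [Cmd.eval_each_cons]
    refine ⟨g1, ?_, fun r hr => (g3 r hr).trans (h2 r hr), g4.trans h3, g5.trans h4⟩
    rw [g2, h1, List.length_cons]; omega

/-- `s'` differs from `s` at most in the given registers, in the dictionary, and in the numbers of
classes stored for the words. -/
structure Keeps (rs : List Reg) (s s' : State) : Prop where
  reg : ∀ r, r ∉ rs → s'.reg r = s.reg r
  arr : ∀ a, (∀ q, a ≠ .odd q) → (∀ p, a ≠ .vec p) → s'.arr a = s.arr a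

theorem Keeps.trans {rs : List Reg} {s s' s'' : State} (h : Keeps rs s s') (h' : Keeps rs s' s'') :
    Keeps rs s s'' :=
  ⟨fun r hr => (h'.reg r hr).trans (h.reg r hr),
    fun a ha hb => (h'.arr a ha hb).trans (h.arr a ha hb)⟩

theorem eval_initTable {s : State} (h : Clean s) :
    Table seedIds (rowSize (s.reg .cnt)) (initTable.eval s) ∧
      (initTable.eval s).reg .next = Nat.card seeds + 1 ∧
      Keeps [.u, .v, .y, .next] s (initTable.eval s) := by
  set M := rowSize (s.reg .cnt) with hM
  set s1 : State := (Op.const .next 1).eval s with hs1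
  have r1 : Rows M s1 := by
    refine ⟨by simp [hs1, Op.eval, hM], by simp [hs1, Op.eval], fun u hu => ?_⟩
    have : u = 0 := by simpa [hs1, Op.eval] using hu
    simp [hs1, Op.eval, h.row, this]
  obtain ⟨g1, g2, g3, g4, g5⟩ := eval_initRows (List.range (Nat.card seeds)) r1
  set s2 := (Cmd.each (List.range (Nat.card seeds)) fun _ => newRow).eval s1 with hs2
  have hn2 : s2.reg .next = Nat.card seeds + 1 := by
    rw [g2, List.length_range]; simp [hs1, Op.eval]; omega
  have hlt : Nat.card seeds < M := by rw [hM, rowSize]; omega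
  have hok : ∀ x ∈ seedPairs, x.1.Ok M s2 := by
    intro x hx
    obtain ⟨h, -, rfl⟩ := mem_seedPairs.1 hx
    unfold keyOf
    split
    · trivial
    · exact ⟨(seedIds_le _).trans_lt hlt,
        g1.row _ (hn2 ▸ (Nat.lt_succ_iff.2 (seedIds_le _)))⟩
  have huniq : ∀ x ∈ seedPairs, ∀ y ∈ seedPairs, x.1 = y.1 → x.2 = y.2 := by
    intro x hx y hy hxy
    obtain ⟨h, hh, rfl⟩ := mem_seedPairs.1 hx
    obtain ⟨h', -, rfl⟩ := mem_seedPairs.1 hy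
    simp only at hxy ⊢
    rw [cls_eq_of_keyOf_eq injIds_seedIds (assigned_seedIds hh) hxy]
  obtain ⟨q, e⟩ := eval_writeConstAll seedPairs hok huniq
  have hz : ∀ κ, look M s2 κ = 0 := by
    intro κ
    cases κ with
    | even u v => simp [look, g5, hs1, Op.eval, h.dict]
    | odd u q => simp [look, g4, hs1, Op.eval, h.odd]
  have hval : ∀ c, seedIds c < M := fun c => (seedIds_le c).trans_lt hlt
  have hs3 : initTable.eval s = (Cmd.each seedPairs writeConst).eval s2 := rfl
  rw [hs3]
  have hn3 : ((Cmd.each seedPairs writeConst).eval s2).reg .next = Nat.card seeds + 1 := by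
    rw [q.reg _ (by simp), hn2]
  refine ⟨⟨⟨?_, ?_, ?_⟩, ⟨injIds_seedIds, hval, ?_, ?_⟩, fun _ _ => rfl, ?_⟩, hn3, ?_, ?_⟩
  · rw [q.reg _ (by simp), ← g1.size]
  · omega
  · intro u hu
    rw [q.row]
    rw [q.reg _ (by simp)] at hu
    exact g1.row u hu
  · intro κ hκ hne
    by_cases hex : ∃ n, (κ, n) ∈ seedPairs
    · obtain ⟨n, hn⟩ := hex
      have := (e κ hκ).1 n hn
      obtain ⟨h, hh, hx⟩ := mem_seedPairs.1 hn
      obtain ⟨rfl, rfl⟩ := Prod.mk.inj hx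
      exact ⟨h, assigned_seedIds hh, rfl, this.symm⟩
    · rw [(e κ hκ).2 fun n hn => hex ⟨n, hn⟩, hz] at hne
      exact absurd rfl hne
  · intro h hh
    have hs := seedIds_ne_zero.1 hh
    exact ⟨assigned_seedIds hs, (e _ (valid_keyOf hval h)).1 _ (mem_seedPairs.2 ⟨h, hs, rfl⟩)⟩
  · intro c
    rw [hn3]
    exact Nat.lt_succ_iff.2 (seedIds_le c)
  · intro r hr
    simp only [List.mem_cons, List.not_mem_nil, or_false, not_or] at hr
    rw [q.reg r (by simp [hr]), g3 r (by simp [hr])]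
    simp [hs1, Op.eval, Function.update_of_ne, hr]
  · intro a ha _
    rw [q.arr a ha, g4]; rfl

end Grigorchuk

namespace Grigorchuk

open RAM

/-! ### Numbering the conjugates of the words -/

/-- Look up the key formed according to `σ₀`. If there is no number under it, store a new number
under all the keys formed according to `σs`. Store the number in the array `vec p`. -/
noncomputable def classify (σ₀ : Slot) (σs : List Slot) (p : G) : Code :=
  .seq σ₀.read
    (.seq
      (.ifz .y (.seq (.each σs Slot.write) (.seq (.op (.move .y .next)) newRow)) .nop)
      (.op (.store (.vec p) .i .y)))

/-- The keys formed according to the list `σs` are those of the elements of the class `c`. -/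
structure SlotsOk (ids : KClass → ℕ) (s : State) (σ₀ : Slot) (σs : List Slot) (c : KClass) :
    Prop where
  mem : σ₀ ∈ σs
  keys : ∀ h, cls h = c → Assigned ids h ∧ keyOf ids h ∈ σs.map (Slot.key s)
  exact : ∀ σ ∈ σs, ∃ h, cls h = c ∧ keyOf ids h = σ.key s

theorem Table.keyOk {ids : KClass → ℕ} {M : ℕ} {s : State} (h : Table ids M s) (g : Gamma) :
    (keyOf ids g).Ok M s := by
  unfold keyOf
  split
  · trivial
  · exact ⟨h.cons.lt _, h.row _ (h.lt _)⟩

theorem SlotsOk.congr {ids : KClass → ℕ} {s s' : State} {σ₀ : Slot} {σs : List Slot} {c : KClass}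
    (h : SlotsOk ids s σ₀ σs c) (hk : ∀ σ : Slot, σ.key s' = σ.key s) {ids' : KClass → ℕ}
    (he : Extends ids ids') : SlotsOk ids' s' σ₀ σs c where
  mem := h.mem
  keys g hg := by
    obtain ⟨h1, h2⟩ := h.keys g hg
    refine ⟨he.assigned h1, ?_⟩
    rwa [he.keyOf_eq h1, List.map_congr_left fun σ _ => hk σ]
  exact σ hσ := by
    obtain ⟨g, hg, hg'⟩ := h.exact σ hσ
    exact ⟨g, hg, by rw [hk, he.keyOf_eq (h.keys g hg).1, hg']⟩

theorem Extends.refl (ids : KClass → ℕ) : Extends ids ids := fun _ _ => rfl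

theorem Extends.trans {ids ids' ids'' : KClass → ℕ} (h : Extends ids ids')
    (h' : Extends ids' ids'') : Extends ids ids'' := fun c hc => by
  rw [h' c (by rw [h c hc]; exact hc), h c hc]

/-- The registers which change while a class is numbered. -/
abbrev classRegs : List Reg := [.u, .v, .y, .next]

open Classical in
/-- One of the keys of the class `c` is enough to find out whether `c` has a number: if it has, the
number is stored under all keys of the class, and a key belongs to only one class. -/
theorem eval_classify {ids : KClass → ℕ} {M : ℕ} {s : State} (hT : Table ids M s)
    (hM : s.reg .next < M) {σ₀ : Slot} {σs : List Slot} {c : KClass}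
    (hσ : SlotsOk ids s σ₀ σs c) (p : G) :
    ∃ ids', Table ids' M ((classify σ₀ σs p).eval s) ∧ Extends ids ids' ∧ ids' c ≠ 0 ∧
      ((classify σ₀ σs p).eval s).reg .next ≤ s.reg .next + 1 ∧
      ((classify σ₀ σs p).eval s).arr (.vec p) =
        Function.update (s.arr (.vec p)) (s.reg .i) (ids' c) ∧
      (∀ q ≠ p, ((classify σ₀ σs p).eval s).arr (.vec q) = s.arr (.vec q)) ∧
      Keeps classRegs s ((classify σ₀ σs p).eval s) := by
  have hok : ∀ σ ∈ σs, (σ.key s).Ok M s := fun σ h => by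
    obtain ⟨g, -, hg⟩ := hσ.exact σ h
    rw [← hg]
    exact hT.keyOk g
  obtain ⟨g₀, hg₀, hk₀⟩ := hσ.exact σ₀ hσ.mem
  obtain ⟨hy, hF⟩ := Slot.eval_read (hok σ₀ hσ.mem)
  set s1 := σ₀.read.eval s with hs1
  have hT1 : Table ids M s1 :=
    hT.congr (hF.reg _ (by simp)) (hF.reg _ (by simp)) hF.row hF.dict fun q => hF.arr _ (by simp)
  have hlook1 : look M s1 = look M s := look_congr hF.dict (fun q => hF.arr _ (by simp)) M
  have hs' : (classify σ₀ σs p).eval s = (Op.store (.vec p) .i .y).eval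
      (if s1.reg .y = 0 then newRow.eval ((Op.move .y .next).eval
        ((Cmd.each σs Slot.write).eval s1)) else s1) := rfl
  rw [hs', hy]
  by_cases h0 : look M s (σ₀.key s) = 0
  · rw [if_pos h0]
    have hc0 : ids c = 0 := by
      by_contra hne
      rw [← hg₀] at hne
      exact hne ((hT.cons.complete g₀ hne).2.symm.trans (hk₀ ▸ h0))
    have hk1 : ∀ σ : Slot, σ.key s1 = σ.key s := fun σ =>
      Slot.key_congr (fun q => by rw [hF.arr _ (by simp)]) (hF.reg _ (by simp))
        (hF.reg _ (by simp)) σ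
    obtain ⟨hQ, hW⟩ := Slot.eval_writeAll (M := M) (s := s1) σs fun σ h => by
      rw [hk1]
      have := hok σ h
      revert this
      cases σ.key s <;> simp [Key.Ok, hF.row]
    set s2 := (Cmd.each σs Slot.write).eval s1 with hs2
    set s3 : State := (Op.move .y .next).eval s2 with hs3
    have hnext3 : s3.reg .next = s.reg .next := by
      simp only [hs3, Op.eval]
      rw [Function.update_of_ne (by decide), hQ.reg _ (by simp), hF.reg _ (by simp)]
    have hcnt3 : s3.reg .cnt = s.reg .cnt := by
      simp only [hs3, Op.eval]
      rw [Function.update_of_ne (by decide), hQ.reg _ (by simp), hF.reg _ (by simp)]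
    have hrow3 : s3.row = s.row := by simp [hs3, Op.eval, hQ.row, hF.row]
    have hR3 : Rows M s3 :=
      ⟨by rw [hcnt3, hT.size], by rw [hnext3]; exact hT.pos, fun u hu => by
        rw [hrow3]; exact hT.row u (hnext3 ▸ hu)⟩
    obtain ⟨n1, n2, n3, n4, -⟩ := eval_newRow s3
    have hR4 := hR3.newRow
    set s4 := newRow.eval s3 with hs4
    have hy4 : s4.reg .y = s.reg .next := by
      rw [n2 _ (by simp)]
      simp only [hs3, Op.eval, Function.update_self]
      rw [hQ.reg _ (by simp), hF.reg _ (by simp)]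
    have hi4 : s4.reg .i = s.reg .i := by
      rw [n2 _ (by simp)]
      simp only [hs3, Op.eval]
      rw [Function.update_of_ne (by decide), hQ.reg _ (by simp), hF.reg _ (by simp)]
    have harr4 : s4.arr = s2.arr := n3
    have hlook4 : look M s4 = look M s2 := look_congr (s := s2) n4 (fun q => by rw [harr4]) M
    have hv4 : ∀ q, s4.arr (.vec q) = s.arr (.vec q) := fun q => by
      rw [harr4, hQ.arr _ (by simp), hF.arr _ (by simp)]
    have hpos := hT.pos
    have hnext' : s4.reg .next = s.reg .next + 1 := by rw [n1, hnext3]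
    have hcons : Consistent (Function.update ids c (s.reg .next)) M (look M s4) := by
      refine hT.cons.extend hc0 hM (fun c' => (hT.lt c').ne) hσ.keys
        (fun κ hκ => ?_) fun κ hκ => ?_
      · obtain ⟨σ, h, rfl⟩ := List.mem_map.1 hκ
        exact hσ.exact σ h
      · rw [hlook4, hW κ hκ, hlook1, hF.reg .next (by simp), List.map_congr_left fun σ _ => hk1 σ]
    refine ⟨Function.update ids c (s.reg .next), ⟨⟨?_, ?_, ?_⟩, ?_, ?_, ?_⟩,
      extends_update hc0 _, ?_, ?_, ?_, ?_, ?_, ?_⟩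
    · exact hR4.size
    · exact hR4.pos
    · exact hR4.row
    · have : look M ((Op.store (.vec p) .i .y).eval s4) = look M s4 :=
        look_congr (s := s4) (s' := (Op.store (.vec p) .i .y).eval s4) rfl
          (fun q => by simp [Op.eval]) M
      rw [this]
      exact hcons
    · exact hT.seeds.trans (extends_update hc0 _)
    · intro c'
      simp only [Op.eval]
      rw [hnext']
      by_cases hc' : c' = c
      · rw [hc', Function.update_self]; omega
      · rw [Function.update_of_ne hc']
        exact (hT.lt c').trans (by omega)
    · rw [Function.update_self]; omega
    · simp only [Op.eval]; omega
    · simp [Op.eval, hy4, hi4, hv4]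
    · intro q hq
      simp [Op.eval, hq, hv4]
    · intro r hr
      simp only [List.mem_cons, List.not_mem_nil, or_false, not_or] at hr
      simp only [Op.eval]
      rw [n2 r (by simp [hr])]
      simp only [hs3, Op.eval]
      rw [Function.update_of_ne hr.2.2.1, hQ.reg r (by simp [hr]), hF.reg r (by simp [hr])]
    · intro a ha hb
      simp only [Op.eval]
      rw [Function.update_of_ne (hb p), harr4, hQ.arr a ha, hF.arr a (by simp)]
  · rw [if_neg h0]
    have hc : ids c = look M s (σ₀.key s) := by
      rw [← hk₀] at h0 ⊢
      obtain ⟨h, ha, hk, hh⟩ := hT.cons.sound _ (valid_keyOf hT.cons.lt g₀) h0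
      rw [← hh, ← hg₀, cls_eq_of_keyOf_eq hT.cons.inj ha hk]
    refine ⟨ids, hT1.congr rfl rfl rfl rfl (fun q => by simp [Op.eval]), Extends.refl _,
      by rw [hc]; exact h0, ?_, ?_, ?_, ?_, ?_⟩
    · simp only [Op.eval]
      rw [hF.reg _ (by simp)]; omega
    · simp [Op.eval, hy, hc, hF.reg .i, hF.arr (.vec p)]
    · intro q hq
      simp [Op.eval, hq, hF.arr (.vec q)]
    · intro r hr
      simp only [List.mem_cons, List.not_mem_nil, or_false, not_or] at hr
      exact hF.reg r (by simp [hr])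
    · intro a ha hb
      simp only [Op.eval]
      rw [Function.update_of_ne (hb p), hF.arr a (by simp)]

/-- The numbers for all conjugates of an element. -/
theorem eval_classifyAll {σ₀ : G → Slot} {σs : G → List Slot} {F : G → KClass} {M : ℕ}
    (l : List G) : ∀ {ids : KClass → ℕ} {s : State}, Table ids M s → s.reg .next + l.length ≤ M →
    s.reg .c₀ ≠ s.reg .i → s.reg .c₁ ≠ s.reg .i →
    (∀ p, SlotsOk ids s (σ₀ p) (σs p) (F p)) → ∀ s',
    s' = (Cmd.each l fun p => classify (σ₀ p) (σs p) p).eval s →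
    ∃ ids', Table ids' M s' ∧ Extends ids ids' ∧ s'.reg .next ≤ s.reg .next + l.length ∧
      (∀ q, q ∈ l → s'.arr (.vec q) (s.reg .i) = ids' (F q) ∧ ids' (F q) ≠ 0) ∧
      (∀ q, q ∉ l → s'.arr (.vec q) = s.arr (.vec q)) ∧
      (∀ q, ∀ j ≠ s.reg .i, s'.arr (.vec q) j = s.arr (.vec q) j) ∧
      Keeps classRegs s s' := by
  induction l with
  | nil =>
    rintro ids s hT - - - - s' rfl
    exact ⟨ids, hT, Extends.refl _, le_rfl, by simp, fun _ _ => rfl, fun _ _ _ => rfl,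
      ⟨fun _ _ => rfl, fun _ _ _ => rfl⟩⟩
  | cons p l ih =>
    rintro ids s hT hM h₀ h₁ hσ s' rfl
    rw [List.length_cons] at hM
    obtain ⟨ids1, t1, t2, t3, t4, t5, t6, t7⟩ := eval_classify hT (by omega) (hσ p) p
    rw [Cmd.eval_each_cons]
    set s1 := (classify (σ₀ p) (σs p) p).eval s with hs1
    have hi1 : s1.reg .i = s.reg .i := t7.reg _ (by simp)
    have hv1 : ∀ q, ∀ j ≠ s.reg .i, s1.arr (.vec q) j = s.arr (.vec q) j := by
      intro q j hj
      by_cases hq : q = p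
      · rw [hq, t5, Function.update_of_ne hj]
      · rw [t6 q hq]
    have hc₀ : s1.reg .c₀ = s.reg .c₀ := t7.reg _ (by simp)
    have hc₁ : s1.reg .c₁ = s.reg .c₁ := t7.reg _ (by simp)
    have hk1 : ∀ σ : Slot, σ.key s1 = σ.key s := by
      intro σ
      cases σ with
      | two e p q =>
        cases e <;> simp [Slot.key, childReg, hc₀, hc₁, hv1 _ _ h₀, hv1 _ _ h₁]
      | one p q => simp [Slot.key, hc₀, hv1 _ _ h₀]
    obtain ⟨ids2, u1, u2, u3, u4, u5, u6, u7⟩ := ih t1 (by omega) (by rw [hc₀, hi1]; exact h₀)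
      (by rw [hc₁, hi1]; exact h₁) (fun q => (hσ q).congr hk1 t2) _ rfl
    rw [hi1] at u4 u6
    refine ⟨ids2, u1, t2.trans u2, ?_, fun q hq => ?_, fun q hq => ?_, fun q j hj => ?_,
      t7.trans u7⟩
    · rw [List.length_cons]; omega
    · by_cases hql : q ∈ l
      · exact u4 q hql
      · have hqp : q = p := by
          rcases List.mem_cons.1 hq with h | h
          · exact h
          · exact absurd h hql
        subst hqp
        rw [u5 q hql, t5, Function.update_self, u2 _ t3]
        exact ⟨rfl, t3⟩
    · rw [u5 q fun h => hq (List.mem_cons_of_mem _ h), t6 q fun h => hq (h ▸ List.mem_cons_self ..)]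
    · rw [u6 q j hj, hv1 q j hj]

/-- The program for one word, depending on the information on it: the conjugates of its value get
numbers. -/
noncomputable def classifyWord : Info → Code
  | .leaf r => .each allG fun p =>
      .block [.const .y (seedIds (conjCls r.val p)), .store (.vec p) .i .y]
  | .even r => .seq (.block [.load .c₀ .child .i, .move .c₁ .c₀, .inc .c₁])
      (.each allG fun p =>
        classify (.two (move (p * toG r.val)).1 (move (p * toG r.val)).2.1
            (move (p * toG r.val)).2.2)
          ((moves (p * toG r.val)).map fun m => .two m.1 m.2.1 m.2.2) p)
  | .odd r q₀ q₁ => .seq (.block [.load .c₀ .child .i, .move .c₁ .c₀, .inc .c₁])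
      (.each allG fun p =>
        let f : Move → Slot := fun m =>
          .one (if m.1 then m.2.1 * q₁ else m.2.1) (m.2.1 * (if m.1 then q₁ else q₀) * (m.2.2)⁻¹)
        classify (f (move (p * toG r.val))) ((moves (p * toG r.val)).map f) p)

theorem move_mem_moves (p : G) : move p ∈ moves p := by
  obtain ⟨x, hx, h⟩ := move_eq p
  exact mem_moves.2 ⟨x, hx, h⟩

/-- Keys which are formed with the data of all elements of a coset. -/
theorem slotsOk_moves {ids : KClass → ℕ} {s : State} {g : Gamma} {p : G} (f : Move → Slot)
    (ha : ∀ x, Assigned ids (x * g * x⁻¹))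
    (hk : ∀ x, keyOf ids (x * g * x⁻¹) = (f (moveOf x)).key s) :
    SlotsOk ids s (f (move p)) ((moves p).map f) (conjCls g p) where
  mem := List.mem_map_of_mem (move_mem_moves p)
  keys h hh := by
    obtain ⟨x, hx, rfl⟩ := cls_eq_conjCls_iff.1 hh
    refine ⟨ha x, ?_⟩
    rw [hk, List.map_map]
    exact List.mem_map_of_mem (f := Slot.key s ∘ f) (mem_moves.2 ⟨x, hx, rfl⟩)
  exact σ hσ := by
    obtain ⟨m, hm, rfl⟩ := List.mem_map.1 hσ
    obtain ⟨x, hx, rfl⟩ := mem_moves.1 hm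
    exact ⟨x * g * x⁻¹, cls_eq_conjCls_iff.2 ⟨x, hx, rfl⟩, hk x⟩

/-- The conjugates of the word number `j` have got numbers, which are stored. -/
def Numbered (ids : KClass → ℕ) (s : State) (W : List (List Letter)) (j : ℕ) : Prop :=
  ∀ w, W[j]? = some w → ∀ q, s.arr (.vec q) j = ids (conjCls (wordVal w) q) ∧
    ids (conjCls (wordVal w) q) ≠ 0

theorem Numbered.congr {ids ids' : KClass → ℕ} {s s' : State} {W : List (List Letter)} {j : ℕ}
    (h : Numbered ids s W j) (he : Extends ids ids')
    (hv : ∀ q, s'.arr (.vec q) j = s.arr (.vec q) j) : Numbered ids' s' W j := fun w hw q => by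
  obtain ⟨h1, h2⟩ := h w hw q
  rw [hv, he _ h2]
  exact ⟨h1, h2⟩

end Grigorchuk

namespace Grigorchuk

open RAM

theorem eval_storeConsts {n : G → ℕ} (l : List G) : ∀ {s : State}, ∀ s',
    s' = (Cmd.each l fun p => (.block [.const .y (n p), .store (.vec p) .i .y] : Code)).eval s →
    (∀ q ∈ l, s'.arr (.vec q) (s.reg .i) = n q) ∧
      (∀ q ∉ l, s'.arr (.vec q) = s.arr (.vec q)) ∧
      (∀ q, ∀ j ≠ s.reg .i, s'.arr (.vec q) j = s.arr (.vec q) j) ∧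
      (∀ a, (∀ p, a ≠ .vec p) → s'.arr a = s.arr a) ∧ (∀ r ≠ Reg.y, s'.reg r = s.reg r) ∧
      s'.row = s.row ∧ s'.dict = s.dict := by
  induction l with
  | nil => rintro s s' rfl; simp
  | cons p l ih =>
    rintro s s' rfl
    rw [Cmd.eval_each_cons]
    obtain ⟨h1, h2, h3, h4, h5, h6, h7⟩ :=
      ih (s := (Cmd.block [.const .y (n p), .store (.vec p) .i .y] : Code).eval s) _ rfl
    set s1 := (Cmd.block [.const .y (n p), .store (.vec p) .i .y] : Code).eval s with hs1
    have e1 : s1.reg .i = s.reg .i := by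
      simp [hs1, Cmd.eval_block_cons, Cmd.eval_block_nil, Op.eval]
    have e2 : s1.arr (.vec p) = Function.update (s.arr (.vec p)) (s.reg .i) (n p) := by
      simp [hs1, Cmd.eval_block_cons, Cmd.eval_block_nil, Op.eval]
    have e3 : ∀ a ≠ Arr.vec p, s1.arr a = s.arr a := fun a ha => by
      simp [hs1, Cmd.eval_block_cons, Cmd.eval_block_nil, Op.eval, Function.update_of_ne, ha]
    rw [e1] at h1 h3
    refine ⟨fun q hq => ?_, fun q hq => ?_, fun q j hj => ?_, fun a ha => ?_, fun r hr => ?_,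
      ?_, ?_⟩
    · by_cases hql : q ∈ l
      · exact h1 q hql
      · have hqp : q = p := by
          rcases List.mem_cons.1 hq with h | h
          · exact h
          · exact absurd h hql
        rw [h2 q hql, hqp, e2, Function.update_self]
    · rw [h2 q fun h => hq (List.mem_cons_of_mem _ h), e3 _ fun h => hq ?_]
      rw [Arr.vec.inj h]; exact List.mem_cons_self ..
    · rw [h3 q j hj]
      by_cases hqp : q = p
      · rw [hqp, e2, Function.update_of_ne hj]
      · rw [e3 _ fun h => hqp (Arr.vec.inj h)]
    · rw [h4 a ha, e3 a (ha p)]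
    · rw [h5 r hr]
      simp [hs1, Cmd.eval_block_cons, Cmd.eval_block_nil, Op.eval, Function.update_of_ne, hr]
    · rw [h6]; rfl
    · rw [h7]; rfl

theorem run_val_mem (r : Run) : r.val ∈ [1, ga, gb, gc, gd] := by
  cases r <;> simp [Run.val]

/-- What is known after the word number `i` has been dealt with. -/
structure Step (ids ids' : KClass → ℕ) (M : ℕ) (W : List (List Letter)) (i : ℕ)
    (s s' : State) : Prop where
  table : Table ids' M s'
  ext : Extends ids ids'
  next : s'.reg .next ≤ s.reg .next + allG.length
  numbered : Numbered ids' s' W i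
  vec : ∀ q, ∀ j ≠ i, s'.arr (.vec q) j = s.arr (.vec q) j
  keeps : Keeps [.u, .v, .y, .next, .c₀, .c₁] s s'

/-- The registers `c₀` and `c₁` point to the shorter words. -/
noncomputable def loadChild : Code := .block [.load .c₀ .child .i, .move .c₁ .c₀, .inc .c₁]

theorem step_of_classifyAll {ids : KClass → ℕ} {M : ℕ} {s : State} {W : List (List Letter)}
    {i : ℕ} {w : List Letter} (hT : Table ids M s) (hM : s.reg .next + allG.length ≤ M)
    (hi : s.reg .i = i) (hw : W[i]? = some w) (hchild : i < s.arr .child i)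
    {σ₀ : G → Slot} {σs : G → List Slot}
    (hσ : ∀ s1 : State, s1.arr = s.arr → s1.reg .c₀ = s.arr .child i →
      s1.reg .c₁ = s.arr .child i + 1 → ∀ p,
      SlotsOk ids s1 (σ₀ p) (σs p) (conjCls (wordVal w) p)) :
    ∃ ids', Step ids ids' M W i s
      ((Cmd.seq loadChild (.each allG fun p => classify (σ₀ p) (σs p) p)).eval s) := by
  rw [Cmd.eval_seq]
  set s1 := loadChild.eval s with hs1
  have a1 : s1.arr = s.arr := rfl
  have r0 : s1.reg .c₀ = s.arr .child i := by
    simp [hs1, loadChild, Cmd.eval_block_cons, Cmd.eval_block_nil, Op.eval, hi]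
  have r1 : s1.reg .c₁ = s.arr .child i + 1 := by
    simp [hs1, loadChild, Cmd.eval_block_cons, Cmd.eval_block_nil, Op.eval, hi]
  have r2 : ∀ r, r ≠ .c₀ → r ≠ .c₁ → s1.reg r = s.reg r := fun r h h' => by
    simp [hs1, loadChild, Cmd.eval_block_cons, Cmd.eval_block_nil, Op.eval, Function.update_of_ne,
      h, h']
  have i1 : s1.reg .i = i := by rw [r2 _ (by decide) (by decide), hi]
  have n1 : s1.reg .next = s.reg .next := r2 _ (by decide) (by decide)
  have hT1 : Table ids M s1 := hT.congr n1 (r2 _ (by decide) (by decide)) rfl rfl fun _ => rfl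
  obtain ⟨ids', t1, t2, t3, t4, -, t6, t7⟩ := eval_classifyAll (F := conjCls (wordVal w)) allG hT1
    (by rw [n1]; exact hM) (by rw [r0, i1]; omega) (by rw [r1, i1]; omega) (hσ s1 a1 r0 r1) _ rfl
  rw [i1] at t4 t6
  refine ⟨ids', t1, t2, by rw [← n1]; exact t3, fun w' hw' q => ?_, fun q j hj => ?_, ?_, ?_⟩
  · rw [hw] at hw'
    obtain rfl := Option.some.inj hw'
    exact t4 q (mem_allG q)
  · rw [t6 q j hj, a1]
  · intro r hr
    simp only [List.mem_cons, List.not_mem_nil, or_false, not_or] at hr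
    rw [t7.reg r (by simp [hr]), r2 r hr.2.2.2.2.1 hr.2.2.2.2.2]
  · intro a ha hb
    rw [t7.arr a ha hb, a1]

theorem eval_classifyWord {ids : KClass → ℕ} {M : ℕ} {s : State} {W : List (List Letter)} {i : ℕ}
    {w : List Letter} (hT : Table ids M s) (hM : s.reg .next + allG.length ≤ M)
    (hi : s.reg .i = i) (hw : W[i]? = some w) (hn : NodeOk s W i)
    (hj : ∀ j, i < j → Numbered ids s W j) :
    ∃ ids', Step ids ids' M W i s ((classifyWord (infoOf w)).eval s) := by
  obtain ⟨-, hchild, hsplit⟩ := hn w hw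
  cases hI : infoOf w with
  | leaf r =>
    obtain ⟨h1, -, h3, h4, h5, h6, h7⟩ := eval_storeConsts
      (n := fun p => seedIds (conjCls r.val p)) allG (s := s) _ rfl
    have hr : wordVal w = r.val := (infoOf_leaf hI).1
    refine ⟨ids, hT.congr (h5 _ (by decide)) (h5 _ (by decide)) h6 h7 (fun q => h4 _ (by simp)),
      Extends.refl _, ?_, fun w' hw' q => ?_, fun q j hj => ?_, fun r hr => ?_,
      fun a _ hb => h4 a hb⟩
    · have := h5 .next (by decide)
      simp only [classifyWord]
      omega
    · rw [hw] at hw'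
      obtain rfl := Option.some.inj hw'
      have hs : seedIds (conjCls r.val q) ≠ 0 :=
        seedIds_ne_zero.2 (conjCls_mem_seeds (run_val_mem r) q)
      rw [hr, hT.seeds _ hs]
      refine ⟨?_, hs⟩
      rw [← hi]
      exact h1 q (mem_allG q)
    · exact h3 q j (hi ▸ hj)
    · simp only [List.mem_cons, List.not_mem_nil, or_false, not_or] at hr
      exact h5 r hr.2.2.1
  | even r =>
    obtain ⟨hp, hs⟩ := infoOf_even hI
    refine step_of_classifyAll hT hM hi hw hchild (W := W) fun s1 ha hc₀ hc₁ p => ?_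
    have hsp : split w = [((Scan.start false).scan w).2, ((Scan.start true).scan w).2] := by
      rw [split, hI]
    have hv : ∀ e q, s1.arr (.vec q) (s1.reg (childReg e)) = ids (conjCls (sect (core r w) e) q) ∧
        ids (conjCls (sect (core r w) e) q) ≠ 0 := by
      intro e q
      rw [← hs e, ha]
      cases e
      · have := hsplit 0 _ (by rw [hsp]; rfl)
        rw [show s1.reg (childReg false) = s.arr .child i from hc₀]
        exact hj _ hchild _ this q
      · have := hsplit 1 _ (by rw [hsp]; rfl)
        rw [show s1.reg (childReg true) = s.arr .child i + 1 from hc₁]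
        exact hj _ (by omega) _ this q
    rw [wordVal_eq_core r w, conjCls_conj]
    exact slotsOk_moves (fun m => .two m.1 m.2.1 m.2.2)
      (fun x => assigned_conj_even ids hp x fun e q => (hv e q).2)
      (fun x => by rw [keyOf_conj_even ids hp, Slot.key, (hv _ _).1, (hv _ _).1])
  | odd r q₀ q₁ =>
    obtain ⟨hp, rfl, rfl, hs⟩ := infoOf_odd hI
    refine step_of_classifyAll hT hM hi hw hchild (W := W) fun s1 ha hc₀ hc₁ p => ?_
    have hsp : split w = [((Scan.start false).scan w).2 ++ ((Scan.start true).scan w).2] := by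
      rw [split, hI]
    have hv : ∀ q, s1.arr (.vec q) (s1.reg .c₀) =
        ids (conjCls (sect (core r w) false * sect (core r w) true) q) ∧
        ids (conjCls (sect (core r w) false * sect (core r w) true) q) ≠ 0 := by
      intro q
      have := hsplit 0 _ (by rw [hsp]; rfl)
      rw [hc₀, ha, ← hs false, ← hs true, ← wordVal_append]
      exact hj _ hchild _ this q
    rw [wordVal_eq_core r w, conjCls_conj]
    exact slotsOk_moves (fun m => .one
        (if m.1 then m.2.1 * toG (sect (core r w) true) else m.2.1)
        (m.2.1 * (if m.1 then toG (sect (core r w) true) else toG (sect (core r w) false)) *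
          (m.2.2)⁻¹))
      (fun x => assigned_conj_odd ids hp x fun q => (hv q).2)
      (fun x => by
        rw [keyOf_conj_odd ids hp, Slot.key, (hv _).1]
        cases (moveOf x).1 <;> rfl)

theorem loopFree_read (σ : Slot) : σ.read.LoopFree := by
  cases σ <;> exact Cmd.loopFree_block _

theorem loopFree_write (σ : Slot) : σ.write.LoopFree := by
  cases σ <;> exact Cmd.loopFree_block _

theorem loopFree_newRow : newRow.LoopFree :=
  ⟨Cmd.loopFree_block _, Cmd.loopFree_each fun _ => trivial, Cmd.loopFree_block _⟩

theorem loopFree_classify (σ₀ : Slot) (σs : List Slot) (p : G) : (classify σ₀ σs p).LoopFree :=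
  ⟨loopFree_read _, ⟨⟨Cmd.loopFree_each loopFree_write, trivial, loopFree_newRow⟩, trivial⟩,
    trivial⟩

theorem loopFree_classifyWord (I : Info) : (classifyWord I).LoopFree := by
  cases I with
  | leaf r => exact Cmd.loopFree_each fun p => Cmd.loopFree_block _
  | even r => exact ⟨Cmd.loopFree_block _, Cmd.loopFree_each fun p => loopFree_classify ..⟩
  | odd r q₀ q₁ => exact ⟨Cmd.loopFree_block _, Cmd.loopFree_each fun p => loopFree_classify ..⟩

theorem loopFree_initTable : initTable.LoopFree := by
  refine ⟨trivial, Cmd.loopFree_each fun _ => loopFree_newRow, Cmd.loopFree_each fun x => ?_⟩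
  obtain ⟨_ | _, _⟩ := x <;> exact Cmd.loopFree_block _

/-- Deal with the last word that has not been dealt with. -/
noncomputable def classifyBody : Code :=
  .seq (.block [.dec .i, .load .st .info .i]) (.cases .tmp .st classifyWord)

/-- Give numbers to the conjugates of all words, from the last word to the first. -/
noncomputable def classifyAll : Code :=
  .seq (.seq initTable (.op (.move .i .cnt))) (.loop .i classifyBody)

theorem loopFree_classifyBody : classifyBody.LoopFree :=
  ⟨Cmd.loopFree_block _, Cmd.loopFree_cases loopFree_classifyWord⟩

/-- The words with the numbers `n`, `n + 1`, … have been dealt with. -/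
structure Classified (ids : KClass → ℕ) (W : List (List Letter)) (s₀ s : State) (n : ℕ) :
    Prop where
  table : Table ids (rowSize W.length) s
  i : s.reg .i = n
  le : n ≤ W.length
  next : s.reg .next + allG.length * n ≤ rowSize W.length
  numbered : ∀ j, n ≤ j → Numbered ids s W j
  keeps : Keeps [.u, .v, .y, .next, .c₀, .c₁, .i, .st, .tmp] s₀ s

theorem reaches_classifyAll {W : List (List Letter)} {s : State} (hc : Clean s)
    (hcnt : s.reg .cnt = W.length) (hW : ∀ j < W.length, NodeOk s W j) :
    Reaches classifyAll s (initTable.cost + 1 + ((classifyBody.cost + 1) * W.length + 1))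
      fun s' => ∃ ids, Classified ids W s s' 0 := by
  obtain ⟨t1, t2, t3⟩ := eval_initTable hc
  rw [hcnt] at t1
  set s1 := initTable.eval s with hs1
  have hcnt1 : s1.reg .cnt = W.length := by rw [t3.reg _ (by simp), hcnt]
  refine Reaches.seq (P := fun s' => ∃ ids, Classified ids W s s' W.length)
    (T := initTable.cost + 1)
    (Cmd.LoopFree.reaches (c := .seq initTable (.op (.move .i .cnt)))
      ⟨loopFree_initTable, trivial⟩ ?_) ?_
  · rw [Cmd.eval_seq]
    refine ⟨seedIds, t1.congr ?_ ?_ rfl rfl fun _ => rfl, ?_, le_rfl, ?_, fun j hj w hw => ?_, ?_,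
      ?_⟩
    · simp [Cmd.eval, Op.eval, ← hs1]
    · simp [Cmd.eval, Op.eval, ← hs1]
    · simp [Cmd.eval, Op.eval, ← hs1, hcnt1]
    · simp only [Cmd.eval, Op.eval, ← hs1, ne_eq, reduceCtorEq, not_false_eq_true,
        Function.update_of_ne, t2, rowSize]
      omega
    · rw [List.getElem?_eq_none hj] at hw
      exact absurd hw (by simp)
    · intro r hr
      simp only [List.mem_cons, List.not_mem_nil, or_false, not_or] at hr
      simp only [Cmd.eval, Op.eval, ← hs1]
      rw [Function.update_of_ne hr.2.2.2.2.2.2.1, t3.reg r (by simp [hr])]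
    · intro a ha hb
      exact t3.arr a ha hb
  rintro s2 ⟨ids, h2⟩
  refine (Reaches.loop (fun n s' => ∃ ids, Classified ids W s s' n)
    (fun n => (classifyBody.cost + 1) * n) ?_ (g := W.length) ⟨ids, h2⟩).mono le_rfl ?_
  · rintro n s3 ⟨ids, h3⟩ hi
    rw [h3.i] at hi
    obtain ⟨m, rfl⟩ : ∃ m, n = m + 1 := ⟨n - 1, by omega⟩
    have hm : m < W.length := h3.le
    refine ⟨_, loopFree_classifyBody.reaches ⟨m, by rw [Nat.mul_succ]; omega, ?_⟩⟩
    have hwm : W[m]? = some W[m] := List.getElem?_eq_getElem hm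
    have ha3 : ∀ a, (∀ q, a ≠ .odd q) → (∀ p, a ≠ .vec p) → s3.arr a = s.arr a := h3.keeps.arr
    have hinfo : s3.arr .info m = code (infoOf W[m]) := by
      rw [ha3 _ (by simp) (by simp)]
      exact (hW m hm _ hwm).1
    rw [classifyBody, Cmd.eval_seq, Cmd.eval_cases (x := infoOf W[m])
      (by simp [Cmd.eval_block_cons, Cmd.eval_block_nil, Op.eval, h3.i, hinfo])]
    set s4 : State := { (Cmd.block [.dec .i, .load .st .info .i] : Code).eval s3 with
      reg := Function.update ((Cmd.block [.dec .i, .load .st .info .i] : Code).eval s3).reg .tmp 0 }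
      with hs4
    have r4 : ∀ r ∉ [Reg.tmp, .st, .i], s4.reg r = s3.reg r := fun r hr => by
      simp only [List.mem_cons, List.not_mem_nil, or_false, not_or] at hr
      simp [hs4, Cmd.eval_block_cons, Cmd.eval_block_nil, Op.eval, Function.update_of_ne, hr]
    have i4 : s4.reg .i = m := by
      simp [hs4, Cmd.eval_block_cons, Cmd.eval_block_nil, Op.eval, h3.i]
    have a4 : s4.arr = s3.arr := rfl
    have hnext := h3.next
    rw [Nat.mul_succ] at hnext
    obtain ⟨ids', h⟩ := eval_classifyWord (s := s4) (W := W)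
      (h3.table.congr (r4 _ (by simp)) (r4 _ (by simp)) rfl rfl fun _ => rfl)
      (by rw [r4 _ (by simp)]; omega) i4 hwm
      (fun w hw => by
        rw [a4, ha3 _ (by simp) (by simp), ha3 _ (by simp) (by simp)]
        exact hW m hm w hw)
      (fun j hj => (h3.numbered j hj).congr (Extends.refl _) fun q => rfl)
    refine ⟨ids', h.table, ?_, hm.le, ?_, fun j hj => ?_, ?_, ?_⟩
    · rw [h.keeps.reg _ (by simp), i4]
    · have := h.next
      rw [r4 _ (by simp)] at this
      omega
    · rcases hj.eq_or_lt with rfl | hj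
      · exact h.numbered
      · refine (h3.numbered j hj).congr h.ext fun q => ?_
        rw [h.vec q j (by omega), a4]
    · intro r hr
      simp only [List.mem_cons, List.not_mem_nil, or_false, not_or] at hr
      rw [h.keeps.reg r (by simp [hr]), r4 r (by simp [hr]), h3.keeps.reg r (by simp [hr])]
    · intro a ha hb
      rw [h.keeps.arr a ha hb, a4, ha3 a ha hb]
  · rintro s3 ⟨⟨n, ids, h3⟩, hi⟩
    rw [h3.i] at hi
    subst hi
    exact ⟨ids, h3⟩

end Grigorchuk

namespace Grigorchuk

open RAM

/-! ### Comparing the given words -/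

/-- Mark the numbers of all conjugates of the word number `i`. -/
noncomputable def markAll (l : List G) : Code :=
  .each l fun p => .block [.load .u (.vec p) .i, .store .used .u .y]

theorem eval_markAll (l : List G) : ∀ {s : State}, s.reg .y = 1 →
    (∀ r ≠ Reg.u, ((markAll l).eval s).reg r = s.reg r) ∧
    (∀ a ≠ Arr.used, ((markAll l).eval s).arr a = s.arr a) ∧
    ∀ k, ((markAll l).eval s).arr .used k ≠ 0 ↔
      s.arr .used k ≠ 0 ∨ ∃ p ∈ l, s.arr (.vec p) (s.reg .i) = k := by
  induction l with
  | nil => exact fun _ => ⟨fun _ _ => rfl, fun _ _ => rfl, fun k => by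
      simp [markAll, Cmd.eval_each_nil]⟩
  | cons p l ih =>
    intro s hy
    set s1 := (Cmd.block [.load .u (.vec p) .i, .store .used .u .y] : Code).eval s with hs1
    have r1 : ∀ r ≠ Reg.u, s1.reg r = s.reg r := fun r hr => by
      simp [hs1, Cmd.eval_block_cons, Cmd.eval_block_nil, Op.eval, Function.update_of_ne, hr]
    have a1 : ∀ a ≠ Arr.used, s1.arr a = s.arr a := fun a ha => by
      simp [hs1, Cmd.eval_block_cons, Cmd.eval_block_nil, Op.eval, Function.update_of_ne, ha]
    have u1 : s1.arr .used = Function.update (s.arr .used) (s.arr (.vec p) (s.reg .i)) 1 := by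
      simp [hs1, Cmd.eval_block_cons, Cmd.eval_block_nil, Op.eval, hy]
    obtain ⟨h1, h2, h3⟩ := ih (s := s1) (by rw [r1 _ (by decide), hy])
    have he : (markAll (p :: l)).eval s = (markAll l).eval s1 := rfl
    rw [he]
    refine ⟨fun r hr => (h1 r hr).trans (r1 r hr), fun a ha => (h2 a ha).trans (a1 a ha),
      fun k => ?_⟩
    rw [h3, u1, r1 _ (by decide)]
    simp only [a1 (.vec _) (by simp), List.mem_cons, exists_eq_or_imp, Function.update_apply]
    by_cases hk : k = s.arr (.vec p) (s.reg .i)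
    · simp [hk]
    · rw [if_neg hk]
      simp [Ne.symm hk]

/-- Compare the last word which has not been dealt with to the words after it. -/
noncomputable def checkBody : Code :=
  .seq (.block [.dec .i, .load .u (.vec 1) .i, .load .v .used .u])
    (.seq (.ifz .v .nop (.op (.const .ans 1))) (.seq (.op (.const .y 1)) (markAll allG)))

/-- Compare the given words to each other. -/
noncomputable def checkRoots : Code := .seq (.op (.move .i .roots)) (.loop .i checkBody)

theorem loopFree_checkBody : checkBody.LoopFree :=
  ⟨Cmd.loopFree_block _, ⟨trivial, trivial⟩, trivial,
    Cmd.loopFree_each fun _ => Cmd.loopFree_block _⟩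

/-- The words with the numbers `n`, `n + 1`, …, `N - 1` have been compared to each other, where
`V p j` is the number stored in `vec p` for the word number `j`. -/
structure Checked (V : G → ℕ → ℕ) (N n : ℕ) (s : State) : Prop where
  vec : ∀ q, s.arr (.vec q) = V q
  i : s.reg .i = n
  le : n ≤ N
  used : ∀ k, s.arr .used k ≠ 0 ↔ ∃ j p, n ≤ j ∧ j < N ∧ V p j = k
  ans : s.reg .ans ≠ 0 ↔ ∃ j j', n ≤ j ∧ j < j' ∧ j' < N ∧ ∃ p, V p j' = V 1 j

theorem eval_checkBody {V : G → ℕ → ℕ} {N n : ℕ} {s : State} (h : Checked V N (n + 1) s) :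
    Checked V N n (checkBody.eval s) := by
  set s1 := (Cmd.block [.dec .i, .load .u (.vec 1) .i, .load .v .used .u] : Code).eval s with hs1
  have i1 : s1.reg .i = n := by
    simp [hs1, Cmd.eval_block_cons, Cmd.eval_block_nil, Op.eval, h.i]
  have ans1 : s1.reg .ans = s.reg .ans := by
    simp [hs1, Cmd.eval_block_cons, Cmd.eval_block_nil, Op.eval]
  have v1 : s1.reg .v = s.arr .used (V 1 n) := by
    simp [hs1, Cmd.eval_block_cons, Cmd.eval_block_nil, Op.eval, h.i, h.vec]
  have a1 : s1.arr = s.arr := rfl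
  set s2 := (Cmd.ifz .v .nop (.op (.const .ans 1)) : Code).eval s1 with hs2
  have a2 : s2.arr = s.arr := by
    simp only [hs2, Cmd.eval]; split <;> rfl
  have i2 : s2.reg .i = n := by
    simp only [hs2, Cmd.eval]; split <;> simp [Op.eval, i1]
  have ans2 : s2.reg .ans ≠ 0 ↔ s.reg .ans ≠ 0 ∨ s.arr .used (V 1 n) ≠ 0 := by
    simp only [hs2, Cmd.eval, v1]
    split <;> rename_i hv
    · rw [ans1]; simp [hv]
    · simp [Op.eval, hv]
  set s3 : State := (Op.const .y 1).eval s2 with hs3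
  have i3 : s3.reg .i = n := by simp [hs3, Op.eval, i2]
  have ans3 : s3.reg .ans = s2.reg .ans := by simp [hs3, Op.eval]
  have a3 : s3.arr = s.arr := a2
  obtain ⟨h1, h2, h3⟩ := eval_markAll allG (s := s3) (by simp [hs3, Op.eval])
  have he : checkBody.eval s = (markAll allG).eval s3 := rfl
  rw [he]
  have hle := h.le
  refine ⟨fun q => ?_, ?_, by omega, fun k => ?_, ?_⟩
  · rw [h2 _ (by simp), a3, h.vec]
  · rw [h1 _ (by decide), i3]
  · rw [h3, a3, h.used, i3]
    simp only [h.vec]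
    constructor
    · rintro (⟨j, p, hj, hN, hk⟩ | ⟨p, -, hk⟩)
      · exact ⟨j, p, by omega, hN, hk⟩
      · exact ⟨n, p, le_rfl, by omega, hk⟩
    · rintro ⟨j, p, hj, hN, hk⟩
      rcases hj.eq_or_lt with rfl | hj
      · exact .inr ⟨p, mem_allG p, hk⟩
      · exact .inl ⟨j, p, hj, hN, hk⟩
  · rw [h1 _ (by decide), ans3, ans2, h.ans, h.used]
    constructor
    · rintro (⟨j, j', hj, hjj, hN, hp⟩ | ⟨j, p, hj, hN, hk⟩)
      · exact ⟨j, j', by omega, hjj, hN, hp⟩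
      · exact ⟨n, j, le_rfl, hj, hN, p, hk⟩
    · rintro ⟨j, j', hj, hjj, hN, p, hp⟩
      rcases hj.eq_or_lt with rfl | hj
      · exact .inr ⟨j', p, hjj, hN, hp⟩
      · exact .inl ⟨j, j', hj, hjj, hN, p, hp⟩

theorem reaches_checkRoots {s : State} (hu : s.arr .used = fun _ => 0) (ha : s.reg .ans = 0) :
    Reaches checkRoots s (1 + ((checkBody.cost + 1) * s.reg .roots + 1)) fun s' =>
      s'.reg .ans ≠ 0 ↔ ∃ j j', j < j' ∧ j' < s.reg .roots ∧
        ∃ p, s.arr (.vec p) j' = s.arr (.vec 1) j := by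
  set V : G → ℕ → ℕ := fun q => s.arr (.vec q) with hV
  set N := s.reg .roots with hN
  refine Reaches.seq (P := Checked V N N) (T := 1)
    (Cmd.LoopFree.reaches (c := (.op (.move .i .roots) : Code)) trivial ?_) ?_
  · refine ⟨fun _ => rfl, by simp [Cmd.eval, Op.eval, hN], le_rfl, fun k => ?_, ?_⟩
    · simp only [Cmd.eval, Op.eval, hu, ne_eq, not_true_eq_false, false_iff, not_exists, not_and]
      intro j p h1 h2
      omega
    · simp only [Cmd.eval, Op.eval, ne_eq, reduceCtorEq, not_false_eq_true, Function.update_of_ne,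
        ha, not_true_eq_false, false_iff, not_exists, not_and]
      intro j j' h1 h2 h3
      omega
  intro s1 h1
  refine (Reaches.loop (Checked V N) (fun n => (checkBody.cost + 1) * n) ?_ (g := N) h1).mono
    le_rfl ?_
  · intro n s2 h2 hi
    rw [h2.i] at hi
    obtain ⟨m, rfl⟩ : ∃ m, n = m + 1 := ⟨n - 1, by omega⟩
    exact ⟨_, loopFree_checkBody.reaches ⟨m, by rw [Nat.mul_succ]; omega, eval_checkBody h2⟩⟩
  · rintro s2 ⟨⟨n, h2⟩, hi⟩
    rw [h2.i] at hi
    subst hi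
    rw [h2.ans]
    simp [hV]

/-! ### The whole program -/

/-- The program which decides the conjugate pair problem. -/
noncomputable def conjugatePairs : Code :=
  .seq copy
    (.ifz .ans
      (.seq (.op (.move .roots .cnt)) (.seq reduceAll (.seq classifyAll checkRoots))) .nop)

theorem hasConjugatePair_iff {ws : List (List Letter)} : HasConjugatePair ws ↔
    ∃ (j j' : ℕ) (w w' : List Letter), j < j' ∧ ws[j]? = some w ∧ ws[j']? = some w' ∧
      IsConj (wordVal w) (wordVal w') := by
  constructor
  · rintro ⟨i, j, hij, h⟩
    rcases lt_or_gt_of_ne hij with hlt | hlt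
    · exact ⟨i, j, _, _, hlt, by simp, by simp, h⟩
    · exact ⟨j, i, _, _, hlt, by simp, by simp, h.symm⟩
  · rintro ⟨j, j', w, w', hlt, hw, hw', h⟩
    obtain ⟨h1, rfl⟩ := List.getElem?_eq_some_iff.1 hw
    obtain ⟨h2, rfl⟩ := List.getElem?_eq_some_iff.1 hw'
    refine ⟨⟨j, h1⟩, ⟨j', h2⟩, ?_, h⟩
    rw [ne_eq, Fin.mk.injEq]
    exact hlt.ne

/-- Different words have conjugate values if and only if the number of one of them is the number of
a conjugate of the other. -/
theorem Classified.hasConjugatePair_iff {ids : KClass → ℕ} {W ws : List (List Letter)}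
    {s s' : State} (h : Classified ids W s s' 0) (hW : ws <+: W) :
    (∃ j j', j < j' ∧ j' < ws.length ∧ ∃ p, s'.arr (.vec p) j' = s'.arr (.vec 1) j) ↔
      HasConjugatePair ws := by
  rw [Grigorchuk.hasConjugatePair_iff]
  have hws : ∀ {j : ℕ} {w : List Letter}, ws[j]? = some w → W[j]? = some w := by
    obtain ⟨t, rfl⟩ := hW
    exact fun h => getElem?_append_of_eq_some h
  have key : ∀ {j j' : ℕ} {w w' : List Letter}, ws[j]? = some w → ws[j']? = some w' →
      ((∃ p, s'.arr (.vec p) j' = s'.arr (.vec 1) j) ↔ IsConj (wordVal w) (wordVal w')) := by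
    intro j j' w w' hw hw'
    have n1 := h.numbered j (Nat.zero_le _) w (hws hw)
    have n2 := h.numbered j' (Nat.zero_le _) w' (hws hw')
    rw [isConj_comm, isConj_iff_conjCls]
    refine exists_congr fun p => ?_
    rw [(n1 1).1, (n2 p).1, conjCls_one]
    exact ⟨fun e => h.table.cons.inj _ _ (n2 p).2 e, fun e => by rw [e]⟩
  constructor
  · rintro ⟨j, j', hlt, hN, hp⟩
    have hw := List.getElem?_eq_getElem (hlt.trans hN)
    have hw' := List.getElem?_eq_getElem hN
    exact ⟨j, j', _, _, hlt, hw, hw', (key hw hw').1 hp⟩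
  · rintro ⟨j, j', w, w', hlt, hw, hw', hc⟩
    exact ⟨j, j', hlt, (List.getElem?_eq_some_iff.1 hw').1, (key hw hw').2 hc⟩

theorem potential_le (ws : List (List Letter)) :
    potential ws ≤ 750 * totalLength ws + ws.length := by
  induction ws with
  | nil => simp [potential]
  | cons w ws ih =>
    rw [potential_cons, totalLength, List.map_cons, List.sum_cons, List.length_cons]
    have := weight_le_length w
    rw [totalLength] at ih
    omega

theorem reaches_conjugatePairs : ∃ D, ∀ ws : List (List Letter),
    Reaches conjugatePairs (.init (encode ws)) (D * (totalLength ws + 1)) fun s' =>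
      s'.reg .ans ≠ 0 ↔ HasConjugatePair ws := by
  set A := copyBody.cost + 1 with hA
  set B := nodeCost + 1 with hB
  set C := classifyBody.cost + 1 with hC
  set D := checkBody.cost + 1 with hD
  set E := initTable.cost with hE
  refine ⟨2 * A + 751 * B + 751 * C + D + E + 20, fun ws => ?_⟩
  set n := totalLength ws with hn
  have hbound : ∀ X : ℕ, ∀ k m, k ≤ m * (n + 1) → X * k ≤ m * X * (n + 1) := fun X k m h => by
    calc X * k ≤ X * (m * (n + 1)) := Nat.mul_le_mul_left _ h
      _ = m * X * (n + 1) := by ring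
  refine Reaches.mono (T := (1 + (A * (2 * n + 2) + 1)) +
      (1 + (1 + ((3 + (B * (751 * (n + 1)) + 1)) + ((E + 1 + (C * (751 * (n + 1)) + 1)) +
        (1 + (D * (n + 1) + 1))))))) (Reaches.seq (reaches_copy ws) ?_) ?_ fun _ h => h
  · rintro s (⟨hans, hne⟩ | ⟨hc, hh, hcnt, hans, hne⟩)
    · refine ⟨1 + 0, by omega, s, .ifz_pos (by omega) (.nop s), ?_⟩
      exact iff_of_true (by omega) (hasConjugatePair_of_numEmpty hne)
    · have hlen : ws.length ≤ n + 1 := (length_le_totalLength ws).trans (by omega)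
      have hpot : potential ws ≤ 751 * (n + 1) := (potential_le ws).trans (by omega)
      obtain ⟨t, ht, s', he, hQ⟩ : Reaches
          (.seq (.op (.move .roots .cnt)) (.seq reduceAll (.seq classifyAll checkRoots))) s
          (1 + ((3 + (B * (751 * (n + 1)) + 1)) + ((E + 1 + (C * (751 * (n + 1)) + 1)) +
            (1 + (D * (n + 1) + 1))))) fun s' => s'.reg .ans ≠ 0 ↔ HasConjugatePair ws := by
        refine Reaches.seq (P := fun s' => s' = (Op.move .roots .cnt).eval s)
          (Cmd.LoopFree.reaches (c := (.op (.move .roots .cnt) : Code)) trivial rfl) ?_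
        rintro _ rfl
        refine Reaches.seq ((reaches_reduceAll (ws := ws) (s := (Op.move .roots .cnt).eval s)
          ⟨hc.used, hc.odd, hc.row, hc.dict⟩ ⟨?_, hh.word⟩ ?_ [.roots, .ans] (by simp)).mono
          (Nat.add_le_add_left (Nat.add_le_add_right (Nat.mul_le_mul_left _ hpot) _) _)
          fun _ h => h) ?_
        · simp [Op.eval, hh.tail]
        · simp [Op.eval, hcnt]
        rintro s1 ⟨⟨W, hW, hc1, hcnt1, hWle, hok⟩, hreg⟩
        have hroots1 : s1.reg .roots = ws.length := by
          rw [hreg _ (by simp)]; simp [Op.eval, hcnt]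
        have hans1 : s1.reg .ans = 0 := by
          rw [hreg _ (by simp)]; simp [Op.eval, hans]
        refine Reaches.seq ((reaches_classifyAll hc1 hcnt1 hok).mono
          (Nat.add_le_add_left (Nat.add_le_add_right (Nat.mul_le_mul_left _
            (hWle.trans hpot)) _) _) fun _ h => h) ?_
        rintro s2 ⟨ids, h2⟩
        have hroots2 : s2.reg .roots = ws.length := by rw [h2.keeps.reg _ (by simp), hroots1]
        refine (reaches_checkRoots (s := s2) ?_ ?_).mono ?_ ?_
        · rw [h2.keeps.arr _ (by simp) (by simp), hc1.used]
        · rw [h2.keeps.reg _ (by simp), hans1]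
        · rw [hroots2]
          exact Nat.add_le_add_left (Nat.add_le_add_right (Nat.mul_le_mul_left _ hlen) _) _
        · intro s3 h3
          rw [h3, hroots2, h2.hasConjugatePair_iff hW]
      exact ⟨1 + t, by omega, s', .ifz_zero hans he, hQ⟩
  · have h1 := hbound A (2 * n + 2) 2 (by omega)
    have h2 := hbound B (751 * (n + 1)) 751 le_rfl
    have h3 := hbound C (751 * (n + 1)) 751 le_rfl
    have e : (2 * A + 751 * B + 751 * C + D + E + 20) * (n + 1) = 2 * A * (n + 1) +
        751 * B * (n + 1) + 751 * C * (n + 1) + D * (n + 1) + E * (n + 1) + 20 * (n + 1) := by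
      ring
    have h4 : E ≤ E * (n + 1) := Nat.le_mul_of_pos_right _ (by omega)
    omega

theorem encode_le (ws : List (List Letter)) : ∀ x ∈ encode ws, x ≤ 5 := by
  intro x hx
  simp only [encode, List.mem_flatMap, List.mem_append, List.mem_map, List.mem_singleton] at hx
  obtain ⟨w, -, ⟨z, -, rfl⟩ | rfl⟩ := hx
  · cases z <;> simp [Letter.code]
  · exact le_rfl

theorem numBound_le (A : Type) (C D n : ℕ) : numBound A C (D * (n + 1)) ≤
    (n + 2) ^ (width A * ((D + 1) * (C + D + 1) + 1) + 2) := by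
  set E := width A * ((D + 1) * (C + D + 1) + 1) with hE
  have h1 : D * (n + 1) + 1 ≤ (D + 1) * (n + 2) := by nlinarith
  have h2 : C + D * (n + 1) + 1 ≤ (C + D + 1) * (n + 2) := by nlinarith
  have h3 : (D * (n + 1) + 1) * (C + D * (n + 1) + 1) + 1 ≤
      ((D + 1) * (C + D + 1) + 1) * (n + 2) ^ 2 := by
    have := Nat.mul_le_mul h1 h2
    have h4 : 1 ≤ (n + 2) ^ 2 := Nat.one_le_pow _ _ (by omega)
    calc _ ≤ (D + 1) * (n + 2) * ((C + D + 1) * (n + 2)) + (n + 2) ^ 2 := by omega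
      _ = _ := by ring
  calc numBound A C (D * (n + 1)) ≤ E * (n + 2) ^ 2 := by
        rw [numBound, hE, mul_assoc]
        exact Nat.mul_le_mul_left _ h3
    _ ≤ (n + 2) ^ E * (n + 2) ^ 2 := by
        refine Nat.mul_le_mul_right _ ?_
        exact Nat.lt_two_pow_self.le.trans (Nat.pow_le_pow_left (by omega) _)
    _ = _ := (pow_add _ _ _).symm

end Grigorchuk

open Grigorchuk in
/-- The conjugate pair problem in the first Grigorchuk group is decided by a random access machine
in time `O(|w₁| + ⋯ + |w_k|)`, with numbers of `O(log (|w₁| + ⋯ + |w_k|))` bits. -/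
theorem mainTheorem1 :
    ∃ (Λ : Type) (_ : Finite Λ) (P : RAM.Program Λ) (C : ℕ),
      ∀ ws : List (List Letter), ∃ answer : Bool,
        (answer = true ↔ HasConjugatePair ws) ∧
        P.AnswersWithin (encode ws) (C * (totalLength ws + 1)) answer ∧
        P.NumbersBoundedBy (encode ws) ((totalLength ws + 2) ^ C) := by
  obtain ⟨D, hD⟩ := reaches_conjugatePairs
  obtain ⟨C₀, hC₀⟩ := conjugatePairs.exists_constLE
  have hc := RAM.Cmd.ConstLE.mono (Nat.le_max_left C₀ 5) hC₀
  set C := max C₀ 5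
  set E := RAM.width Arr * ((D + 1) * (C + D + 1) + 1)
  refine ⟨_, inferInstance, conjugatePairs.raw.program (RAM.rnum Reg.ans),
    (RAM.width Arr + 4) * D + 1 + (E + 2), fun ws => ?_⟩
  obtain ⟨t, ht, s', he, hQ⟩ := hD ws
  obtain ⟨⟨t', ht', h1⟩, h2⟩ :=
    he.answers hc (fun x hx => (encode_le ws x hx).trans (Nat.le_max_right _ _)) ht .ans
  refine ⟨_, ?_, ⟨t', ht'.trans ?_, h1⟩, fun t i => ?_⟩
  · simpa using hQ
  · nlinarith
  · have h3 : RAM.numBound Arr C (D * (totalLength ws + 1)) ≤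
        (totalLength ws + 2) ^ ((RAM.width Arr + 4) * D + 1 + (E + 2)) :=
      (numBound_le Arr C D _).trans (Nat.pow_le_pow_right (by omega) (by omega))
    exact ⟨(h2 t i).1.trans h3, (h2 t i).2.trans h3⟩
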